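/- Let $\Theta\subset\mathbb{C}^n$ be open, and for each $\theta\in\Theta$ let $(Z_t)_{t\in\mathbb{Z}}$ be, under a probability measure $P_\theta$, a mean-zero strictly stationary circular-symmetric complex-valued Gaussian process (the values at finitely many distinct times have a non-degenerate complex normal distribution, with density $\pi^{-N}|V|^{-1}e^{-(z-\mu)^*V^{-1}(z-\mu)}$ on $\mathbb{C}^N$) that satisfies the $\mathrm{ARMA}(r,s)$ equation $$Z_t=-\sum_{i=1}^{r}a_i(\theta)Z_{t-i}+\varepsilon_t+\sum_{i=1}^{s}b_i(\theta)\varepsilon_{t-i}\quad\text{almost surely, for all } t\in\mathbb{Z},$$ where $(\varepsilon_t)$ is complex Gaussian white noise with variance $\sigma^2(\theta)>0$. Assume causality and invertibility: all roots of $z^r(1+\sum_i a_i(\theta)z^{-i})$ and of $z^s(1+\sum_i b_i(\theta)z^{-i})$ lie in the open unit disk. Assume that $a_i,b_i,\sigma^2$ are three times continuously differentiable (in the real sense) on $\Theta$. Let $\gamma_h(\theta)=E_\theta[Z_{t+h}\overline{Z_t}]$, let $\Sigma=\Sigma^{(N)}_\theta=(\gamma_{s-t}(\theta))_{s,t=1}^{N}$,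 let $l=l^{(N)}_\theta(z)=-N\log\pi-\log|\Sigma|-z^*\Sigma^{-1}z$ be the log-likelihood of the observation $z=(Z_1,\dots,Z_N)$, and let $S=S_\theta(\omega)=\frac1{2\pi}\sum_{h\in\mathbb{Z}}\gamma_h(\theta)e^{-\sqrt{-1}h\omega}$ be the power spectral density. For $\alpha\in\{1,\dots,n,\bar1,\dots,\bar n\}$ let $\partial_\alpha$ be the Wirtinger derivative with respect to $\theta^i$ (if $\alpha=i$) or $\overline{\theta^i}$ (if $\alpha=\bar i$), and put $$g_{\alpha\beta}=\frac1{2\pi}\int_{-\pi}^{\pi}\frac{\partial_\alpha S}{S}\frac{\partial_\beta S}{S}\,d\omega,\qquad T_{\alpha\beta\gamma}=\frac1{\pi}\int_{-\pi}^{\pi}\frac{\partial_\alpha S}{S}\frac{\partial_\beta S}{S}\frac{\partial_\gamma S}{S}\,d\omega,\qquad \Gamma^{(m)}_{\alpha\beta,\gamma}=\frac1{2\pi}\int_{-\pi}^{\pi}\frac{\partial_\alpha\partial_\beta S}{S}\frac{\partial_\gamma S}{S}\,d\omega .$$ Then $\theta\mapsto l^{(N)}_\theta(z)$ and $\theta\mapsto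 S_\theta(\omega)$ are three times continuously differentiable on $\Theta$ for all $N,z,\omega$, the series $\sum_h\gamma_h(\theta)$ converges absolutely, all the integrals and expectations above and below exist, and for every $\theta\in\Theta$ and all $\alpha,\beta,\gamma\in\{1,\dots,n,\bar1,\dots,\bar n\}$, as $N\to\infty$, \begin{align*} \tfrac1N E_\theta[\partial_\alpha l]&=0\quad\text{(exactly, for every } N\ge1),\\ \tfrac1N E_\theta[\partial_\alpha\partial_\beta l]&=-g_{\alpha\beta}+O(N^{-1}),\\ \tfrac1N E_\theta[\partial_\alpha\partial_\beta\partial_\gamma l]&=-\Gamma^{(m)}_{\alpha\beta,\gamma}-\Gamma^{(m)}_{\beta\gamma,\alpha}-\Gamma^{(m)}_{\gamma\alpha,\beta}+2T_{\alpha\beta\gamma}+O(N^{-1}),\\ \tfrac1N E_\theta[(\partial_\alpha l)(\partial_\beta l)]&=g_{\alpha\beta}+O(N^{-1}),\\ \tfrac1N E_\theta[(\partial_\alpha\partial_\beta l)(\partial_\gamma l)]&=\Gamma^{(m)}_{\alpha\beta,\gamma}-T_{\alpha\beta\gamma}+O(N^{-1}),\\ \tfrac1N E_\theta[(\partial_\alpha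 l)(\partial_\beta l)(\partial_\gamma l)]&=T_{\alpha\beta\gamma}+O(N^{-1}). \end{align*} -/

import Mathlib

open MeasureTheory Asymptotics Filter
open scoped ComplexOrder

namespace ComplexARMA

noncomputable section

/-! ### Wirtinger derivatives -/

/-- The index set `{1, …, n, 1̄, …, n̄}`: `Sum.inl i` is `i`, `Sum.inr i` is `ī`. -/
abbrev Idx (n : ℕ) : Type := Fin n ⊕ Fin n

/-- The Wirtinger derivatives `∂_i = (∂/∂xⁱ - √-1 ∂/∂yⁱ) / 2` and
`∂_ī = (∂/∂xⁱ + √-1 ∂/∂yⁱ) / 2` of a complex-valued function on `ℂⁿ`. -/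
def wirtinger {n : ℕ} (α : Idx n) (f : (Fin n → ℂ) → ℂ) (θ : Fin n → ℂ) : ℂ :=
  match α with
  | Sum.inl i => (1 / 2 : ℂ) * (lineDeriv ℝ f θ (Pi.single i 1)
      - Complex.I * lineDeriv ℝ f θ (Pi.single i Complex.I))
  | Sum.inr i => (1 / 2 : ℂ) * (lineDeriv ℝ f θ (Pi.single i 1)
      + Complex.I * lineDeriv ℝ f θ (Pi.single i Complex.I))

/-! ### Complex normal distributions and Gaussian processes -/

/-- The density of the (circular-symmetric) complex normal distribution with mean `m` and
variance-covariance matrix `V`. -/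
def complexNormalPDF {N : ℕ} (m : Fin N → ℂ) (V : Matrix (Fin N) (Fin N) ℂ)
    (z : Fin N → ℂ) : ℝ :=
  1 / (Real.pi ^ N * V.det.re) * Real.exp (-(star (z - m) ⬝ᵥ (V⁻¹.mulVec (z - m))).re)

/-- The complex normal distribution with mean `m` and variance-covariance matrix `V`, by its
density with respect to Lebesgue measure on `ℂᴺ`. -/
def complexNormal {N : ℕ} (m : Fin N → ℂ) (V : Matrix (Fin N) (Fin N) ℂ) :
    Measure (Fin N → ℂ) :=
  (volume : Measure (Fin N → ℂ)).withDensity fun z => ENNReal.ofReal (complexNormalPDF m V z)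

/-- Complex-valued circular-symmetric discrete Gaussian process: the vector of values at any
finitely many distinct times has a complex normal distribution. -/
structure IsComplexGaussianProcess {Ω : Type*} [MeasurableSpace Ω] (P : Measure Ω)
    (Z : ℤ → Ω → ℂ) : Prop where
  aemeasurable : ∀ t : ℤ, AEMeasurable (Z t) P
  normal : ∀ (N : ℕ) (t : Fin N → ℤ), Function.Injective t →
    ∃ (m : Fin N → ℂ) (V : Matrix (Fin N) (Fin N) ℂ), V.PosDef ∧
      P.map (fun ω j => Z (t j) ω) = complexNormal m V

/-- Complex Gaussian white noise with variance `σ2`: after division by the standard deviation,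
the values at any finitely many distinct times follow a standard complex normal distribution. -/
structure IsComplexWhiteNoise {Ω : Type*} [MeasurableSpace Ω] (P : Measure Ω)
    (ε : ℤ → Ω → ℂ) (σ2 : ℝ) : Prop where
  aemeasurable : ∀ t : ℤ, AEMeasurable (ε t) P
  normal : ∀ (N : ℕ) (t : Fin N → ℤ), Function.Injective t →
    P.map (fun ω j => ε (t j) ω / (Real.sqrt σ2 : ℂ)) = complexNormal 0 1

/-- Strong (strict) stationarity: finite-dimensional distributions are invariant under time
shifts. -/
def IsStronglyStationary {Ω : Type*} [MeasurableSpace Ω] (P : Measure Ω)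
    (Z : ℤ → Ω → ℂ) : Prop :=
  ∀ (N : ℕ) (t : Fin N → ℤ) (h : ℤ),
    P.map (fun ω j => Z (t j + h) ω) = P.map (fun ω j => Z (t j) ω)

/-! ### ARMA processes -/

/-- All roots of `z ^ r * (1 + c₁ z⁻¹ + ⋯ + c_r z⁻ʳ)` lie in the open unit disk, where `c i`
stands for the coefficient with (one-based) index `i + 1`. -/
def RootsInUnitDisk {r : ℕ} (c : Fin r → ℂ) : Prop :=
  ∀ z : ℂ, z ^ r + ∑ i : Fin r, c i * z ^ (r - (i.val + 1)) = 0 → ‖z‖ < 1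

/-- `Z` is a mean-zero, stationary, causal and invertible complex-valued Gaussian
`ARMA(r, s)` process with autoregressive coefficients `a`, moving average coefficients `b` and
noise variance `σ2`:
`Z_t = - ∑ a_i Z_{t-i} + ε_t + ∑ b_i ε_{t-i}` for a complex Gaussian white noise `ε`. -/
structure IsARMA {Ω : Type*} [MeasurableSpace Ω] (P : Measure Ω) (Z : ℤ → Ω → ℂ)
    {r s : ℕ} (a : Fin r → ℂ) (b : Fin s → ℂ) (σ2 : ℝ) : Prop where
  isProbabilityMeasure : IsProbabilityMeasure P
  gaussian : IsComplexGaussianProcess P Z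
  stationary : IsStronglyStationary P Z
  mean_zero : ∀ t : ℤ, ∫ ω, Z t ω ∂P = 0
  variance_pos : 0 < σ2
  causal : RootsInUnitDisk a
  invertible : RootsInUnitDisk b
  recursion : ∃ ε : ℤ → Ω → ℂ, IsComplexWhiteNoise P ε σ2 ∧
    ∀ t : ℤ, ∀ᵐ ω ∂P, Z t ω = -(∑ i : Fin r, a i * Z (t - ((i.val : ℤ) + 1)) ω)
      + ε t ω + ∑ i : Fin s, b i * ε (t - ((i.val : ℤ) + 1)) ω

/-- The autocovariance `γ_h` of a mean-zero stationary process: the covariance of `Z_{t+h}` and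
`Z_t`, which does not depend on `t`. -/
def autocov {Ω : Type*} [MeasurableSpace Ω] (P : Measure Ω) (Z : ℤ → Ω → ℂ) (h : ℤ) : ℂ :=
  ∫ ω, Z h ω * (starRingEnd ℂ) (Z 0 ω) ∂P

/-- The variance-covariance matrix of size `N`, with `(s, t)` entry `γ_{s-t}`. -/
def covMatrix (γ : ℤ → ℂ) (N : ℕ) : Matrix (Fin N) (Fin N) ℂ :=
  Matrix.of fun s t => γ ((s.val : ℤ) - (t.val : ℤ))

/-- The power spectral density `S(ω) = (2π)⁻¹ ∑_h γ_h exp(-√-1 h ω)`. -/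
def spectralDensity (γ : ℤ → ℂ) (ω : ℝ) : ℂ :=
  (1 / (2 * Real.pi) : ℂ) * ∑' h : ℤ, γ h * Complex.exp (-(Complex.I * (h : ℂ) * (ω : ℂ)))

/-- The log-likelihood `l(z) = -N log π - log |Σ| - z* Σ⁻¹ z`, `Σ = covMatrix γ N`. -/
def logLikelihood (γ : ℤ → ℂ) (N : ℕ) (z : Fin N → ℂ) : ℝ :=
  -(N : ℝ) * Real.log Real.pi - Real.log (covMatrix γ N).det.re
    - (star z ⬝ᵥ ((covMatrix γ N)⁻¹.mulVec z)).re

/-- The distribution of the observation `(Z_1, …, Z_N)`. -/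
def obsLaw {Ω : Type*} [MeasurableSpace Ω] (P : Measure Ω) (Z : ℤ → Ω → ℂ) (N : ℕ) :
    Measure (Fin N → ℂ) :=
  P.map fun ω (j : Fin N) => Z ((j.val : ℤ) + 1) ω

/-! ### Parametrized families -/

section Family

variable {Ω : Type*} [MeasurableSpace Ω] {n : ℕ}

/-- `S(ω | θ)` for the family of processes `Z θ` under `P θ`. -/
def specFamily (P : (Fin n → ℂ) → Measure Ω) (Z : (Fin n → ℂ) → ℤ → Ω → ℂ)
    (θ : Fin n → ℂ) (ω : ℝ) : ℂ :=
  spectralDensity (autocov (P θ) (Z θ)) ω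

/-- The log-likelihood of the observation `z`, as a (complex-valued) function of `θ`. -/
def logLik (P : (Fin n → ℂ) → Measure Ω) (Z : (Fin n → ℂ) → ℤ → Ω → ℂ)
    (N : ℕ) (z : Fin N → ℂ) (θ : Fin n → ℂ) : ℂ :=
  (logLikelihood (autocov (P θ) (Z θ)) N z : ℂ)

/-- The expectation `E_θ[f(z)]` over the observation `z` of size `N` at the parameter `θ`. -/
def expect (P : (Fin n → ℂ) → Measure Ω) (Z : (Fin n → ℂ) → ℤ → Ω → ℂ)
    (θ : Fin n → ℂ) (N : ℕ) (f : (Fin N → ℂ) → ℂ) : ℂ :=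
  ∫ z, f z ∂(obsLaw (P θ) (Z θ) N)

end Family

/-! ### Spectral quantities -/

section Spectral

variable {n : ℕ} (S : (Fin n → ℂ) → ℝ → ℂ)

/-- `S⁻¹ ∂_α S`, at `(θ, ω)`. -/
def S₁ (α : Idx n) (θ : Fin n → ℂ) (ω : ℝ) : ℂ :=
  (S θ ω)⁻¹ * wirtinger α (fun θ' => S θ' ω) θ

/-- `S⁻¹ ∂_α ∂_β S`, at `(θ, ω)`. -/
def S₂ (α β : Idx n) (θ : Fin n → ℂ) (ω : ℝ) : ℂ :=
  (S θ ω)⁻¹ * wirtinger α (wirtinger β (fun θ' => S θ' ω)) θ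

/-- The Fisher metric `g_{αβ} = M_{α,β} = (2π)⁻¹ ∫ (S⁻¹ ∂_α S) (S⁻¹ ∂_β S) dω`. -/
def fisherMetric (α β : Idx n) (θ : Fin n → ℂ) : ℂ :=
  (1 / (2 * Real.pi) : ℂ) * ∫ ω in (-Real.pi)..Real.pi, S₁ S α θ ω * S₁ S β θ ω

/-- The skewness tensor `T_{αβγ} = 2 M_{α,β,γ}`. -/
def skewness (α β γ : Idx n) (θ : Fin n → ℂ) : ℂ :=
  2 * ((1 / (2 * Real.pi) : ℂ) *
    ∫ ω in (-Real.pi)..Real.pi, S₁ S α θ ω * S₁ S β θ ω * S₁ S γ θ ω)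

/-- The coefficients `Γ^(m)_{αβ,γ} = M_{αβ,γ} = (2π)⁻¹ ∫ (S⁻¹ ∂_α ∂_β S) (S⁻¹ ∂_γ S) dω` of the
mixture connection. -/
def mConnection (α β γ : Idx n) (θ : Fin n → ℂ) : ℂ :=
  (1 / (2 * Real.pi) : ℂ) * ∫ ω in (-Real.pi)..Real.pi, S₂ S α β θ ω * S₁ S γ θ ω

end Spectral

end

end ComplexARMA

open ComplexARMA

/-!
Asymptotic expansion of the expected log-likelihood derivatives of complex Gaussian ARMA models.

*Reduction to Toeplitz matrices.* By the Yule–Walker equations the autocovariances satisfy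
`|a|² * γ = σ² |b|²` for convolution. Since `a` has no zeros on the unit circle, `1 / |a|²` has
summable Fourier coefficients, so the only bounded solution `γ` consists of the Fourier coefficients
of the symbol `F = σ² |b|² / |a|²` (`eq_coef_armaSymbol`, `IsARMA.autocov_eq`). Hence `F = 2π S`, and
the covariance matrix of the observation is the Toeplitz matrix `Σ = T_N(F)`. As a map from the
parameters to the Banach algebra of continuous functions on the circle, `F` is three times
continuously differentiable, and its derivatives are smooth in the frequency
(`smoothFamily_armaSymbol`).

*Exact expectations.* Wirtinger derivatives are taken in Banach spaces (`wd`, `HasWd`), so that they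
commute with the continuous linear map `T_N` and obey the product rule in the noncommutative algebra
of matrices. Jacobi's formula (`hasFDerivAt_det`) and the derivative of the inverse show that each
derivative of the log-likelihood up to order three has the form `z* (K Σ⁻¹) z - c`. Stein's identity
(`stein_identity`) gives the moments of such forms: for centred ones the covariance is `tr(KL)` and
the third cumulant is `tr(KLM) + tr(KML)` (`integral_quadForm_sub_mul`,
`integral_quadForm_sub_mul_mul`). All six expectations thereby become traces of products of at most
three factors `Σ⁻¹ T_N(g)`, with `g` a first or second derivative of `F`.

*Trace asymptotics.* For smooth `u` and `v` the entries of `T_N(u) T_N(v) - T_N(uv)` are absolutely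
summable, uniformly in `N` (`sum_norm_toep_mul_sub_le`), which bounds this difference in the trace
norm. As `F` is bounded below by a positive constant, so are the quadratic forms of `T_N(F)`, and
`Σ⁻¹` is bounded in operator norm (`norm_inv_toep_le`). Therefore `Σ⁻¹ T_N(g)` differs from
`T_N(g / F)` by a matrix of bounded trace norm, products of such matrices behave alike, and
`tr T_N(h)` is `N` times the mean of `h` (`PosSymbol.trace_two`, `PosSymbol.trace_three`). Division
by `N` leaves the spectral integrals and an error `O(1 / N)`.
-/

/-! ### Integration by parts for complex normal distributions -/

namespace ComplexARMA

open Matrix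

variable {N : ℕ}

/-- A positive definite form is coercive, here with respect to the sup norm of `Fin N → ℂ`. -/
lemma posDef_quadratic_lower_bound {B : Matrix (Fin N) (Fin N) ℂ} (hB : B.PosDef) :
    ∃ c : ℝ, 0 < c ∧ ∀ z : Fin N → ℂ, c * ‖z‖ ^ 2 ≤ (star z ⬝ᵥ (B *ᵥ z)).re := by
  have hcont : Continuous fun z : Fin N → ℂ => (star z ⬝ᵥ (B *ᵥ z)).re := by
    fun_prop
  -- the unit sphere is empty exactly when `N = 0`
  rcases (Metric.sphere (0 : Fin N → ℂ) 1).eq_empty_or_nonempty with he | hne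
  · refine ⟨1, one_pos, fun z => ?_⟩
    have hz : z = 0 := by
      by_contra hz
      have : (((‖z‖⁻¹ : ℝ) : ℂ) • z) ∈ Metric.sphere (0 : Fin N → ℂ) 1 := by
        simp [norm_smul, hz]
      simp [he] at this
    simp [hz]
  · obtain ⟨x, hx, hmin⟩ := (isCompact_sphere (0 : Fin N → ℂ) 1).exists_isMinOn hne
      hcont.continuousOn
    have hx0 : x ≠ 0 := by
      rintro rfl
      simp at hx
    refine ⟨_, (Complex.lt_def.1 (hB.dotProduct_mulVec_pos hx0)).1, fun z => ?_⟩
    rcases eq_or_ne z 0 with rfl | hz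
    · simp
    · have hy : (((‖z‖⁻¹ : ℝ) : ℂ) • z) ∈ Metric.sphere (0 : Fin N → ℂ) 1 := by
        simp [norm_smul, hz]
      have h := hmin hy
      simp only [Set.mem_ofPred_eq] at h
      have e : (star (((‖z‖⁻¹ : ℝ) : ℂ) • z) ⬝ᵥ (B *ᵥ (((‖z‖⁻¹ : ℝ) : ℂ) • z))).re
          = (‖z‖ ^ 2)⁻¹ * (star z ⬝ᵥ (B *ᵥ z)).re := by
        rw [star_smul, mulVec_smul, smul_dotProduct, dotProduct_smul, smul_smul]
        have : star ((‖z‖⁻¹ : ℝ) : ℂ) * ((‖z‖⁻¹ : ℝ) : ℂ) = (((‖z‖ ^ 2)⁻¹ : ℝ) : ℂ) := by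
          rw [Complex.star_def, Complex.conj_ofReal]
          push_cast
          ring
        rw [this, smul_eq_mul, Complex.re_ofReal_mul]
      rw [e] at h
      have hp : 0 < ‖z‖ ^ 2 := by positivity
      calc _ ≤ ((‖z‖ ^ 2)⁻¹ * (star z ⬝ᵥ (B *ᵥ z)).re) * ‖z‖ ^ 2 := by
            exact mul_le_mul_of_nonneg_right h hp.le
        _ = _ := by field_simp

lemma complexNormalPDF_nonneg {m : Fin N → ℂ} {V : Matrix (Fin N) (Fin N) ℂ} (hV : V.PosDef)
    (z : Fin N → ℂ) : 0 ≤ complexNormalPDF m V z := by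
  have := (Complex.lt_def.1 hV.det_pos).1
  unfold complexNormalPDF
  simp only [Complex.zero_re] at this
  positivity

lemma continuous_complexNormalPDF (m : Fin N → ℂ) (V : Matrix (Fin N) (Fin N) ℂ) :
    Continuous (complexNormalPDF m V) := by
  unfold complexNormalPDF
  fun_prop

lemma integral_complexNormal {m : Fin N → ℂ} {V : Matrix (Fin N) (Fin N) ℂ} (hV : V.PosDef)
    (f : (Fin N → ℂ) → ℂ) :
    ∫ z, f z ∂complexNormal m V = ∫ z, f z * (complexNormalPDF m V z : ℂ) := by
  unfold complexNormal
  rw [integral_withDensity_eq_integral_toReal_smul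
    (continuous_complexNormalPDF m V).measurable.ennreal_ofReal (by simp)]
  refine integral_congr_ae (ae_of_all _ fun z => ?_)
  simp [ENNReal.toReal_ofReal (complexNormalPDF_nonneg hV z), mul_comm]

lemma integrable_complexNormal_iff {m : Fin N → ℂ} {V : Matrix (Fin N) (Fin N) ℂ} (hV : V.PosDef)
    (f : (Fin N → ℂ) → ℂ) :
    Integrable f (complexNormal m V) ↔ Integrable fun z => f z * (complexNormalPDF m V z : ℂ) := by
  unfold complexNormal
  rw [integrable_withDensity_iff_integrable_smul'
    (continuous_complexNormalPDF m V).measurable.ennreal_ofReal (by simp)]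
  refine integrable_congr (ae_of_all _ fun z => ?_)
  simp [ENNReal.toReal_ofReal (complexNormalPDF_nonneg hV z), mul_comm]

/-- A Gaussian density beats polynomial growth. -/
lemma integrable_mul_complexNormalPDF {V : Matrix (Fin N) (Fin N) ℂ} (hV : V.PosDef)
    {f : (Fin N → ℂ) → ℂ} (hf : Continuous f) {C : ℝ} {k : ℕ}
    (hb : ∀ z, ‖f z‖ ≤ C * (1 + ‖z‖) ^ k) :
    Integrable fun z => f z * (complexNormalPDF 0 V z : ℂ) := by
  obtain ⟨c, hc, hq⟩ := posDef_quadratic_lower_bound hV.inv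
  set d : ℕ := Module.finrank ℝ (Fin N → ℂ) + 1 with hd
  set K : ℝ := 1 / (Real.pi ^ N * V.det.re)
  have hK : 0 ≤ K := by
    have := (Complex.lt_def.1 hV.det_pos).1
    simp only [Complex.zero_re] at this
    positivity
  have hC : 0 ≤ C := by simpa using (norm_nonneg _).trans (hb 0)
  have hint : Integrable (fun z : Fin N → ℂ => (1 + ‖z‖) ^ (-(d : ℝ))) :=
    integrable_one_add_norm (by rw [hd]; push_cast; linarith)
  -- `m t - c t ^ 2 ≤ m ^ 2 / (4 c)`, so that the weight `(1 + ‖z‖) ^ (k + d)` is absorbed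
  set m : ℝ := ((k + d : ℕ) : ℝ)
  refine (hint.const_mul (C * K * Real.exp (m ^ 2 / (4 * c)))).mono'
    ((hf.mul (Complex.continuous_ofReal.comp
      (continuous_complexNormalPDF 0 V))).aestronglyMeasurable) (ae_of_all _ fun z => ?_)
  have h1 : (0 : ℝ) < 1 + ‖z‖ := by positivity
  have hE : (1 + ‖z‖) ^ (k + d) * Real.exp (-(c * ‖z‖ ^ 2)) ≤ Real.exp (m ^ 2 / (4 * c)) := by
    have : (1 + ‖z‖) ^ (k + d) ≤ Real.exp (m * ‖z‖) := by
      rw [Real.exp_nat_mul]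
      gcongr
      rw [add_comm]
      exact Real.add_one_le_exp _
    calc _ ≤ Real.exp (m * ‖z‖) * Real.exp (-(c * ‖z‖ ^ 2)) := by gcongr
      _ = Real.exp (m * ‖z‖ - c * ‖z‖ ^ 2) := by rw [← Real.exp_add]; ring_nf
      _ ≤ _ := by
        gcongr
        have : m ^ 2 / (4 * c) - (m * ‖z‖ - c * ‖z‖ ^ 2) = (2 * c * ‖z‖ - m) ^ 2 / (4 * c) := by
          field_simp
          ring
        have h0 : 0 ≤ (2 * c * ‖z‖ - m) ^ 2 / (4 * c) := by positivity
        linarith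
  have hp : complexNormalPDF 0 V z ≤ K * Real.exp (-(c * ‖z‖ ^ 2)) := by
    unfold complexNormalPDF
    gcongr
    simpa using hq z
  rw [norm_mul, Complex.norm_real, Real.norm_of_nonneg (complexNormalPDF_nonneg hV z)]
  rw [Real.rpow_neg h1.le, Real.rpow_natCast]
  calc ‖f z‖ * complexNormalPDF 0 V z
      ≤ (C * (1 + ‖z‖) ^ k) * (K * Real.exp (-(c * ‖z‖ ^ 2))) :=
        mul_le_mul (hb z) hp (complexNormalPDF_nonneg hV z) (by positivity)
    _ = C * K * ((1 + ‖z‖) ^ (k + d) * Real.exp (-(c * ‖z‖ ^ 2))) * ((1 + ‖z‖) ^ d)⁻¹ := by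
        rw [pow_add]
        field_simp
    _ ≤ C * K * Real.exp (m ^ 2 / (4 * c)) * ((1 + ‖z‖) ^ d)⁻¹ := by gcongr

lemma integrable_of_hasTemperateGrowth {V : Matrix (Fin N) (Fin N) ℂ} (hV : V.PosDef)
    {f : (Fin N → ℂ) → ℂ} (hf : f.HasTemperateGrowth) : Integrable f (complexNormal 0 V) := by
  obtain ⟨k, C, h⟩ := hf.2 0
  exact (integrable_complexNormal_iff hV f).2
    (integrable_mul_complexNormalPDF hV hf.1.continuous (C := C) (k := k) (by simpa using h))

@[fun_prop]
lemma hasTemperateGrowth_coord (i : Fin N) :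
    Function.HasTemperateGrowth fun z : Fin N → ℂ => z i :=
  (ContinuousLinearMap.proj (R := ℝ) (φ := fun _ : Fin N => ℂ) i).hasTemperateGrowth

@[fun_prop]
lemma hasTemperateGrowth_conj_coord (i : Fin N) :
    Function.HasTemperateGrowth fun z : Fin N → ℂ => star (z i) :=
  ((Complex.conjCLE : ℂ →L[ℝ] ℂ).comp
    (ContinuousLinearMap.proj (R := ℝ) (φ := fun _ : Fin N => ℂ) i)).hasTemperateGrowth

/-- The complex-linear part of the derivative of `G` at `z`, in the direction `v`. -/
noncomputable def holDeriv (G : (Fin N → ℂ) → ℂ) (z v : Fin N → ℂ) : ℂ :=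
  (1 / 2 : ℂ) * (fderiv ℝ G z v - Complex.I * fderiv ℝ G z (Complex.I • v))

lemma integrable_fderiv_of_hasTemperateGrowth {V : Matrix (Fin N) (Fin N) ℂ} (hV : V.PosDef)
    {G : (Fin N → ℂ) → ℂ} (hG : G.HasTemperateGrowth) (v : Fin N → ℂ) :
    Integrable (fun z => fderiv ℝ G z v) (complexNormal 0 V) := by
  obtain ⟨k, C, h⟩ := hG.2 1
  refine (integrable_complexNormal_iff hV _).2
    (integrable_mul_complexNormalPDF hV ?_ (C := C * ‖v‖) (k := k) fun z => ?_)
  · exact (hG.1.continuous_fderiv (by simp)).clm_apply continuous_const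
  · calc _ ≤ ‖fderiv ℝ G z‖ * ‖v‖ := ContinuousLinearMap.le_opNorm _ _
      _ ≤ (C * (1 + ‖z‖) ^ k) * ‖v‖ := by
          gcongr
          simpa [norm_iteratedFDeriv_one] using h z
      _ = _ := by ring

lemma hasLineDerivAt_complexNormalPDF {V : Matrix (Fin N) (Fin N) ℂ} (z v : Fin N → ℂ) :
    HasLineDerivAt ℝ (fun z => (complexNormalPDF 0 V z : ℂ))
      (-(((star v ⬝ᵥ (V⁻¹ *ᵥ z)).re + (star z ⬝ᵥ (V⁻¹ *ᵥ v)).re : ℝ) : ℂ)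
        * (complexNormalPDF 0 V z : ℂ)) z v := by
  have e : ∀ t : ℝ, (star (z + t • v) ⬝ᵥ (V⁻¹ *ᵥ (z + t • v))).re
      = (star z ⬝ᵥ (V⁻¹ *ᵥ z)).re
        + t * ((star v ⬝ᵥ (V⁻¹ *ᵥ z)).re + (star z ⬝ᵥ (V⁻¹ *ᵥ v)).re)
        + t ^ 2 * (star v ⬝ᵥ (V⁻¹ *ᵥ v)).re := by
    intro t
    have ht : (t • v : Fin N → ℂ) = (t : ℂ) • v := by
      ext i
      simp
    rw [ht, star_add, star_smul, mulVec_add, mulVec_smul]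
    simp only [add_dotProduct, dotProduct_add, smul_dotProduct, dotProduct_smul, smul_eq_mul,
      Complex.star_def, Complex.conj_ofReal, Complex.add_re, Complex.re_ofReal_mul]
    ring
  unfold HasLineDerivAt
  have h : HasDerivAt (fun t : ℝ => complexNormalPDF 0 V (z + t • v))
      (-((star v ⬝ᵥ (V⁻¹ *ᵥ z)).re + (star z ⬝ᵥ (V⁻¹ *ᵥ v)).re) * complexNormalPDF 0 V z) 0 := by
    unfold complexNormalPDF
    simp only [sub_zero, e]
    set A := (star z ⬝ᵥ (V⁻¹ *ᵥ z)).re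
    set B := (star v ⬝ᵥ (V⁻¹ *ᵥ z)).re + (star z ⬝ᵥ (V⁻¹ *ᵥ v)).re
    set D := (star v ⬝ᵥ (V⁻¹ *ᵥ v)).re
    have h1 : HasDerivAt (fun t : ℝ => -(A + t * B + t ^ 2 * D)) (-B) 0 := by
      have h2 := ((((hasDerivAt_id' (0 : ℝ)).mul_const B).const_add A).fun_add
        (((hasDerivAt_id' (0 : ℝ)).fun_pow 2).mul_const D)).fun_neg
      simpa using h2
    have h3 := (h1.exp).const_mul (1 / (Real.pi ^ N * V.det.re))
    convert! h3 using 1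
    simp
    ring
  have := h.ofReal_comp
  simpa using this

/-- **Stein's identity** for the centred complex normal distribution. Integration by parts in the
real directions `v` and `√-1 v`, with `V⁻¹ v` the `j`-th coordinate vector, brings down the factors
`2 Re z_j` and `2 Im z_j`, whose combination is `2 conj z_j`. -/
theorem stein_identity {V : Matrix (Fin N) (Fin N) ℂ} (hV : V.PosDef)
    {G : (Fin N → ℂ) → ℂ} (hG : G.HasTemperateGrowth) (j : Fin N) :
    ∫ z, star (z j) * G z ∂complexNormal 0 V
      = ∫ z, holDeriv G z (V *ᵥ Pi.single j 1) ∂complexNormal 0 V := by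
  have hdet : IsUnit V.det := hV.det_pos.ne'.isUnit
  have hHerm : (V⁻¹).IsHermitian := hV.inv.isHermitian
  have hl : ∀ v : Fin N → ℂ, Function.HasTemperateGrowth fun z : Fin N → ℂ =>
      (((star v ⬝ᵥ (V⁻¹ *ᵥ z)).re + (star z ⬝ᵥ (V⁻¹ *ᵥ v)).re : ℝ) : ℂ) := by
    intro v
    have : (fun z : Fin N → ℂ =>
        (((star v ⬝ᵥ (V⁻¹ *ᵥ z)).re + (star z ⬝ᵥ (V⁻¹ *ᵥ v)).re : ℝ) : ℂ))
        = fun z => star v ⬝ᵥ (V⁻¹ *ᵥ z) + star z ⬝ᵥ (V⁻¹ *ᵥ v) := by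
      ext z
      have h : star (star v ⬝ᵥ (V⁻¹ *ᵥ z)) = star z ⬝ᵥ (V⁻¹ *ᵥ v) := by
        rw [← star_dotProduct_star, star_star, star_mulVec, hHerm.eq, dotProduct_mulVec,
          dotProduct_comm]
      rw [← h]
      apply Complex.ext <;> simp
    rw [this]
    simp only [dotProduct, mulVec, Pi.star_apply]
    fun_prop
  have hint := fun v => integrable_of_hasTemperateGrowth hV ((hl v).mul hG)
  -- integration by parts in an arbitrary real direction
  have key : ∀ v : Fin N → ℂ, ∫ z, fderiv ℝ G z v ∂complexNormal 0 V
      = ∫ z, (((star v ⬝ᵥ (V⁻¹ *ᵥ z)).re + (star z ⬝ᵥ (V⁻¹ *ᵥ v)).re : ℝ) : ℂ) * G z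
        ∂complexNormal 0 V := by
    intro v
    have h := integral_bilinear_hasLineDerivAt_right_eq_neg_left_of_integrable
      (μ := (volume : Measure (Fin N → ℂ))) (B := ContinuousLinearMap.mul ℝ ℂ) (v := v)
      (f := G) (f' := fun z => fderiv ℝ G z v)
      (g := fun z => (complexNormalPDF 0 V z : ℂ))
      (g' := fun z => -(((star v ⬝ᵥ (V⁻¹ *ᵥ z)).re + (star z ⬝ᵥ (V⁻¹ *ᵥ v)).re : ℝ) : ℂ)
        * (complexNormalPDF 0 V z : ℂ))
      ((integrable_complexNormal_iff hV _).1 (integrable_fderiv_of_hasTemperateGrowth hV hG v))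
      (by
        refine (((integrable_complexNormal_iff hV _).1
          (hint v)).neg).congr (ae_of_all _ fun z => ?_)
        simp
        ring)
      ((integrable_complexNormal_iff hV _).1 (integrable_of_hasTemperateGrowth hV hG))
      (fun z _ => ((hG.1.differentiable (by simp)) z).hasFDerivAt.hasLineDerivAt v)
      (fun z _ => hasLineDerivAt_complexNormalPDF z v)
    rw [integral_complexNormal hV, integral_complexNormal hV, ← neg_inj]
    simp only [ContinuousLinearMap.mul_apply'] at h
    rw [← h, ← integral_neg]
    refine integral_congr_ae (ae_of_all _ fun z => ?_)
    simp only
    ring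
  set v : Fin N → ℂ := V *ᵥ Pi.single j 1
  have hv : V⁻¹ *ᵥ v = Pi.single j 1 := by
    rw [mulVec_mulVec, nonsing_inv_mul V hdet, one_mulVec]
  have hv' : ∀ z, star v ⬝ᵥ (V⁻¹ *ᵥ z) = z j := by
    intro z
    rw [dotProduct_mulVec]
    have : star v ᵥ* V⁻¹ = star (V⁻¹ *ᵥ v) := by rw [star_mulVec (V⁻¹) v, hHerm.eq]
    rw [this, hv, ← Pi.single_star]
    simp
  have hv2 : ∀ z, star z ⬝ᵥ (V⁻¹ *ᵥ v) = star (z j) := by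
    intro z
    rw [hv]
    simp
  have i1 := integrable_fderiv_of_hasTemperateGrowth hV hG v
  have i2 := integrable_fderiv_of_hasTemperateGrowth hV hG (Complex.I • v)
  have k1 := key v
  have k2 := key (Complex.I • v)
  have j1 := hint v
  have j2 := hint (Complex.I • v)
  simp only [star_smul, smul_dotProduct, mulVec_smul, dotProduct_smul, hv', hv2, Pi.mul_def]
    at k1 k2 j1 j2
  unfold holDeriv
  rw [integral_const_mul, integral_sub i1 (i2.const_mul _), integral_const_mul, k1, k2,
    ← integral_const_mul, ← integral_sub j1 (j2.const_mul _), ← integral_const_mul]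
  refine integral_congr_ae (ae_of_all _ fun z => ?_)
  simp only
  rw [show (star (z j) : ℂ) = (z j).re - (z j).im * Complex.I by
    apply Complex.ext <;> simp]
  simp
  ring_nf

end ComplexARMA

/-! ### Moments of quadratic forms -/

namespace ComplexARMA

open Matrix

variable {N : ℕ}

lemma holDeriv_mul {f g : (Fin N → ℂ) → ℂ} {z : Fin N → ℂ} (hf : DifferentiableAt ℝ f z)
    (hg : DifferentiableAt ℝ g z) (v : Fin N → ℂ) :
    holDeriv (fun z => f z * g z) z v = holDeriv f z v * g z + f z * holDeriv g z v := by
  unfold holDeriv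
  rw [fderiv_fun_mul hf hg]
  simp
  ring

lemma holDeriv_smul (f : (Fin N → ℂ) → ℂ) (z : Fin N → ℂ) (c : ℂ) (v : Fin N → ℂ) :
    holDeriv f z (c • v) = c * holDeriv f z v := by
  have hc : ∀ w : Fin N → ℂ, c • w = c.re • w + c.im • (Complex.I • w) := by
    intro w
    ext i
    simp only [Pi.smul_apply, Pi.add_apply, smul_eq_mul, Complex.real_smul]
    linear_combination (-(w i)) * Complex.re_add_im c
  have hI : Complex.I • (c • v) = c.re • (Complex.I • v) - c.im • v := by
    rw [smul_comm, hc, smul_smul Complex.I, Complex.I_mul_I]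
    ext i
    simp
    ring
  unfold holDeriv
  rw [hI, hc v]
  simp only [map_add, map_sub, ContinuousLinearMap.map_smul_of_tower, Complex.real_smul]
  linear_combination (1 / 2 * (fderiv ℝ f z v - Complex.I * fderiv ℝ f z (Complex.I • v)))
    * Complex.re_add_im c + (1 / 2 * (c.im : ℂ) * fderiv ℝ f z (Complex.I • v)) * Complex.I_sq

lemma holDeriv_sum {ι : Type*} (s : Finset ι) (f : (Fin N → ℂ) → ℂ) (z : Fin N → ℂ)
    (v : ι → Fin N → ℂ) :
    holDeriv f z (∑ i ∈ s, v i) = ∑ i ∈ s, holDeriv f z (v i) := by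
  unfold holDeriv
  rw [Finset.smul_sum, map_sum, map_sum, Finset.mul_sum, ← Finset.sum_sub_distrib,
    Finset.mul_sum]

lemma holDeriv_of_linear (L : (Fin N → ℂ) →ₗ[ℂ] ℂ) (z v : Fin N → ℂ) :
    holDeriv L z v = L v := by
  have h : fderiv ℝ L z = (LinearMap.toContinuousLinearMap L).restrictScalars ℝ :=
    ((LinearMap.toContinuousLinearMap L).restrictScalars ℝ).fderiv
  unfold holDeriv
  rw [h]
  simp
  ring_nf
  simp
  ring

/-- The sesquilinear form `z* A z`. -/
noncomputable def quadForm (A : Matrix (Fin N) (Fin N) ℂ) (z : Fin N → ℂ) : ℂ :=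
  star z ⬝ᵥ (A *ᵥ z)

@[fun_prop]
lemma hasTemperateGrowth_quadForm (A : Matrix (Fin N) (Fin N) ℂ) :
    Function.HasTemperateGrowth (quadForm A) := by
  unfold quadForm
  simp only [dotProduct, mulVec, Pi.star_apply]
  fun_prop

@[fun_prop]
lemma differentiable_quadForm (A : Matrix (Fin N) (Fin N) ℂ) :
    Differentiable ℝ (quadForm A) :=
  (hasTemperateGrowth_quadForm A).1.differentiable (by simp)

lemma holDeriv_quadForm (A : Matrix (Fin N) (Fin N) ℂ) (z v : Fin N → ℂ) :
    holDeriv (quadForm A) z v = star z ⬝ᵥ (A *ᵥ v) := by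
  have key : ∀ w : Fin N → ℂ, fderiv ℝ (quadForm A) z w
      = star w ⬝ᵥ (A *ᵥ z) + star z ⬝ᵥ (A *ᵥ w) := by
    intro w
    rw [← (differentiable_quadForm A z).lineDeriv_eq_fderiv]
    have e : ∀ t : ℝ, quadForm A (z + t • w)
        = quadForm A z + t * (star w ⬝ᵥ (A *ᵥ z) + star z ⬝ᵥ (A *ᵥ w))
          + t ^ 2 * quadForm A w := by
      intro t
      have ht : (t • w : Fin N → ℂ) = (t : ℂ) • w := by
        ext i
        simp
      unfold quadForm
      rw [ht, star_add, star_smul, mulVec_add, mulVec_smul]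
      simp only [add_dotProduct, dotProduct_add, smul_dotProduct, dotProduct_smul, smul_eq_mul,
        Complex.star_def, Complex.conj_ofReal]
      ring
    refine HasLineDerivAt.lineDeriv ?_
    unfold HasLineDerivAt
    simp only [e]
    have h1 : HasDerivAt (fun t : ℝ => (t : ℂ)) 1 0 := Complex.ofRealCLM.hasDerivAt
    have h2 := ((h1.mul_const (star w ⬝ᵥ (A *ᵥ z) + star z ⬝ᵥ (A *ᵥ w))).const_add
      (quadForm A z)).fun_add ((h1.fun_pow 2).mul_const (quadForm A w))
    simpa using h2
  unfold holDeriv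
  rw [key, key]
  simp only [star_smul, smul_dotProduct, mulVec_smul, dotProduct_smul, smul_eq_mul,
    Complex.star_def, Complex.conj_I]
  ring_nf
  simp
  ring

lemma holDeriv_quadForm_mulVec (V A B : Matrix (Fin N) (Fin N) ℂ) (z : Fin N → ℂ) :
    holDeriv (quadForm B) z (V *ᵥ (A *ᵥ z)) = quadForm (B * V * A) z := by
  rw [holDeriv_quadForm]
  simp [quadForm, mulVec_mulVec, Matrix.mul_assoc]

/-- Integration by parts against a quadratic form: the recursion behind Wick's formula. -/
theorem integral_quadForm_mul {V : Matrix (Fin N) (Fin N) ℂ} (hV : V.PosDef)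
    (A : Matrix (Fin N) (Fin N) ℂ) {H : (Fin N → ℂ) → ℂ} (hH : H.HasTemperateGrowth)
    (hi : Integrable (fun z => holDeriv H z (V *ᵥ (A *ᵥ z))) (complexNormal 0 V)) :
    ∫ z, quadForm A z * H z ∂complexNormal 0 V
      = (A * V).trace * ∫ z, H z ∂complexNormal 0 V
        + ∫ z, holDeriv H z (V *ᵥ (A *ᵥ z)) ∂complexNormal 0 V := by
  have hg : ∀ i, Function.HasTemperateGrowth fun z : Fin N → ℂ => (A *ᵥ z) i := by
    intro i
    simp only [mulVec, dotProduct]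
    fun_prop
  have hd : ∀ i z, holDeriv (fun z => (A *ᵥ z) i * H z) z (V *ᵥ Pi.single i 1)
      = (A * V) i i * H z + (A *ᵥ z) i * holDeriv H z (V *ᵥ Pi.single i 1) := by
    intro i z
    rw [holDeriv_mul ((hg i).1.differentiable (by simp) z) (hH.1.differentiable (by simp) z)]
    congr 2
    have := holDeriv_of_linear ((LinearMap.proj i).comp (mulVecLin A)) z (V *ᵥ Pi.single i 1)
    refine Eq.trans this ?_
    simp [Matrix.mul_apply, mulVec, dotProduct]
  have hint : ∀ i, Integrable (fun z => star (z i) * ((A *ᵥ z) i * H z)) (complexNormal 0 V) :=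
    fun i => integrable_of_hasTemperateGrowth hV
      ((hasTemperateGrowth_conj_coord i).mul ((hg i).mul hH))
  have hint2 : ∀ i, Integrable
      (fun z => holDeriv (fun z => (A *ᵥ z) i * H z) z (V *ᵥ Pi.single i 1))
      (complexNormal 0 V) := by
    intro i
    unfold holDeriv
    exact ((integrable_fderiv_of_hasTemperateGrowth hV ((hg i).mul hH) _).sub
      ((integrable_fderiv_of_hasTemperateGrowth hV ((hg i).mul hH) _).const_mul _)).const_mul _
  have e1 : ∀ z, quadForm A z * H z = ∑ i, star (z i) * ((A *ᵥ z) i * H z) := by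
    intro z
    simp only [quadForm, dotProduct, Finset.sum_mul, Pi.star_apply, mul_assoc]
  have e2 : ∀ z, ∑ i, holDeriv (fun z => (A *ᵥ z) i * H z) z (V *ᵥ Pi.single i 1)
      = (A * V).trace * H z + holDeriv H z (V *ᵥ (A *ᵥ z)) := by
    intro z
    simp only [hd, Finset.sum_add_distrib, ← Finset.sum_mul]
    congr 1
    simp only [← holDeriv_smul, ← holDeriv_sum]
    congr 1
    simp only [← mulVec_smul, ← mulVec_sum]
    congr 1
    ext k
    simp [Finset.sum_apply, Pi.single_apply]
  simp only [e1]
  rw [integral_finsetSum _ fun i _ => hint i]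
  have hs : ∀ i, ∫ z, star (z i) * ((A *ᵥ z) i * H z) ∂complexNormal 0 V
      = ∫ z, holDeriv (fun z => (A *ᵥ z) i * H z) z (V *ᵥ Pi.single i 1) ∂complexNormal 0 V :=
    fun i => stein_identity hV ((hg i).mul hH) i
  simp only [hs]
  rw [← integral_finsetSum _ fun i _ => hint2 i]
  simp only [e2]
  rw [integral_add ((integrable_of_hasTemperateGrowth hV hH).const_mul _) hi, integral_const_mul]

theorem integral_conj_coord {V : Matrix (Fin N) (Fin N) ℂ} (hV : V.PosDef) (j : Fin N) :
    ∫ z, star (z j) ∂complexNormal 0 V = 0 := by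
  have h := stein_identity hV (G := fun _ => 1) (by fun_prop) j
  simpa [holDeriv] using h

section Moments

variable {V : Matrix (Fin N) (Fin N) ℂ} [IsProbabilityMeasure (complexNormal 0 V)]

/-- `E[z* A z] = tr(A V)`. -/
theorem integral_quadForm (hV : V.PosDef) (A : Matrix (Fin N) (Fin N) ℂ) :
    ∫ z, quadForm A z ∂complexNormal 0 V = (A * V).trace := by
  have h0 : ∀ z v : Fin N → ℂ, holDeriv (fun _ => (1 : ℂ)) z v = 0 := by
    intro z v
    simp [holDeriv]
  have := integral_quadForm_mul hV A (H := fun _ => 1) (by fun_prop) (by simp [h0])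
  simpa [h0] using this

theorem integral_quadForm_mul_quadForm (hV : V.PosDef) (A B : Matrix (Fin N) (Fin N) ℂ) :
    ∫ z, quadForm A z * quadForm B z ∂complexNormal 0 V
      = (A * V).trace * (B * V).trace + (B * V * A * V).trace := by
  rw [integral_quadForm_mul hV A (by fun_prop)]
  · simp only [holDeriv_quadForm_mulVec, integral_quadForm hV]
  · simp only [holDeriv_quadForm_mulVec]
    exact integrable_of_hasTemperateGrowth hV (by fun_prop)

theorem integral_quadForm_mul_quadForm_mul_quadForm (hV : V.PosDef)
    (A B C : Matrix (Fin N) (Fin N) ℂ) :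
    ∫ z, quadForm A z * (quadForm B z * quadForm C z) ∂complexNormal 0 V
      = (A * V).trace * ((B * V).trace * (C * V).trace + (C * V * B * V).trace)
        + ((B * V * A * V).trace * (C * V).trace + (C * V * B * V * A * V).trace)
        + ((B * V).trace * (C * V * A * V).trace + (C * V * A * V * B * V).trace) := by
  have hd : ∀ z, holDeriv (fun z => quadForm B z * quadForm C z) z (V *ᵥ (A *ᵥ z))
      = quadForm (B * V * A) z * quadForm C z + quadForm B z * quadForm (C * V * A) z := by
    intro z
    rw [holDeriv_mul (by fun_prop) (by fun_prop), holDeriv_quadForm_mulVec,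
      holDeriv_quadForm_mulVec]
  have i1 : ∀ B C, Integrable (fun z => quadForm B z * quadForm C z) (complexNormal 0 V) :=
    fun B C => integrable_of_hasTemperateGrowth hV (by fun_prop)
  rw [integral_quadForm_mul hV A (by fun_prop)]
  · simp only [hd]
    rw [integral_add (i1 _ _) (i1 _ _)]
    simp only [integral_quadForm_mul_quadForm hV, ← Matrix.mul_assoc]
    ring
  · simp only [hd]
    exact (i1 _ _).add (i1 _ _)

/-- The second moment `E[z_i conj z_j]` of a centred complex normal vector. -/
theorem integral_coord_mul_conj (hV : V.PosDef) (i j : Fin N) :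
    ∫ z, z i * star (z j) ∂complexNormal 0 V = V i j := by
  have h := stein_identity hV (hasTemperateGrowth_coord i) j
  have h2 : ∀ z v : Fin N → ℂ, holDeriv (fun z => z i) z v = v i := fun z v =>
    holDeriv_of_linear (LinearMap.proj i) z v
  simp only [h2] at h
  simp_rw [mul_comm (_ : ℂ) (star _)]
  rw [h]
  simp

end Moments

end ComplexARMA

/-! ### Second-order structure of Gaussian ARMA processes -/

namespace ComplexARMA

open Matrix

variable {N : ℕ}

lemma integral_complexNormal_translate {V : Matrix (Fin N) (Fin N) ℂ} (hV : V.PosDef)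
    (m : Fin N → ℂ) (f : (Fin N → ℂ) → ℂ) :
    ∫ z, f z ∂complexNormal m V = ∫ z, f (z + m) ∂complexNormal 0 V := by
  rw [integral_complexNormal hV, integral_complexNormal hV,
    ← integral_add_right_eq_self (μ := volume) _ m]
  simp [complexNormalPDF]

/-- The total mass does not depend on the mean. That it is `1` is not computed, but inherited from
the law of a random vector. -/
lemma isProbabilityMeasure_complexNormal_zero {V : Matrix (Fin N) (Fin N) ℂ} (hV : V.PosDef)
    (m : Fin N → ℂ) [IsProbabilityMeasure (complexNormal m V)] :
    IsProbabilityMeasure (complexNormal 0 V) := by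
  have h := integral_complexNormal_translate hV m (fun _ => 1)
  simp only [integral_const, probReal_univ, one_smul] at h
  have h1 : (complexNormal 0 V).real Set.univ = 1 := by
    have : (((complexNormal 0 V).real Set.univ : ℝ) : ℂ) = 1 := by simpa using h.symm
    exact_mod_cast this
  constructor
  rw [measureReal_def] at h1
  have h2 : (complexNormal 0 V) Set.univ ≠ ⊤ := by
    intro h
    simp [h] at h1
  rw [← ENNReal.ofReal_toReal h2, h1, ENNReal.ofReal_one]

/-- The mean parameter is the mean of the distribution. -/
lemma integral_conj_coord_complexNormal {V : Matrix (Fin N) (Fin N) ℂ} (hV : V.PosDef)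
    (m : Fin N → ℂ) [IsProbabilityMeasure (complexNormal m V)] (j : Fin N) :
    ∫ z, star (z j) ∂complexNormal m V = star (m j) := by
  have := isProbabilityMeasure_complexNormal_zero hV m
  rw [integral_complexNormal_translate hV]
  simp only [Pi.add_apply, star_add]
  rw [integral_add (integrable_of_hasTemperateGrowth hV (hasTemperateGrowth_conj_coord j))
    (integrable_const _), integral_conj_coord hV]
  simp

section SecondOrder

variable {Ω : Type*} [MeasurableSpace Ω] {P : Measure Ω} {Z : ℤ → Ω → ℂ}

/-- The finite-dimensional distributions of a centred complex Gaussian process. -/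
lemma IsComplexGaussianProcess.exists_map_eq [IsProbabilityMeasure P]
    (hZ : IsComplexGaussianProcess P Z) (h0 : ∀ t, ∫ ω, Z t ω ∂P = 0)
    (t : Fin N → ℤ) (ht : Function.Injective t) :
    ∃ V : Matrix (Fin N) (Fin N) ℂ, V.PosDef ∧
      P.map (fun ω j => Z (t j) ω) = complexNormal 0 V := by
  obtain ⟨m, V, hV, h⟩ := hZ.normal N t ht
  have hm : AEMeasurable (fun ω j => Z (t j) ω) P :=
    aemeasurable_pi_lambda _ fun j => hZ.aemeasurable (t j)
  have : IsProbabilityMeasure (complexNormal m V) := h ▸ Measure.isProbabilityMeasure_map hm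
  have hm0 : m = 0 := by
    ext j
    have h1 := integral_conj_coord_complexNormal hV m j
    rw [← h, integral_map hm (continuous_apply j).star.aestronglyMeasurable] at h1
    have h2 : ∫ ω, star (Z (t j) ω) ∂P = star (∫ ω, Z (t j) ω ∂P) := integral_conj
    rw [h2, h0, star_zero] at h1
    simpa using congrArg star h1.symm
  exact ⟨V, hV, hm0 ▸ h⟩

lemma integral_of_map_eq_complexNormal [IsProbabilityMeasure P] {X : Fin N → Ω → ℂ}
    {V : Matrix (Fin N) (Fin N) ℂ} (hV : V.PosDef) (hX : ∀ j, AEMeasurable (X j) P)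
    (h : P.map (fun ω j => X j ω) = complexNormal 0 V) (i j : Fin N) :
    ∫ ω, X i ω * star (X j ω) ∂P = V i j := by
  have hm : AEMeasurable (fun ω j => X j ω) P := aemeasurable_pi_lambda _ hX
  have : IsProbabilityMeasure (complexNormal 0 V) := h ▸ Measure.isProbabilityMeasure_map hm
  rw [← integral_coord_mul_conj hV i j, ← h, integral_map hm]
  exact Continuous.aestronglyMeasurable (by fun_prop)

lemma memLp_two_of_map_eq_complexNormal {X : Fin N → Ω → ℂ} {V : Matrix (Fin N) (Fin N) ℂ}
    (hV : V.PosDef) (hX : ∀ j, AEMeasurable (X j) P)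
    (h : P.map (fun ω j => X j ω) = complexNormal 0 V) (j : Fin N) :
    MemLp (X j) 2 P := by
  have hm : AEMeasurable (fun ω j => X j ω) P := aemeasurable_pi_lambda _ hX
  have h1 := integrable_of_hasTemperateGrowth hV
    ((hasTemperateGrowth_coord j).mul (hasTemperateGrowth_conj_coord j))
  rw [← h, integrable_map_measure (Continuous.aestronglyMeasurable
    ((continuous_apply j).mul (continuous_apply j).star)) hm] at h1
  rw [memLp_two_iff_integrable_sq_norm (hX j).aestronglyMeasurable]
  refine h1.norm.congr (ae_of_all _ fun ω => ?_)
  simp [sq]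

lemma IsComplexGaussianProcess.memLp_two [IsProbabilityMeasure P]
    (hZ : IsComplexGaussianProcess P Z) (h0 : ∀ t, ∫ ω, Z t ω ∂P = 0)
    (t : ℤ) : MemLp (Z t) 2 P := by
  obtain ⟨V, hV, h⟩ := hZ.exists_map_eq h0 (fun _ : Fin 1 => t)
    (Function.injective_of_subsingleton _)
  exact memLp_two_of_map_eq_complexNormal (X := fun _ : Fin 1 => Z t) hV
    (fun _ => hZ.aemeasurable t) h 0

lemma IsStronglyStationary.integral_mul_conj (hs : IsStronglyStationary P Z)
    (hm : ∀ t, AEMeasurable (Z t) P) (s t : ℤ) :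
    ∫ ω, Z s ω * star (Z t ω) ∂P = autocov P Z (s - t) := by
  have h := hs 2 ![s - t, 0] t
  have key : ∀ u v : ℤ, ∫ z : Fin 2 → ℂ, z 0 * star (z 1) ∂P.map (fun ω j => Z (![u, v] j) ω)
      = ∫ ω, Z u ω * star (Z v ω) ∂P := by
    intro u v
    rw [integral_map (aemeasurable_pi_lambda _ fun j => hm _)
      (Continuous.aestronglyMeasurable (by fun_prop))]
    simp
  have e : (fun ω (j : Fin 2) => Z (![s - t, 0] j + t) ω) = fun ω j => Z (![s, t] j) ω := by
    ext ω j
    fin_cases j <;> simp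
  rw [e] at h
  rw [← key, h, key]
  rfl

/-- The observation is centred normal, and its covariance matrix is the Toeplitz matrix of the
autocovariances. -/
theorem obsLaw_eq_complexNormal [IsProbabilityMeasure P] (hZ : IsComplexGaussianProcess P Z)
    (hs : IsStronglyStationary P Z) (h0 : ∀ t, ∫ ω, Z t ω ∂P = 0) (N : ℕ) :
    (covMatrix (autocov P Z) N).PosDef ∧
      obsLaw P Z N = complexNormal 0 (covMatrix (autocov P Z) N) := by
  obtain ⟨V, hV, h⟩ := hZ.exists_map_eq h0 (fun j : Fin N => (j.val : ℤ) + 1)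
    (fun i j hij => by simpa [Fin.ext_iff] using hij)
  have : V = covMatrix (autocov P Z) N := by
    ext i j
    rw [← integral_of_map_eq_complexNormal hV (fun _ => hZ.aemeasurable _) h i j,
      hs.integral_mul_conj hZ.aemeasurable]
    simp [covMatrix]
  exact ⟨this ▸ hV, this ▸ h⟩

/-- The autocovariances are bounded by the variance. -/
lemma norm_autocov_le [IsProbabilityMeasure P] (hZ : IsComplexGaussianProcess P Z)
    (hs : IsStronglyStationary P Z) (h0 : ∀ t, ∫ ω, Z t ω ∂P = 0) (h : ℤ) :
    ‖autocov P Z h‖ ≤ ‖autocov P Z 0‖ := by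
  have hL := fun t => hZ.memLp_two h0 t
  have hI := fun t => (memLp_two_iff_integrable_sq_norm (hL t).1).1 (hL t)
  have hsq : ∀ t, ∫ ω, ‖Z t ω‖ ^ 2 ∂P = ‖autocov P Z 0‖ := by
    intro t
    have h1 := hs.integral_mul_conj hZ.aemeasurable t t
    have h2 : ∀ ω, Z t ω * star (Z t ω) = ((‖Z t ω‖ ^ 2 : ℝ) : ℂ) := by
      intro ω
      rw [Complex.star_def, Complex.mul_conj, Complex.normSq_eq_norm_sq]
    simp only [h2, sub_self] at h1
    rw [integral_complex_ofReal] at h1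
    rw [← h1, Complex.norm_real, Real.norm_of_nonneg]
    exact integral_nonneg fun ω => by positivity
  calc ‖autocov P Z h‖ ≤ ∫ ω, ‖Z h ω‖ * ‖Z 0 ω‖ ∂P := by
        refine (norm_integral_le_integral_norm _).trans_eq ?_
        simp
    _ ≤ ∫ ω, (1 / 2) * (‖Z h ω‖ ^ 2 + ‖Z 0 ω‖ ^ 2) ∂P := by
        refine integral_mono ((hL h).norm.integrable_mul (hL 0).norm)
          (((hI h).add (hI 0)).const_mul _) fun ω => ?_
        have := sq_nonneg (‖Z h ω‖ - ‖Z 0 ω‖)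
        simp only
        linarith
    _ = ‖autocov P Z 0‖ := by
        rw [integral_const_mul, integral_add (hI h) (hI 0), hsq, hsq]
        ring

lemma IsComplexWhiteNoise.memLp_two [IsProbabilityMeasure P] {ε : ℤ → Ω → ℂ} {σ2 : ℝ}
    (hσ : 0 < σ2) (hε : IsComplexWhiteNoise P ε σ2) (t : ℤ) : MemLp (ε t) 2 P := by
  have h := hε.normal 1 (fun _ => t) (Function.injective_of_subsingleton _)
  have h1 := memLp_two_of_map_eq_complexNormal
    (X := fun _ : Fin 1 => fun ω => ε t ω / (Real.sqrt σ2 : ℂ)) PosDef.one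
    (fun _ => (hε.aemeasurable t).div_const _) h 0
  have h2 := h1.const_mul (Real.sqrt σ2 : ℂ)
  have h3 : (Real.sqrt σ2 : ℂ) ≠ 0 := by
    exact_mod_cast (Real.sqrt_pos.2 hσ).ne'
  refine h2.ae_eq (ae_of_all _ fun ω => ?_)
  field_simp

lemma IsComplexWhiteNoise.integral_mul_conj [IsProbabilityMeasure P] {ε : ℤ → Ω → ℂ} {σ2 : ℝ}
    (hσ : 0 < σ2) (hε : IsComplexWhiteNoise P ε σ2) (s t : ℤ) :
    ∫ ω, ε s ω * star (ε t ω) ∂P = if s - t = 0 then (σ2 : ℂ) else 0 := by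
  have h3 : (Real.sqrt σ2 : ℂ) ≠ 0 := by
    exact_mod_cast (Real.sqrt_pos.2 hσ).ne'
  have h4 : (Real.sqrt σ2 : ℂ) * (Real.sqrt σ2 : ℂ) = σ2 := by
    exact_mod_cast Real.mul_self_sqrt hσ.le
  have e : ∀ ω, ε s ω * star (ε t ω) = (σ2 : ℂ) *
      ((ε s ω / (Real.sqrt σ2 : ℂ)) * star (ε t ω / (Real.sqrt σ2 : ℂ))) := by
    intro ω
    rw [star_div₀]
    simp only [Complex.star_def, Complex.conj_ofReal]
    rw [← h4]
    field_simp
  simp only [e]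
  rw [integral_const_mul]
  split_ifs with hst
  · obtain rfl : s = t := by omega
    have h := hε.normal 1 (fun _ => s) (Function.injective_of_subsingleton _)
    rw [integral_of_map_eq_complexNormal
      (X := fun _ : Fin 1 => fun ω => ε s ω / (Real.sqrt σ2 : ℂ)) PosDef.one
      (fun _ => (hε.aemeasurable s).div_const _) h 0 0]
    simp
  · have hne : s ≠ t := fun h => hst (by omega)
    have h := hε.normal 2 ![s, t] (by
      intro i j
      fin_cases i <;> fin_cases j <;> simp [hne, hne.symm])
    have := integral_of_map_eq_complexNormal
      (X := fun j : Fin 2 => fun ω => ε (![s, t] j) ω / (Real.sqrt σ2 : ℂ)) PosDef.one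
      (fun _ => (hε.aemeasurable _).div_const _) h 0 1
    simp only [Matrix.cons_val_zero, Matrix.cons_val_one] at this
    rw [this]
    simp

/-- The autocovariance of a finite moving average of a process with autocovariance `c`. -/
lemma integral_movingAverage {X : ℤ → Ω → ℂ} {c : ℤ → ℂ} (hX : ∀ t, MemLp (X t) 2 P)
    (hc : ∀ s t, ∫ ω, X s ω * star (X t ω) ∂P = c (s - t)) {m : ℕ} (u : Fin m → ℂ) (h : ℤ) :
    ∫ ω, (∑ i, u i * X (h - (i.val : ℤ)) ω) * star (∑ j, u j * X (0 - (j.val : ℤ)) ω) ∂P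
      = ∑ i, ∑ j, u i * star (u j) * c (h - (i.val : ℤ) + (j.val : ℤ)) := by
  have hint : ∀ s t, Integrable (fun ω => X s ω * star (X t ω)) P := fun s t =>
    (hX s).integrable_mul (hX t).star
  have e : ∀ ω, (∑ i, u i * X (h - (i.val : ℤ)) ω) * star (∑ j, u j * X (0 - (j.val : ℤ)) ω)
      = ∑ i, ∑ j, (u i * star (u j)) *
        (X (h - (i.val : ℤ)) ω * star (X (0 - (j.val : ℤ)) ω)) := by
    intro ω
    rw [star_sum, Finset.sum_mul_sum]
    refine Finset.sum_congr rfl fun i _ => Finset.sum_congr rfl fun j _ => ?_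
    rw [star_mul']
    ring
  simp only [e]
  rw [integral_finsetSum _ fun i _ => integrable_finsetSum _ fun j _ => (hint _ _).const_mul _]
  refine Finset.sum_congr rfl fun i _ => ?_
  rw [integral_finsetSum _ fun j _ => (hint _ _).const_mul _]
  refine Finset.sum_congr rfl fun j _ => ?_
  rw [integral_const_mul, hc]
  congr 2
  ring

/-- The Yule–Walker equations of an `ARMA` process, in the form `|a|² * γ = σ² |b|²` for
convolution, with the leading coefficient `1` included in `a` and `b`. -/
theorem IsARMA.autocov_recursion {P : Measure Ω} {r s : ℕ} {a : Fin r → ℂ} {b : Fin s → ℂ}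
    {σ2 : ℝ} (hA : IsARMA P Z a b σ2) (h : ℤ) :
    ∑ i : Fin (r + 1), ∑ j : Fin (r + 1),
        (Fin.cons 1 a : Fin (r + 1) → ℂ) i * star ((Fin.cons 1 a : Fin (r + 1) → ℂ) j)
          * autocov P Z (h - (i.val : ℤ) + (j.val : ℤ))
      = ∑ i : Fin (s + 1), ∑ j : Fin (s + 1),
        (Fin.cons 1 b : Fin (s + 1) → ℂ) i * star ((Fin.cons 1 b : Fin (s + 1) → ℂ) j)
          * (if h - (i.val : ℤ) + (j.val : ℤ) = 0 then (σ2 : ℂ) else 0) := by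
  have := hA.isProbabilityMeasure
  obtain ⟨ε, hε, hrec⟩ := hA.recursion
  rw [← integral_movingAverage (c := autocov P Z)
      (fun t => hA.gaussian.memLp_two hA.mean_zero t)
      (fun s t => hA.stationary.integral_mul_conj hA.gaussian.aemeasurable s t),
    ← integral_movingAverage (c := fun k => if k = 0 then (σ2 : ℂ) else 0)
      (fun t => hε.memLp_two hA.variance_pos t)
      (fun s t => hε.integral_mul_conj hA.variance_pos s t)]
  have key : ∀ t : ℤ, ∀ᵐ ω ∂P,
      ∑ i : Fin (r + 1), (Fin.cons 1 a : Fin (r + 1) → ℂ) i * Z (t - (i.val : ℤ)) ω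
      = ∑ i : Fin (s + 1), (Fin.cons 1 b : Fin (s + 1) → ℂ) i * ε (t - (i.val : ℤ)) ω := by
    intro t
    filter_upwards [hrec t] with ω hω
    rw [Fin.sum_univ_succ, Fin.sum_univ_succ]
    simp only [Fin.cons_zero, Fin.cons_succ, Fin.val_zero, Fin.val_succ, Nat.cast_zero, sub_zero,
      one_mul, Nat.cast_add, Nat.cast_one]
    rw [hω]
    ring
  refine integral_congr_ae ?_
  filter_upwards [key h, key 0] with ω h1 h2
  rw [h1, h2]

end SecondOrder

end ComplexARMA

/-! ### Symbols and their Fourier coefficients -/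

namespace ComplexARMA

open AddCircle

instance factTwoPiPos : Fact (0 < 2 * Real.pi) := ⟨Real.two_pi_pos⟩

/-- Symbols: continuous functions of the frequency `ω ∈ ℝ / 2πℤ`, as a Banach algebra. -/
abbrev FreqSymbol : Type := C(AddCircle (2 * Real.pi), ℂ)

lemma integrable_fourier_mul (h : ℤ) (f : FreqSymbol) :
    Integrable (fun t => (fourier h t : ℂ) * f t) haarAddCircle :=
  Continuous.integrable_of_hasCompactSupport
    ((fourier h : FreqSymbol).continuous.mul f.continuous) (HasCompactSupport.of_compactSpace _)

lemma norm_integral_fourier_mul_le (h : ℤ) (f : FreqSymbol) :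
    ‖∫ t, (fourier h t : ℂ) * f t ∂haarAddCircle‖ ≤ 1 * ‖f‖ := by
  have h1 : ∀ t : AddCircle (2 * Real.pi), ‖(fourier h t : ℂ) * f t‖ ≤ ‖f‖ := by
    intro t
    rw [norm_mul, show ‖(fourier h t : ℂ)‖ = 1 from Circle.norm_coe _, one_mul]
    exact f.norm_coe_le_norm t
  have := norm_integral_le_of_norm_le_const (μ := haarAddCircle (T := 2 * Real.pi))
    (ae_of_all _ h1)
  simpa only [probReal_univ, mul_one, one_mul] using this

/-- The coefficient `(2π)⁻¹ ∫ f(ω) exp(√-1 h ω) dω` of `exp(-√-1 h ω)` in `f`. The sign is the one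
that makes the autocovariance the coefficients of `2π S`. -/
noncomputable def coef (h : ℤ) : FreqSymbol →L[ℂ] ℂ :=
  LinearMap.mkContinuous
    { toFun := fun f => ∫ t, (fourier h t : ℂ) * f t ∂haarAddCircle
      map_add' := fun f g => by
        rw [← integral_add (integrable_fourier_mul h f) (integrable_fourier_mul h g)]
        refine integral_congr_ae (ae_of_all _ fun t => ?_)
        exact mul_add _ _ _
      map_smul' := fun c f => by
        rw [RingHom.id_apply, smul_eq_mul, ← integral_const_mul]
        refine integral_congr_ae (ae_of_all _ fun t => ?_)
        exact mul_left_comm _ _ _ }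
    1 (norm_integral_fourier_mul_le h)

lemma coef_apply (h : ℤ) (f : FreqSymbol) :
    coef h f = ∫ t, (fourier h t : ℂ) * f t ∂haarAddCircle := rfl

lemma coef_eq_fourierCoeff (h : ℤ) (f : FreqSymbol) : coef h f = fourierCoeff f (-h) := by
  simp [coef_apply, fourierCoeff]

lemma norm_coef_le (h : ℤ) (f : FreqSymbol) : ‖coef h f‖ ≤ ‖f‖ := by
  refine ((coef h).le_opNorm f).trans ?_
  have : ‖coef h‖ ≤ 1 := LinearMap.mkContinuous_norm_le _ zero_le_one _
  nlinarith [norm_nonneg f]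

lemma fourier_mul_fourier (m n : ℤ) :
    (fourier m * fourier n : FreqSymbol) = fourier (m + n) := by
  ext t
  simp only [ContinuousMap.mul_apply]
  rw [fourier_add]

lemma coef_fourier_mul (h k : ℤ) (f : FreqSymbol) :
    coef h (fourier k * f) = coef (h + k) f := by
  rw [coef_apply, coef_apply]
  congr 1
  ext t
  rw [fourier_add, ContinuousMap.mul_apply]
  ring

lemma coef_one (h : ℤ) : coef h 1 = if h = 0 then 1 else 0 := by
  have h1 : (1 : FreqSymbol) = fourier 0 := by
    ext t
    simp
  rw [coef_eq_fourierCoeff, h1, fourierCoeff_fourier, Pi.single_apply]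
  simp

lemma coef_eq_intervalIntegral (h : ℤ) (f : FreqSymbol) (a : ℝ) :
    coef h f = (1 / (2 * Real.pi) : ℂ) * ∫ x in a..a + 2 * Real.pi,
      Complex.exp (Complex.I * h * x) * f (x : AddCircle (2 * Real.pi)) := by
  rw [coef_eq_fourierCoeff, fourierCoeff_eq_intervalIntegral _ _ a]
  rw [Complex.real_smul]
  push_cast
  congr 1
  refine intervalIntegral.integral_congr fun x _ => ?_
  simp only [neg_neg, fourier_coe_apply, smul_eq_mul]
  congr 2
  push_cast
  have : (Real.pi : ℂ) ≠ 0 := by exact_mod_cast Real.pi_ne_zero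
  field_simp

lemma coef_zero_eq_intervalIntegral (f : FreqSymbol) :
    coef 0 f = (1 / (2 * Real.pi) : ℂ) * ∫ x in (-Real.pi)..Real.pi,
      f (x : AddCircle (2 * Real.pi)) := by
  have := coef_eq_intervalIntegral 0 f (-Real.pi)
  rw [this]
  simp only [Int.cast_zero, mul_zero, zero_mul, Complex.exp_zero, one_mul]
  ring_nf

/-! ### Smooth symbols -/

/-- Symbols that are smooth functions of the frequency. -/
def IsSmooth (f : FreqSymbol) : Prop :=
  ContDiff ℝ (⊤ : ℕ∞) fun x : ℝ => f (x : AddCircle (2 * Real.pi))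

lemma IsSmooth.add {f g : FreqSymbol} (hf : IsSmooth f) (hg : IsSmooth g) : IsSmooth (f + g) :=
  ContDiff.add hf hg

lemma IsSmooth.sub {f g : FreqSymbol} (hf : IsSmooth f) (hg : IsSmooth g) : IsSmooth (f - g) :=
  ContDiff.sub hf hg

lemma IsSmooth.mul {f g : FreqSymbol} (hf : IsSmooth f) (hg : IsSmooth g) : IsSmooth (f * g) :=
  ContDiff.mul hf hg

lemma IsSmooth.smul (c : ℂ) {f : FreqSymbol} (hf : IsSmooth f) : IsSmooth (c • f) :=
  ContDiff.smul contDiff_const hf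

lemma isSmooth_zero : IsSmooth 0 := contDiff_const

lemma isSmooth_fourier (n : ℤ) : IsSmooth (fourier n) := by
  unfold IsSmooth
  simp only [fourier_coe_apply]
  exact (((contDiff_const.mul Complex.ofRealCLM.contDiff).div_const _)).cexp

lemma IsSmooth.sum {ι : Type*} (s : Finset ι) {f : ι → FreqSymbol}
    (hf : ∀ i ∈ s, IsSmooth (f i)) : IsSmooth (∑ i ∈ s, f i) := by
  classical
  induction s using Finset.induction_on with
  | empty => simpa using isSmooth_zero
  | insert a s ha ih =>
    rw [Finset.sum_insert ha]
    exact (hf a (by simp)).add (ih fun i hi => hf i (by simp [hi]))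

lemma inverse_apply {f : FreqSymbol} (hf : IsUnit f) (t : AddCircle (2 * Real.pi)) :
    Ring.inverse f t = (f t)⁻¹ := by
  have h := congrArg (fun g : FreqSymbol => g t) (Ring.mul_inverse_cancel f hf)
  simp only [ContinuousMap.mul_apply, ContinuousMap.one_apply] at h
  exact eq_inv_of_mul_eq_one_right h

lemma IsSmooth.inverse {f : FreqSymbol} (hf : IsSmooth f) (hu : IsUnit f) :
    IsSmooth (Ring.inverse f) := by
  unfold IsSmooth
  simp only [inverse_apply hu]
  exact ContDiff.inv hf fun x => (ContinuousMap.isUnit_iff_forall_ne_zero f).1 hu _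

/-- Repeated integration by parts: the Fourier coefficients of a smooth periodic function decay
faster than any power. -/
lemma exists_bound_pow_mul_integral (k : ℕ) {g : ℝ → ℂ} (hg : ContDiff ℝ (⊤ : ℕ∞) g)
    (hp : Function.Periodic g (2 * Real.pi)) :
    ∃ C : ℝ, ∀ h : ℤ, |(h : ℝ)| ^ k *
      ‖∫ x in (0 : ℝ)..2 * Real.pi, Complex.exp (Complex.I * h * x) * g x‖ ≤ C := by
  induction k generalizing g with
  | zero =>
    obtain ⟨C, hC⟩ := (isCompact_Icc (a := 0) (b := 2 * Real.pi)).exists_bound_of_continuousOn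
      hg.continuous.continuousOn
    refine ⟨C * |2 * Real.pi - 0|, fun h => ?_⟩
    rw [pow_zero, one_mul]
    refine intervalIntegral.norm_integral_le_of_norm_le_const fun x hx => ?_
    rw [norm_mul]
    have : ‖Complex.exp (Complex.I * h * x)‖ = 1 := by
      rw [Complex.norm_exp]
      simp
    rw [this, one_mul]
    rw [Set.uIoc_of_le Real.two_pi_pos.le] at hx
    exact hC x ⟨hx.1.le, hx.2⟩
  | succ k ih =>
    have hd : Differentiable ℝ g := hg.differentiable (by simp)
    have hg' : ContDiff ℝ (⊤ : ℕ∞) (deriv g) := (contDiff_infty_iff_deriv.1 hg).2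
    have hp' : Function.Periodic (deriv g) (2 * Real.pi) := by
      intro x
      rw [← deriv_comp_add_const]
      congr 1
      ext y
      exact hp y
    obtain ⟨C, hC⟩ := ih hg' hp'
    refine ⟨C, fun h => ?_⟩
    have hexp : ∀ x : ℝ, HasDerivAt (fun x : ℝ => Complex.exp (Complex.I * h * x))
        (Complex.I * h * Complex.exp (Complex.I * h * x)) x := by
      intro x
      have h1 : HasDerivAt (fun t : ℝ => (t : ℂ)) 1 x := Complex.ofRealCLM.hasDerivAt
      have h2 := (h1.const_mul (Complex.I * h)).cexp
      convert! h2 using 1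
      ring
    have hparts := intervalIntegral.integral_mul_deriv_eq_deriv_mul (a := 0) (b := 2 * Real.pi)
      (u := g) (u' := deriv g) (v := fun x : ℝ => Complex.exp (Complex.I * h * x))
      (v' := fun x : ℝ => Complex.I * h * Complex.exp (Complex.I * h * x))
      (fun x _ => (hd x).hasDerivAt) (fun x _ => hexp x)
      (hg'.continuous.intervalIntegrable _ _) (Continuous.intervalIntegrable (by fun_prop) _ _)
    have hper : Complex.exp (Complex.I * h * ((2 * Real.pi : ℝ) : ℂ)) = 1 := by
      rw [Complex.exp_eq_one_iff]
      exact ⟨h, by push_cast; ring⟩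
    have h0 : g (2 * Real.pi) = g 0 := by simpa using hp 0
    simp only [hper, h0, Complex.ofReal_zero, mul_zero, Complex.exp_zero, sub_self, zero_sub]
      at hparts
    have e1 : ∫ x in (0 : ℝ)..2 * Real.pi, g x * (Complex.I * h * Complex.exp (Complex.I * h * x))
        = Complex.I * h * ∫ x in (0 : ℝ)..2 * Real.pi, Complex.exp (Complex.I * h * x) * g x := by
      rw [← intervalIntegral.integral_const_mul]
      refine intervalIntegral.integral_congr fun x _ => ?_
      ring
    have e2 : ‖∫ x in (0 : ℝ)..2 * Real.pi, Complex.exp (Complex.I * h * x) * deriv g x‖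
        = |(h : ℝ)| * ‖∫ x in (0 : ℝ)..2 * Real.pi, Complex.exp (Complex.I * h * x) * g x‖ := by
      have := congrArg norm (e1.symm.trans hparts)
      simp only [norm_mul, Complex.norm_I, one_mul, Complex.norm_intCast, norm_neg] at this
      rw [this]
      simp only [mul_comm]
    have := hC h
    rw [e2] at this
    rw [pow_succ, mul_assoc]
    exact this

/-- Smooth symbols have rapidly decaying coefficients. -/
theorem IsSmooth.summable_coef {f : FreqSymbol} (hf : IsSmooth f) :
    Summable fun h : ℤ => (1 + |(h : ℝ)|) * ‖coef h f‖ := by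
  have hp : Function.Periodic (fun x : ℝ => f (x : AddCircle (2 * Real.pi))) (2 * Real.pi) := by
    intro x
    simp
  obtain ⟨C, hC⟩ := exists_bound_pow_mul_integral 3 hf hp
  have hs : Summable fun h : ℤ => (2 * C) * (1 / (h : ℝ) ^ 2) :=
    (Real.summable_one_div_int_pow.2 one_lt_two).mul_left _
  refine Summable.of_norm_bounded_eventually hs ?_
  filter_upwards [(Set.finite_singleton (0 : ℤ)).compl_mem_cofinite] with h hh
  have h0 : h ≠ 0 := by simpa using hh
  have h1 : (1 : ℝ) ≤ |(h : ℝ)| := by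
    exact_mod_cast Int.one_le_abs h0
  have hb := hC h
  set J := ∫ x in (0 : ℝ)..2 * Real.pi, Complex.exp (Complex.I * h * x)
    * f (x : AddCircle (2 * Real.pi))
  have hJ : ‖coef h f‖ ≤ ‖J‖ := by
    rw [coef_eq_intervalIntegral h f 0, norm_mul, zero_add]
    have : ‖(1 / (2 * Real.pi) : ℂ)‖ ≤ 1 := by
      rw [norm_div, norm_one, norm_mul, Complex.norm_real, Complex.norm_ofNat,
        Real.norm_of_nonneg Real.pi_pos.le, div_le_one (by positivity)]
      linarith [Real.pi_gt_three]
    exact mul_le_of_le_one_left (norm_nonneg _) this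
  rw [Real.norm_of_nonneg (by positivity)]
  calc (1 + |(h : ℝ)|) * ‖coef h f‖ ≤ (2 * |(h : ℝ)|) * ‖J‖ := by
        gcongr
        linarith
    _ = 2 * (|(h : ℝ)| ^ 3 * ‖J‖) * (1 / |(h : ℝ)| ^ 2) := by
        have : |(h : ℝ)| ≠ 0 := by linarith
        field_simp
    _ ≤ 2 * C * (1 / |(h : ℝ)| ^ 2) := by gcongr
    _ = 2 * C * (1 / (h : ℝ) ^ 2) := by rw [sq_abs]

lemma IsSmooth.summable_norm_coef {f : FreqSymbol} (hf : IsSmooth f) :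
    Summable fun h : ℤ => ‖coef h f‖ :=
  Summable.of_nonneg_of_le (fun _ => norm_nonneg _)
    (fun h => le_mul_of_one_le_left (norm_nonneg _) (by linarith [abs_nonneg (h : ℝ)]))
    hf.summable_coef

/-- The Fourier expansion of a smooth symbol converges uniformly. -/
lemma IsSmooth.hasSum {f : FreqSymbol} (hf : IsSmooth f) :
    HasSum (fun h : ℤ => coef h f • fourier (-h)) f := by
  have h1 : Summable (fourierCoeff f) := by
    have := (Equiv.neg ℤ).summable_iff.2 hf.summable_norm_coef.of_norm
    refine this.congr fun h => ?_
    simp [coef_eq_fourierCoeff]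
  have h2 := (Equiv.neg ℤ).hasSum_iff.2 (hasSum_fourier_series_of_summable h1)
  refine h2.congr_fun ?_
  intro h
  simp [coef_eq_fourierCoeff]

/-- The coefficients of a product are the convolution of the coefficients. -/
lemma IsSmooth.hasSum_coef_mul {u : FreqSymbol} (hu : IsSmooth u) (v : FreqSymbol) (h : ℤ) :
    HasSum (fun k : ℤ => coef k u * coef (h - k) v) (coef h (u * v)) := by
  have := (coef h).hasSum (hu.hasSum.mul_right v)
  refine this.congr_fun fun k => ?_
  simp only [smul_mul_assoc, map_smul, coef_fourier_mul, smul_eq_mul, sub_eq_add_neg]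

lemma spectral_hasSum {f : FreqSymbol} (hf : IsSmooth f) (ω : ℝ) :
    HasSum (fun h : ℤ => coef h f * Complex.exp (-(Complex.I * (h : ℂ) * (ω : ℂ))))
      (f (ω : AddCircle (2 * Real.pi))) := by
  have := (ContinuousMap.evalCLM ℂ (ω : AddCircle (2 * Real.pi))).hasSum hf.hasSum
  refine this.congr_fun fun h => ?_
  simp only [ContinuousMap.evalCLM_apply, ContinuousMap.smul_apply, smul_eq_mul,
    fourier_coe_apply]
  congr 2
  push_cast
  have : (Real.pi : ℂ) ≠ 0 := by exact_mod_cast Real.pi_ne_zero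
  field_simp

end ComplexARMA

/-! ### The symbol of an ARMA process -/

namespace ComplexARMA

open AddCircle

/-- The transfer function `1 + c₁ e^{-iω} + ⋯ + c_r e^{-irω}` of the coefficients `c`. -/
noncomputable def transfer {r : ℕ} (c : Fin r → ℂ) : FreqSymbol :=
  ∑ i : Fin (r + 1), (Fin.cons 1 c : Fin (r + 1) → ℂ) i • fourier (-(i.val : ℤ))

/-- The complex conjugate of the transfer function. -/
noncomputable def transferConj {r : ℕ} (c : Fin r → ℂ) : FreqSymbol :=
  ∑ i : Fin (r + 1), star ((Fin.cons 1 c : Fin (r + 1) → ℂ) i) • fourier (i.val : ℤ)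

lemma transferConj_apply {r : ℕ} (c : Fin r → ℂ) (t : AddCircle (2 * Real.pi)) :
    transferConj c t = star (transfer c t) := by
  simp only [transfer, transferConj, ContinuousMap.coe_sum, Finset.sum_apply,
    ContinuousMap.smul_apply, star_sum, smul_eq_mul, star_mul']
  refine Finset.sum_congr rfl fun i _ => ?_
  simp only [fourier_neg, Complex.star_def, Complex.conj_conj]

lemma isSmooth_transfer {r : ℕ} (c : Fin r → ℂ) : IsSmooth (transfer c) :=
  IsSmooth.sum _ fun _ _ => (isSmooth_fourier _).smul _

lemma isSmooth_transferConj {r : ℕ} (c : Fin r → ℂ) : IsSmooth (transferConj c) :=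
  IsSmooth.sum _ fun _ _ => (isSmooth_fourier _).smul _

/-- The transfer function at `ω` is `z⁻ʳ` times the characteristic polynomial at `z = e^{iω}`, whose
roots lie inside the unit circle. -/
lemma RootsInUnitDisk.isUnit_transfer {r : ℕ} {c : Fin r → ℂ} (hc : RootsInUnitDisk c) :
    IsUnit (transfer c) := by
  rw [ContinuousMap.isUnit_iff_forall_ne_zero]
  intro t h0
  have hn : ‖(fourier 1 t : ℂ)‖ = 1 := Circle.norm_coe _
  set z : ℂ := fourier 1 t with hz
  have hz0 : z ≠ 0 := by
    intro h
    rw [h, norm_zero] at hn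
    exact zero_ne_one hn
  have hpow : ∀ n : ℕ, (fourier (n : ℤ) t : ℂ) = z ^ n := by
    intro n
    induction n with
    | zero => simp
    | succ n ih =>
      rw [Nat.cast_succ, fourier_add, ih, pow_succ]
  have hneg : ∀ n : ℕ, n ≤ r → z ^ r * (fourier (-(n : ℤ)) t : ℂ) = z ^ (r - n) := by
    intro n hn
    have h1 : (fourier (n : ℤ) t : ℂ) * fourier (-(n : ℤ)) t = 1 := by
      rw [← fourier_add, add_neg_cancel, fourier_zero]
    rw [hpow] at h1
    rw [← Nat.sub_add_cancel hn, pow_add, mul_assoc, h1, mul_one, Nat.sub_add_cancel hn]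
  have h1 : z ^ r * transfer c t = 0 := by rw [h0, mul_zero]
  have h2 : z ^ r + ∑ i : Fin r, c i * z ^ (r - (i.val + 1)) = 0 := by
    rw [← h1]
    simp only [transfer, ContinuousMap.coe_sum, Finset.sum_apply, ContinuousMap.smul_apply,
      smul_eq_mul, Finset.mul_sum]
    rw [Fin.sum_univ_succ]
    simp only [Fin.cons_zero, Fin.cons_succ, Fin.val_zero, Fin.val_succ]
    congr 1
    · rw [one_mul, hneg 0 (Nat.zero_le _), Nat.sub_zero]
    · refine Finset.sum_congr rfl fun i _ => ?_
      rw [mul_left_comm, hneg _ (by omega)]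
  exact absurd (hc z h2) (by rw [hn]; exact lt_irrefl _)

lemma RootsInUnitDisk.isUnit_transferConj {r : ℕ} {c : Fin r → ℂ} (hc : RootsInUnitDisk c) :
    IsUnit (transferConj c) := by
  rw [ContinuousMap.isUnit_iff_forall_ne_zero]
  intro t
  rw [transferConj_apply]
  exact star_ne_zero.2 ((ContinuousMap.isUnit_iff_forall_ne_zero _).1 hc.isUnit_transfer t)

/-- `2π` times the power spectral density of an `ARMA` process, `σ² |b|² / |a|²`. -/
noncomputable def armaSymbol {r s : ℕ} (a : Fin r → ℂ) (b : Fin s → ℂ) (σ2 : ℝ) : FreqSymbol :=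
  (σ2 : ℂ) • (transfer b * transferConj b * Ring.inverse (transfer a * transferConj a))

lemma isUnit_transfer_mul_transferConj {r : ℕ} {c : Fin r → ℂ} (hc : RootsInUnitDisk c) :
    IsUnit (transfer c * transferConj c) :=
  hc.isUnit_transfer.mul hc.isUnit_transferConj

lemma isSmooth_armaSymbol {r s : ℕ} {a : Fin r → ℂ} (b : Fin s → ℂ) (σ2 : ℝ)
    (ha : RootsInUnitDisk a) : IsSmooth (armaSymbol a b σ2) :=
  ((((isSmooth_transfer b).mul (isSmooth_transferConj b)).mul
    (((isSmooth_transfer a).mul (isSmooth_transferConj a)).inverse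
      (isUnit_transfer_mul_transferConj ha)))).smul _

/-- The ARMA symbol takes positive values. -/
lemma exists_armaSymbol_eq_pos {r s : ℕ} {a : Fin r → ℂ} {b : Fin s → ℂ} {σ2 : ℝ}
    (ha : RootsInUnitDisk a) (hb : RootsInUnitDisk b) (hσ : 0 < σ2)
    (t : AddCircle (2 * Real.pi)) : ∃ x : ℝ, 0 < x ∧ armaSymbol a b σ2 t = x := by
  have h1 := (ContinuousMap.isUnit_iff_forall_ne_zero _).1 ha.isUnit_transfer t
  have h2 := (ContinuousMap.isUnit_iff_forall_ne_zero _).1 hb.isUnit_transfer t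
  refine ⟨σ2 * (‖transfer b t‖ ^ 2 * (‖transfer a t‖ ^ 2)⁻¹), by positivity, ?_⟩
  simp only [armaSymbol, ContinuousMap.smul_apply, ContinuousMap.mul_apply,
    inverse_apply (isUnit_transfer_mul_transferConj ha), transferConj_apply, Complex.star_def,
    Complex.mul_conj, Complex.normSq_eq_norm_sq, smul_eq_mul]
  push_cast
  rfl

lemma coef_transfer_mul {r : ℕ} (c : Fin r → ℂ) (f : FreqSymbol) (h : ℤ) :
    coef h (transfer c * transferConj c * f)
      = ∑ i : Fin (r + 1), ∑ j : Fin (r + 1),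
        (Fin.cons 1 c : Fin (r + 1) → ℂ) i * star ((Fin.cons 1 c : Fin (r + 1) → ℂ) j)
          * coef (h - (i.val : ℤ) + (j.val : ℤ)) f := by
  rw [transfer, transferConj, Finset.sum_mul_sum, Finset.sum_mul, map_sum]
  refine Finset.sum_congr rfl fun i _ => ?_
  rw [Finset.sum_mul, map_sum]
  refine Finset.sum_congr rfl fun j _ => ?_
  rw [smul_mul_smul_comm, fourier_mul_fourier, smul_mul_assoc, map_smul, coef_fourier_mul,
    smul_eq_mul]
  ring_nf

/-- A bounded sequence that solves the Yule–Walker equations consists of the coefficients of the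
ARMA symbol: convolution by `|a|²` is injective on bounded sequences, because `1 / |a|²` has
summable coefficients. -/
theorem eq_coef_armaSymbol {r s : ℕ} {a : Fin r → ℂ} {b : Fin s → ℂ} {σ2 : ℝ}
    (ha : RootsInUnitDisk a) {γ : ℤ → ℂ} {K : ℝ} (hK : ∀ h, ‖γ h‖ ≤ K)
    (hγ : ∀ h : ℤ, ∑ i : Fin (r + 1), ∑ j : Fin (r + 1),
        (Fin.cons 1 a : Fin (r + 1) → ℂ) i * star ((Fin.cons 1 a : Fin (r + 1) → ℂ) j)
          * γ (h - (i.val : ℤ) + (j.val : ℤ))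
      = ∑ i : Fin (s + 1), ∑ j : Fin (s + 1),
        (Fin.cons 1 b : Fin (s + 1) → ℂ) i * star ((Fin.cons 1 b : Fin (s + 1) → ℂ) j)
          * (if h - (i.val : ℤ) + (j.val : ℤ) = 0 then (σ2 : ℂ) else 0)) (h : ℤ) :
    γ h = coef h (armaSymbol a b σ2) := by
  set G := transfer a * transferConj a
  have hG : IsUnit G := isUnit_transfer_mul_transferConj ha
  set I := Ring.inverse G
  have hI : IsSmooth I := ((isSmooth_transfer a).mul (isSmooth_transferConj a)).inverse hG
  have hsum : ∀ d k : ℤ, Summable fun m : ℤ => coef (m + d) I * γ (k - m) := by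
    intro d k
    have h1 : Summable fun m : ℤ => ‖coef (m + d) I‖ * K :=
      (((Equiv.addRight d).summable_iff (f := fun m => ‖coef m I‖)).2
        hI.summable_norm_coef).mul_right K
    refine Summable.of_norm_bounded h1 fun m => ?_
    rw [norm_mul]
    exact mul_le_mul_of_nonneg_left (hK _) (norm_nonneg _)
  have hsum' : ∀ k : ℤ, Summable fun m : ℤ => coef m I * γ (k - m) := fun k => by
    simpa using hsum 0 k
  have hshift : ∀ d : ℤ, ∑' m : ℤ, coef (m + d) I * γ (h - m)
      = ∑' m : ℤ, coef m I * γ (h - m + d) := by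
    intro d
    rw [← (Equiv.addRight d).tsum_eq (fun m : ℤ => coef m I * γ (h - m + d))]
    refine tsum_congr fun m => ?_
    simp only [Equiv.coe_addRight]
    congr 2
    ring
  -- insert the unit `1 = |a|² / |a|²` for convolution
  have step1 : γ h = ∑' m : ℤ, coef m (G * I) * γ (h - m) := by
    rw [Ring.mul_inverse_cancel _ hG, tsum_eq_single 0]
    · simp [coef_one]
    · intro m hm
      simp [coef_one, hm]
  have step2 : γ h = ∑' m : ℤ, coef m I * (∑ i : Fin (r + 1), ∑ j : Fin (r + 1),
        (Fin.cons 1 a : Fin (r + 1) → ℂ) i * star ((Fin.cons 1 a : Fin (r + 1) → ℂ) j)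
          * γ ((h - m) - (i.val : ℤ) + (j.val : ℤ))) := by
    rw [step1]
    simp only [G, coef_transfer_mul, Finset.sum_mul, Finset.mul_sum]
    have e1 : ∀ (i j : Fin (r + 1)), Summable fun m : ℤ =>
        (Fin.cons 1 a : Fin (r + 1) → ℂ) i * star ((Fin.cons 1 a : Fin (r + 1) → ℂ) j)
          * coef (m - (i.val : ℤ) + (j.val : ℤ)) I * γ (h - m) := by
      intro i j
      refine ((hsum (-(i.val : ℤ) + (j.val : ℤ)) h).mul_left
        ((Fin.cons 1 a : Fin (r + 1) → ℂ) i * star ((Fin.cons 1 a : Fin (r + 1) → ℂ) j))).congr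
        fun m => ?_
      rw [← mul_assoc, sub_eq_add_neg m, add_assoc]
    have e2 : ∀ (i j : Fin (r + 1)), Summable fun m : ℤ =>
        coef m I * ((Fin.cons 1 a : Fin (r + 1) → ℂ) i
          * star ((Fin.cons 1 a : Fin (r + 1) → ℂ) j)
          * γ ((h - m) - (i.val : ℤ) + (j.val : ℤ))) := by
      intro i j
      refine ((hsum' (h - (i.val : ℤ) + (j.val : ℤ))).mul_left
        ((Fin.cons 1 a : Fin (r + 1) → ℂ) i * star ((Fin.cons 1 a : Fin (r + 1) → ℂ) j))).congr
        fun m => ?_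
      rw [mul_left_comm]
      ring_nf
    rw [Summable.tsum_finsetSum fun i _ => summable_sum fun j _ => e1 i j,
      Summable.tsum_finsetSum fun i _ => summable_sum fun j _ => e2 i j]
    refine Finset.sum_congr rfl fun i _ => ?_
    rw [Summable.tsum_finsetSum fun j _ => e1 i j, Summable.tsum_finsetSum fun j _ => e2 i j]
    refine Finset.sum_congr rfl fun j _ => ?_
    have := hshift (-(i.val : ℤ) + (j.val : ℤ))
    simp only [mul_assoc, mul_left_comm (coef _ I), tsum_mul_left]
    simp only [← add_assoc, ← sub_eq_add_neg] at this
    rw [this]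
  rw [step2]
  simp only [hγ]
  rw [armaSymbol, map_smul, coef_transfer_mul, smul_eq_mul]
  have e3 : ∀ m : ℤ, ∀ i j : Fin (s + 1),
      coef m I * ((Fin.cons 1 b : Fin (s + 1) → ℂ) i * star ((Fin.cons 1 b : Fin (s + 1) → ℂ) j)
          * (if h - m - (i.val : ℤ) + (j.val : ℤ) = 0 then (σ2 : ℂ) else 0))
      = if m = h - (i.val : ℤ) + (j.val : ℤ) then (σ2 : ℂ) *
          ((Fin.cons 1 b : Fin (s + 1) → ℂ) i * star ((Fin.cons 1 b : Fin (s + 1) → ℂ) j)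
            * coef (h - (i.val : ℤ) + (j.val : ℤ)) I) else 0 := by
    intro m i j
    by_cases hm : m = h - (i.val : ℤ) + (j.val : ℤ)
    · rw [if_pos hm, if_pos (by omega), hm]
      ring
    · rw [if_neg hm, if_neg (by omega), mul_zero, mul_zero]
  simp only [Finset.mul_sum, e3]
  have e4 : ∀ (k : ℤ) (x : ℂ), Summable fun m : ℤ => if m = k then x else 0 := fun k x =>
    (hasSum_ite_eq k x).summable
  rw [Summable.tsum_finsetSum fun i _ => summable_sum fun j _ => e4 _ _]
  refine Finset.sum_congr rfl fun i _ => ?_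
  rw [Summable.tsum_finsetSum fun j _ => e4 _ _]
  refine Finset.sum_congr rfl fun j _ => ?_
  rw [tsum_ite_eq]

section Autocovariance

variable {Ω : Type*} [MeasurableSpace Ω] {P : Measure Ω} {Z : ℤ → Ω → ℂ} {r s : ℕ}
  {a : Fin r → ℂ} {b : Fin s → ℂ} {σ2 : ℝ}

/-- The autocovariances of an ARMA process are the Fourier coefficients of its symbol. -/
theorem IsARMA.autocov_eq (hA : IsARMA P Z a b σ2) (h : ℤ) :
    autocov P Z h = coef h (armaSymbol a b σ2) :=
  have := hA.isProbabilityMeasure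
  eq_coef_armaSymbol hA.causal (norm_autocov_le hA.gaussian hA.stationary hA.mean_zero)
    hA.autocov_recursion h

lemma IsARMA.isSmooth (hA : IsARMA P Z a b σ2) : IsSmooth (armaSymbol a b σ2) :=
  isSmooth_armaSymbol b σ2 hA.causal

lemma IsARMA.summable_autocov (hA : IsARMA P Z a b σ2) : Summable (autocov P Z) := by
  have := hA.isSmooth.summable_norm_coef.of_norm
  exact this.congr fun h => (hA.autocov_eq h).symm

theorem IsARMA.spectralDensity_eq (hA : IsARMA P Z a b σ2) (ω : ℝ) :
    spectralDensity (autocov P Z) ω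
      = (1 / (2 * Real.pi) : ℂ) * armaSymbol a b σ2 (ω : AddCircle (2 * Real.pi)) := by
  unfold spectralDensity
  simp only [hA.autocov_eq]
  rw [(spectral_hasSum hA.isSmooth ω).tsum_eq]

end Autocovariance

end ComplexARMA

/-! ### Products of Toeplitz matrices -/

namespace ComplexARMA

open AddCircle Matrix
open scoped Matrix.Norms.L2Operator

/-- The Toeplitz matrix of size `N` of a symbol. -/
noncomputable def toep (N : ℕ) : FreqSymbol →L[ℂ] Matrix (Fin N) (Fin N) ℂ where
  toFun f := Matrix.of fun s t => coef ((s.val : ℤ) - (t.val : ℤ)) f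
  map_add' f g := by
    ext s t
    simp
  map_smul' c f := by
    ext s t
    simp
  cont := continuous_matrix fun s t => (coef _).continuous

lemma toep_apply (N : ℕ) (f : FreqSymbol) (s t : Fin N) :
    toep N f s t = coef ((s.val : ℤ) - (t.val : ℤ)) f := rfl

lemma trace_toep (N : ℕ) (f : FreqSymbol) : (toep N f).trace = N * coef 0 f := by
  simp [Matrix.trace, toep_apply]

section Norms

variable {N : ℕ}

lemma norm_apply_le_l2_opNorm (A : Matrix (Fin N) (Fin N) ℂ) (i j : Fin N) : ‖A i j‖ ≤ ‖A‖ := by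
  have h1 := l2_opNorm_mulVec A (EuclideanSpace.single j 1)
  have h2 := PiLp.norm_apply_le
    ((EuclideanSpace.equiv (Fin N) ℂ).symm (A *ᵥ (EuclideanSpace.single j (1 : ℂ)).ofLp)) i
  have h3 := h2.trans h1
  simpa using h3

/-- The Schur test. -/
lemma l2_opNorm_le_of_sum_le {A : Matrix (Fin N) (Fin N) ℂ} {C : ℝ} (hC : 0 ≤ C)
    (hr : ∀ i, ∑ j, ‖A i j‖ ≤ C) (hc : ∀ j, ∑ i, ‖A i j‖ ≤ C) : ‖A‖ ≤ C := by
  rw [← l2_opNorm_toEuclideanCLM]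
  refine ContinuousLinearMap.opNorm_le_bound _ hC fun x => ?_
  refine le_of_sq_le_sq ?_ (by positivity)
  rw [EuclideanSpace.norm_sq_eq, mul_pow, EuclideanSpace.norm_sq_eq]
  have key : ∀ i, ‖(toEuclideanCLM (n := Fin N) (𝕜 := ℂ) A x) i‖ ^ 2
      ≤ C * ∑ j, ‖A i j‖ * ‖x j‖ ^ 2 := by
    intro i
    have e : (toEuclideanCLM (n := Fin N) (𝕜 := ℂ) A x) i = ∑ j, A i j * x j := by
      rw [ofLp_toEuclideanCLM]
      rfl
    rw [e]
    calc ‖∑ j, A i j * x j‖ ^ 2 ≤ (∑ j, ‖A i j‖ * ‖x j‖) ^ 2 := by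
          gcongr
          exact (norm_sum_le _ _).trans_eq (by simp)
      _ ≤ (∑ j, ‖A i j‖) * ∑ j, ‖A i j‖ * ‖x j‖ ^ 2 :=
          Finset.sum_sq_le_sum_mul_sum_of_sq_le_mul _ (fun _ _ => norm_nonneg _)
            (fun _ _ => by positivity) (fun _ _ => le_of_eq (by ring))
      _ ≤ _ := by
          gcongr
          exact hr i
  calc _ ≤ ∑ i, C * ∑ j, ‖A i j‖ * ‖x j‖ ^ 2 := Finset.sum_le_sum fun i _ => key i
    _ = C * ∑ j, (∑ i, ‖A i j‖) * ‖x j‖ ^ 2 := by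
        rw [← Finset.mul_sum, Finset.sum_comm]
        simp only [Finset.sum_mul]
    _ ≤ C * ∑ j, C * ‖x j‖ ^ 2 := by
        gcongr with j
        exact hc j
    _ = _ := by
        rw [← Finset.mul_sum]
        ring

lemma sum_norm_coef_le {u : FreqSymbol} (hu : IsSmooth u) (f : Fin N → ℤ)
    (hf : Function.Injective f) : ∑ i, ‖coef (f i) u‖ ≤ ∑' h : ℤ, ‖coef h u‖ := by
  rw [← Finset.sum_image (s := Finset.univ) (g := f) (f := fun h => ‖coef h u‖)
    (fun i _ j _ hij => hf hij)]
  exact hu.summable_norm_coef.sum_le_tsum _ fun _ _ => norm_nonneg _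

lemma norm_toep_le {u : FreqSymbol} (hu : IsSmooth u) : ‖toep N u‖ ≤ ∑' h : ℤ, ‖coef h u‖ := by
  refine l2_opNorm_le_of_sum_le (tsum_nonneg fun _ => norm_nonneg _) (fun i => ?_) fun j => ?_
  · exact sum_norm_coef_le hu (fun j : Fin N => (i.val : ℤ) - (j.val : ℤ)) fun a b h => by
      simpa [Fin.ext_iff] using h
  · exact sum_norm_coef_le hu (fun i : Fin N => (i.val : ℤ) - (j.val : ℤ)) fun a b h => by
      simpa [Fin.ext_iff] using h

lemma card_filter_shift_le (m : ℤ) :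
    ((Finset.univ.filter fun s : Fin N => ¬ (0 ≤ (s.val : ℤ) - m ∧ (s.val : ℤ) - m < N)).card : ℝ)
      ≤ |(m : ℝ)| := by
  have h : (Finset.univ.filter fun s : Fin N =>
      ¬ (0 ≤ (s.val : ℤ) - m ∧ (s.val : ℤ) - m < N)).card ≤ m.natAbs := by
    rcases le_total 0 m with hm | hm
    · rw [← Finset.card_range m.natAbs]
      refine Finset.card_le_card_of_injOn (fun s => s.val) (fun s hs => ?_)
        (fun a _ b _ hab => Fin.ext hab)
      have := s.isLt
      simp only [Finset.coe_filter, Finset.mem_univ, true_and, Set.mem_ofPred_eq] at hs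
      simp only [Finset.coe_range, Set.mem_Iio]
      omega
    · rw [← Finset.card_range m.natAbs]
      refine Finset.card_le_card_of_injOn (fun s => N - 1 - s.val) (fun s hs => ?_)
        (fun a _ b _ hab => Fin.ext ?_)
      · have := s.isLt
        simp only [Finset.coe_filter, Finset.mem_univ, true_and, Set.mem_ofPred_eq] at hs
        simp only [Finset.coe_range, Set.mem_Iio]
        omega
      · have := a.isLt
        have := b.isLt
        simp only at hab
        omega
  calc _ ≤ ((m.natAbs : ℕ) : ℝ) := by exact_mod_cast h
    _ = |(m : ℝ)| := by
      rw [Nat.cast_natAbs]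
      push_cast
      rfl

/-- The coefficient `u_{s-k} v_{k-t}` summed over the `k` outside the window `[0, N)` is the error
made by `T_N(u) T_N(v)`, as an approximation of `T_N(uv)`. -/
lemma norm_toep_mul_sub_apply_le {u : FreqSymbol} (hu : IsSmooth u) (v : FreqSymbol)
    (s t : Fin N) :
    ‖(toep N u * toep N v - toep N (u * v)) s t‖
      ≤ ∑' m : ℤ, (if 0 ≤ (s.val : ℤ) - m ∧ (s.val : ℤ) - m < N then 0
          else ‖coef m u‖ * ‖coef ((s.val : ℤ) - (t.val : ℤ) - m) v‖) := by
  classical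
  set f : ℤ → ℂ := fun m => coef m u * coef ((s.val : ℤ) - (t.val : ℤ) - m) v with hf
  have hsum : HasSum f (coef ((s.val : ℤ) - (t.val : ℤ)) (u * v)) := hu.hasSum_coef_mul v _
  have habs : Summable fun m => ‖f m‖ := by
    have : Summable fun m : ℤ => ‖coef m u‖ * ‖v‖ := hu.summable_norm_coef.mul_right _
    refine Summable.of_nonneg_of_le (fun _ => norm_nonneg _) (fun m => ?_) this
    rw [hf, norm_mul]
    exact mul_le_mul_of_nonneg_left (norm_coef_le _ _) (norm_nonneg _)
  set S : Finset ℤ := Finset.univ.image fun k : Fin N => (s.val : ℤ) - (k.val : ℤ) with hS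
  have hmem : ∀ m : ℤ, m ∈ S ↔ (0 ≤ (s.val : ℤ) - m ∧ (s.val : ℤ) - m < N) := by
    intro m
    simp only [hS, Finset.mem_image, Finset.mem_univ, true_and]
    constructor
    · rintro ⟨k, rfl⟩
      have := k.isLt
      omega
    · rintro ⟨h1, h2⟩
      exact ⟨⟨((s.val : ℤ) - m).toNat, by omega⟩, by simp only; omega⟩
  have hfin : (toep N u * toep N v) s t = ∑ m ∈ S, f m := by
    rw [hS, Finset.sum_image (fun a _ b _ h => by simpa [Fin.ext_iff] using h), Matrix.mul_apply]
    refine Finset.sum_congr rfl fun k _ => ?_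
    rw [toep_apply, toep_apply, hf]
    congr 3
    ring
  have hind : HasSum (fun m => if m ∈ S then 0 else f m)
      (coef ((s.val : ℤ) - (t.val : ℤ)) (u * v) - ∑ m ∈ S, f m) := by
    have h1 : HasSum (fun m => if m ∈ S then f m else 0) (∑ m ∈ S, f m) := by
      have h2 : HasSum (fun m => if m ∈ S then f m else 0) (∑ m ∈ S, if m ∈ S then f m else 0) :=
        hasSum_sum_of_ne_finset_zero fun m hm => by simp [hm]
      rwa [Finset.sum_congr rfl fun m hm => if_pos hm] at h2
    refine (hsum.sub h1).congr_fun fun m => ?_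
    by_cases hm : m ∈ S <;> simp [hm]
  rw [Matrix.sub_apply, hfin, toep_apply, norm_sub_rev, ← hind.tsum_eq]
  have e : ∀ m, ‖if m ∈ S then 0 else f m‖ = (if 0 ≤ (s.val : ℤ) - m ∧ (s.val : ℤ) - m < N then 0
          else ‖coef m u‖ * ‖coef ((s.val : ℤ) - (t.val : ℤ) - m) v‖) := by
    intro m
    simp only [hmem]
    split_ifs <;> simp [hf]
  simp only [← e]
  refine norm_tsum_le_tsum_norm (Summable.of_nonneg_of_le (fun _ => norm_nonneg _) (fun m => ?_)
    habs)
  split_ifs <;> simp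

/-- The entries of `T_N(u) T_N(v) - T_N(uv)` are absolutely summable, uniformly in `N`. -/
theorem sum_norm_toep_mul_sub_le {u v : FreqSymbol} (hu : IsSmooth u) (hv : IsSmooth v) :
    ∑ s, ∑ t, ‖(toep N u * toep N v - toep N (u * v)) s t‖
      ≤ (∑' m : ℤ, (1 + |(m : ℝ)|) * ‖coef m u‖) * ∑' m : ℤ, ‖coef m v‖ := by
  set V := ∑' m : ℤ, ‖coef m v‖
  have hV : 0 ≤ V := tsum_nonneg fun _ => norm_nonneg _
  have hs1 : ∀ s t : Fin N, Summable fun m : ℤ =>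
      (if 0 ≤ (s.val : ℤ) - m ∧ (s.val : ℤ) - m < N then 0
          else ‖coef m u‖ * ‖coef ((s.val : ℤ) - (t.val : ℤ) - m) v‖) := by
    intro s t
    have : Summable fun m : ℤ => ‖coef m u‖ * ‖v‖ := hu.summable_norm_coef.mul_right _
    refine Summable.of_nonneg_of_le (fun m => ?_) (fun m => ?_) this
    · split_ifs <;> positivity
    · split_ifs
      · positivity
      · exact mul_le_mul_of_nonneg_left (norm_coef_le _ _) (norm_nonneg _)
  calc ∑ s, ∑ t, ‖(toep N u * toep N v - toep N (u * v)) s t‖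
      ≤ ∑ s : Fin N, ∑ t : Fin N, ∑' m : ℤ, (if 0 ≤ (s.val : ℤ) - m ∧ (s.val : ℤ) - m < N then 0
          else ‖coef m u‖ * ‖coef ((s.val : ℤ) - (t.val : ℤ) - m) v‖) :=
        Finset.sum_le_sum fun s _ => Finset.sum_le_sum fun t _ =>
          norm_toep_mul_sub_apply_le hu v s t
    _ = ∑' m : ℤ, ∑ s : Fin N, ∑ t : Fin N, (if 0 ≤ (s.val : ℤ) - m ∧ (s.val : ℤ) - m < N then 0
          else ‖coef m u‖ * ‖coef ((s.val : ℤ) - (t.val : ℤ) - m) v‖) := by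
        rw [Summable.tsum_finsetSum fun s _ => summable_sum fun t _ => hs1 s t]
        refine Finset.sum_congr rfl fun s _ => ?_
        rw [Summable.tsum_finsetSum fun t _ => hs1 s t]
    _ ≤ ∑' m : ℤ, ((1 + |(m : ℝ)|) * ‖coef m u‖) * V := by
        refine Summable.tsum_le_tsum (fun m => ?_)
          (summable_sum fun s _ => summable_sum fun t _ => hs1 s t)
          (hu.summable_coef.mul_right V)
        have h1 : ∀ s : Fin N, ∑ t : Fin N,
            (if 0 ≤ (s.val : ℤ) - m ∧ (s.val : ℤ) - m < N then (0 : ℝ)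
              else ‖coef m u‖ * ‖coef ((s.val : ℤ) - (t.val : ℤ) - m) v‖)
            ≤ if ¬ (0 ≤ (s.val : ℤ) - m ∧ (s.val : ℤ) - m < N) then ‖coef m u‖ * V else 0 := by
          intro s
          by_cases h : 0 ≤ (s.val : ℤ) - m ∧ (s.val : ℤ) - m < N
          · rw [if_neg (not_not.2 h)]
            simp only [if_pos h, Finset.sum_const_zero, le_refl]
          · simp only [h, if_false, not_false_eq_true, if_true]
            rw [← Finset.mul_sum]
            refine mul_le_mul_of_nonneg_left ?_ (norm_nonneg _)
            exact sum_norm_coef_le hv (fun t : Fin N => (s.val : ℤ) - (t.val : ℤ) - m)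
              fun a b h => by simpa [Fin.ext_iff] using h
        refine (Finset.sum_le_sum fun s _ => h1 s).trans ?_
        rw [← Finset.sum_filter, Finset.sum_const, nsmul_eq_mul, mul_assoc]
        refine mul_le_mul_of_nonneg_right ?_ (by positivity)
        linarith [card_filter_shift_le (N := N) m]
    _ = _ := tsum_mul_right

end Norms

end ComplexARMA

/-! ### Traces of products of inverse Toeplitz matrices -/

namespace ComplexARMA

open AddCircle Matrix
open scoped Matrix.Norms.L2Operator

/-- A sequence of matrices, the `N`-th one of size `N`. -/
abbrev MatSeq : Type := ∀ N : ℕ, Matrix (Fin N) (Fin N) ℂ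

/-- Uniform boundedness in the operator norm. -/
def BoundedOp (K : MatSeq) : Prop := ∃ C : ℝ, ∀ N, ‖K N‖ ≤ C

/-- Uniform boundedness in the trace norm, expressed by duality with the operator norm. -/
def BoundedTrace (K : MatSeq) : Prop :=
  ∃ C : ℝ, ∀ N, ∀ X : Matrix (Fin N) (Fin N) ℂ, ‖(X * K N).trace‖ ≤ C * ‖X‖

lemma BoundedOp.mul {K L : MatSeq} (hK : BoundedOp K) (hL : BoundedOp L) :
    BoundedOp fun N => K N * L N := by
  obtain ⟨C, hC⟩ := hK
  obtain ⟨D, hD⟩ := hL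
  refine ⟨C * D, fun N => (norm_mul_le _ _).trans ?_⟩
  exact mul_le_mul (hC N) (hD N) (norm_nonneg _) ((norm_nonneg _).trans (hC N))

lemma boundedOp_toep {u : FreqSymbol} (hu : IsSmooth u) : BoundedOp fun N => toep N u :=
  ⟨_, fun _ => norm_toep_le hu⟩

lemma BoundedTrace.add {K L : MatSeq} (hK : BoundedTrace K) (hL : BoundedTrace L) :
    BoundedTrace fun N => K N + L N := by
  obtain ⟨C, hC⟩ := hK
  obtain ⟨D, hD⟩ := hL
  refine ⟨C + D, fun N X => ?_⟩
  rw [Matrix.mul_add, Matrix.trace_add, add_mul]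
  exact (norm_add_le _ _).trans (add_le_add (hC N X) (hD N X))

lemma BoundedTrace.neg {K : MatSeq} (hK : BoundedTrace K) : BoundedTrace fun N => -K N := by
  obtain ⟨C, hC⟩ := hK
  exact ⟨C, fun N X => by simpa using hC N X⟩

lemma BoundedTrace.mul_left {K L : MatSeq} (hL : BoundedOp L) (hK : BoundedTrace K) :
    BoundedTrace fun N => L N * K N := by
  obtain ⟨C, hC⟩ := hK
  obtain ⟨D, hD⟩ := hL
  refine ⟨|C| * D, fun N X => ?_⟩
  rw [← Matrix.mul_assoc]
  calc _ ≤ C * ‖X * L N‖ := hC N _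
    _ ≤ |C| * (‖X‖ * D) := by
        have h1 : ‖X * L N‖ ≤ ‖X‖ * D :=
          (norm_mul_le _ _).trans (mul_le_mul_of_nonneg_left (hD N) (norm_nonneg _))
        exact mul_le_mul (le_abs_self C) h1 (norm_nonneg _) (abs_nonneg _)
    _ = _ := by ring

lemma BoundedTrace.mul_right {K L : MatSeq} (hK : BoundedTrace K) (hL : BoundedOp L) :
    BoundedTrace fun N => K N * L N := by
  obtain ⟨C, hC⟩ := hK
  obtain ⟨D, hD⟩ := hL
  refine ⟨|C| * D, fun N X => ?_⟩
  rw [← Matrix.mul_assoc, Matrix.trace_mul_comm, ← Matrix.mul_assoc]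
  calc _ ≤ C * ‖L N * X‖ := hC N _
    _ ≤ |C| * (D * ‖X‖) := by
        have h1 : ‖L N * X‖ ≤ D * ‖X‖ :=
          (norm_mul_le _ _).trans (mul_le_mul_of_nonneg_right (hD N) (norm_nonneg _))
        exact mul_le_mul (le_abs_self C) h1 (norm_nonneg _) (abs_nonneg _)
    _ = _ := by ring

lemma boundedTrace_of_sum_norm_le {K : MatSeq} {C : ℝ}
    (hC : ∀ N, ∑ i, ∑ j, ‖K N i j‖ ≤ C) : BoundedTrace K := by
  refine ⟨C, fun N X => ?_⟩
  rw [Matrix.trace_mul_comm]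
  calc ‖(K N * X).trace‖ = ‖∑ i, ∑ j, K N i j * X j i‖ := by
        simp only [Matrix.trace, Matrix.diag_apply, Matrix.mul_apply]
    _ ≤ ∑ i, ∑ j, ‖K N i j‖ * ‖X‖ := by
        refine (norm_sum_le _ _).trans (Finset.sum_le_sum fun i _ => ?_)
        refine (norm_sum_le _ _).trans (Finset.sum_le_sum fun j _ => ?_)
        rw [norm_mul]
        exact mul_le_mul_of_nonneg_left (norm_apply_le_l2_opNorm X j i) (norm_nonneg _)
    _ = (∑ i, ∑ j, ‖K N i j‖) * ‖X‖ := by simp only [Finset.sum_mul]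
    _ ≤ C * ‖X‖ := mul_le_mul_of_nonneg_right (hC N) (norm_nonneg _)

/-- `K` agrees with the Toeplitz matrices of the symbol `u`, up to an error that is uniformly
bounded in the trace norm. -/
def ApproxToep (K : MatSeq) (u : FreqSymbol) : Prop := BoundedTrace fun N => K N - toep N u

lemma boundedTrace_toep_mul_sub {u v : FreqSymbol} (hu : IsSmooth u) (hv : IsSmooth v) :
    BoundedTrace fun N => toep N u * toep N v - toep N (u * v) :=
  boundedTrace_of_sum_norm_le fun _ => sum_norm_toep_mul_sub_le hu hv

/-- `K L - T(uv) = K (L - T(v)) + (K - T(u)) T(v) + (T(u) T(v) - T(uv))`, and the trace norm is an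
ideal norm. -/
lemma ApproxToep.mul {K L : MatSeq} {u v : FreqSymbol} (hK : ApproxToep K u)
    (hL : ApproxToep L v) (hKb : BoundedOp K) (hu : IsSmooth u) (hv : IsSmooth v) :
    ApproxToep (fun N => K N * L N) (u * v) := by
  have h := ((BoundedTrace.mul_left hKb hL).add
    (BoundedTrace.mul_right hK (boundedOp_toep hv))).add (boundedTrace_toep_mul_sub hu hv)
  unfold ApproxToep
  convert! h using 2
  noncomm_ring

lemma ApproxToep.trace {K : MatSeq} {u : FreqSymbol} (hK : ApproxToep K u) :
    ∃ C : ℝ, ∀ N : ℕ, ‖(K N).trace - N * coef 0 u‖ ≤ C := by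
  obtain ⟨C, hC⟩ := hK
  refine ⟨|C|, fun N => ?_⟩
  have h1 := hC N 1
  rw [Matrix.one_mul, Matrix.trace_sub, trace_toep] at h1
  refine h1.trans ?_
  have h2 : ‖(1 : Matrix (Fin N) (Fin N) ℂ)‖ ≤ 1 := by
    rw [← Matrix.diagonal_one, l2_opNorm_diagonal]
    exact (pi_norm_le_iff_of_nonneg zero_le_one).2 fun _ => by simp
  calc C * ‖(1 : Matrix (Fin N) (Fin N) ℂ)‖ ≤ |C| * ‖(1 : Matrix (Fin N) (Fin N) ℂ)‖ :=
        mul_le_mul_of_nonneg_right (le_abs_self C) (norm_nonneg _)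
    _ ≤ |C| := mul_le_of_le_one_right (abs_nonneg _) h2

/-! ### Toeplitz matrices of positive symbols -/

/-- The quadratic form of a Toeplitz matrix is the integral of the symbol against the squared
modulus of a trigonometric polynomial. -/
lemma toep_quadForm {N : ℕ} (f : FreqSymbol) (v : Fin N → ℂ) :
    star v ⬝ᵥ (toep N f *ᵥ v)
      = ∫ t, ((‖∑ j, v j * (fourier (-(j.val : ℤ)) t : ℂ)‖ ^ 2 : ℝ) : ℂ) * f t
          ∂haarAddCircle := by
  have e : ∀ t : AddCircle (2 * Real.pi),
      ((‖∑ j, v j * (fourier (-(j.val : ℤ)) t : ℂ)‖ ^ 2 : ℝ) : ℂ) * f t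
      = ∑ i, ∑ j, (star (v i) * v j) *
          ((fourier ((i.val : ℤ) - (j.val : ℤ)) t : ℂ) * f t) := by
    intro t
    rw [← Complex.normSq_eq_norm_sq, ← Complex.mul_conj, mul_comm (∑ j, _), map_sum,
      Finset.sum_mul_sum, Finset.sum_mul]
    refine Finset.sum_congr rfl fun i _ => ?_
    rw [Finset.sum_mul]
    refine Finset.sum_congr rfl fun j _ => ?_
    rw [sub_eq_add_neg, fourier_add, map_mul, fourier_neg, Complex.conj_conj, Complex.star_def]
    ring
  simp only [e]
  rw [integral_finsetSum _ fun i _ => integrable_finsetSum _ fun j _ =>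
    (integrable_fourier_mul _ f).const_mul _]
  simp only [dotProduct, mulVec, Finset.mul_sum, Pi.star_apply]
  refine Finset.sum_congr rfl fun i _ => ?_
  rw [integral_finsetSum _ fun j _ => (integrable_fourier_mul _ f).const_mul _]
  refine Finset.sum_congr rfl fun j _ => ?_
  rw [integral_const_mul, toep_apply, coef_apply]
  ring

lemma toep_one (N : ℕ) : toep N 1 = 1 := by
  ext i j
  rw [toep_apply, coef_one, Matrix.one_apply]
  simp only [Fin.ext_iff]
  congr 1
  apply propext
  omega

/-- The quadratic form of a Toeplitz matrix is bounded below by the minimum of its symbol. -/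
lemma le_re_toep_quadForm {N : ℕ} {f : FreqSymbol} {m : ℝ} (hm : ∀ t, m ≤ (f t).re)
    (v : Fin N → ℂ) : m * ∑ i, ‖v i‖ ^ 2 ≤ (star v ⬝ᵥ (toep N f *ᵥ v)).re := by
  have h0 : ∑ i, ‖v i‖ ^ 2 = ∫ t, ‖∑ j, v j * (fourier (-(j.val : ℤ)) t : ℂ)‖ ^ 2
      ∂haarAddCircle (T := 2 * Real.pi) := by
    have h1 := toep_quadForm 1 v
    simp only [toep_one, one_mulVec, ContinuousMap.one_apply, mul_one] at h1
    rw [integral_complex_ofReal] at h1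
    have h2 : star v ⬝ᵥ v = ((∑ i, ‖v i‖ ^ 2 : ℝ) : ℂ) := by
      simp only [dotProduct, Pi.star_apply, Complex.star_def]
      push_cast
      refine Finset.sum_congr rfl fun i _ => ?_
      rw [mul_comm, Complex.mul_conj, Complex.normSq_eq_norm_sq]
      push_cast
      rfl
    rw [h2] at h1
    exact_mod_cast h1
  have hc : Continuous fun t : AddCircle (2 * Real.pi) =>
      ‖∑ j, v j * (fourier (-(j.val : ℤ)) t : ℂ)‖ ^ 2 := by
    refine ((continuous_finsetSum _ fun j _ => continuous_const.mul ?_).norm).pow 2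
    exact (fourier (-(j.val : ℤ)) : FreqSymbol).continuous
  have hint : Integrable (fun t => ((‖∑ j, v j * (fourier (-(j.val : ℤ)) t : ℂ)‖ ^ 2 : ℝ) : ℂ)
      * f t) (haarAddCircle (T := 2 * Real.pi)) :=
    Continuous.integrable_of_hasCompactSupport
      ((Complex.continuous_ofReal.comp hc).mul f.continuous) (HasCompactSupport.of_compactSpace _)
  rw [toep_quadForm, h0, ← integral_const_mul]
  have h3 := integral_re hint
  simp only [RCLike.re_to_complex] at h3
  rw [← h3]
  refine integral_mono ((hc.integrable_of_hasCompactSupport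
    (HasCompactSupport.of_compactSpace _)).const_mul m) hint.re fun t => ?_
  simp only [Complex.re_ofReal_mul]
  rw [mul_comm m]
  exact mul_le_mul_of_nonneg_left (hm t) (by positivity)

/-- The inverses of the Toeplitz matrices of a positive symbol are uniformly bounded. -/
theorem norm_inv_toep_le {N : ℕ} {f : FreqSymbol} {m : ℝ} (hm0 : 0 < m)
    (hm : ∀ t, m ≤ (f t).re) (hdet : IsUnit (toep N f).det) : ‖(toep N f)⁻¹‖ ≤ m⁻¹ := by
  rw [← l2_opNorm_toEuclideanCLM]
  refine ContinuousLinearMap.opNorm_le_bound _ (by positivity) fun x => ?_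
  set y : EuclideanSpace ℂ (Fin N) := toEuclideanCLM (n := Fin N) (𝕜 := ℂ) (toep N f)⁻¹ x with hy
  have hx : x = WithLp.toLp 2 (toep N f *ᵥ y.ofLp) := by
    rw [hy, ofLp_toEuclideanCLM, mulVec_mulVec, mul_nonsing_inv _ hdet, one_mulVec]
  have h1 := le_re_toep_quadForm hm y.ofLp
  rw [← EuclideanSpace.norm_sq_eq] at h1
  have h2 : star y.ofLp ⬝ᵥ (toep N f *ᵥ y.ofLp) = inner ℂ y x := by
    rw [hx, EuclideanSpace.inner_eq_star_dotProduct, dotProduct_comm]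
  rw [h2] at h1
  have h3 : (inner ℂ y x).re ≤ ‖y‖ * ‖x‖ := (Complex.re_le_norm _).trans (norm_inner_le_norm y x)
  rcases (norm_nonneg y).eq_or_lt with h0 | h0
  · rw [← h0]
    positivity
  · rw [inv_mul_eq_div, le_div_iff₀ hm0]
    have : ‖y‖ * (‖y‖ * m) ≤ ‖y‖ * ‖x‖ := by nlinarith
    exact le_of_mul_le_mul_left this h0

/-- A smooth symbol with positive real part whose Toeplitz matrices are invertible. -/
structure PosSymbol (F : FreqSymbol) : Prop where
  smooth : IsSmooth F
  pos : ∀ t, 0 < (F t).re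
  det : ∀ N, IsUnit (toep N F).det

namespace PosSymbol

variable {F : FreqSymbol}

lemma isUnit (hF : PosSymbol F) : IsUnit F := by
  rw [ContinuousMap.isUnit_iff_forall_ne_zero]
  intro t h
  have := hF.pos t
  rw [h] at this
  simp at this

lemma boundedOp_inv (hF : PosSymbol F) : BoundedOp fun N => (toep N F)⁻¹ := by
  obtain ⟨t, -, ht⟩ := isCompact_univ.exists_isMinOn Set.univ_nonempty
    (Complex.continuous_re.comp F.continuous).continuousOn
  exact ⟨_, fun N => norm_inv_toep_le (hF.pos t) (fun u => ht (Set.mem_univ u)) (hF.det N)⟩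

lemma boundedOp_inv_mul (hF : PosSymbol F) {g : FreqSymbol} (hg : IsSmooth g) :
    BoundedOp fun N => (toep N F)⁻¹ * toep N g :=
  hF.boundedOp_inv.mul (boundedOp_toep hg)

lemma smooth_div (hF : PosSymbol F) {g : FreqSymbol} (hg : IsSmooth g) :
    IsSmooth (Ring.inverse F * g) :=
  (hF.smooth.inverse hF.isUnit).mul hg

/-- `T_N(F)⁻¹ T_N(g)` is `T_N(g / F)` up to an error bounded in the trace norm, because
`T_N(F) T_N(g / F)` is `T_N(g)` up to such an error and `T_N(F)⁻¹` is bounded. -/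
lemma approx_inv_mul (hF : PosSymbol F) {g : FreqSymbol} (hg : IsSmooth g) :
    ApproxToep (fun N => (toep N F)⁻¹ * toep N g) (Ring.inverse F * g) := by
  have h := (BoundedTrace.mul_left hF.boundedOp_inv
    (boundedTrace_toep_mul_sub hF.smooth (hF.smooth_div hg))).neg
  unfold ApproxToep
  convert! h using 2 with N
  rw [Matrix.mul_sub, ← Matrix.mul_assoc, nonsing_inv_mul _ (hF.det N), Matrix.one_mul,
    ← mul_assoc, Ring.mul_inverse_cancel _ hF.isUnit, one_mul, neg_sub]

theorem trace_two (hF : PosSymbol F) {g₁ g₂ : FreqSymbol} (h₁ : IsSmooth g₁)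
    (h₂ : IsSmooth g₂) :
    ∃ C : ℝ, ∀ N : ℕ, ‖(((toep N F)⁻¹ * toep N g₁) * ((toep N F)⁻¹ * toep N g₂)).trace
      - N * coef 0 ((Ring.inverse F * g₁) * (Ring.inverse F * g₂))‖ ≤ C :=
  ((hF.approx_inv_mul h₁).mul (hF.approx_inv_mul h₂) (hF.boundedOp_inv_mul h₁)
    (hF.smooth_div h₁) (hF.smooth_div h₂)).trace

theorem trace_three (hF : PosSymbol F) {g₁ g₂ g₃ : FreqSymbol} (h₁ : IsSmooth g₁)
    (h₂ : IsSmooth g₂) (h₃ : IsSmooth g₃) :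
    ∃ C : ℝ, ∀ N : ℕ, ‖(((toep N F)⁻¹ * toep N g₁) * ((toep N F)⁻¹ * toep N g₂)
        * ((toep N F)⁻¹ * toep N g₃)).trace
      - N * coef 0 ((Ring.inverse F * g₁) * (Ring.inverse F * g₂) * (Ring.inverse F * g₃))‖ ≤ C :=
  (((hF.approx_inv_mul h₁).mul (hF.approx_inv_mul h₂) (hF.boundedOp_inv_mul h₁)
    (hF.smooth_div h₁) (hF.smooth_div h₂)).mul (hF.approx_inv_mul h₃)
    ((hF.boundedOp_inv_mul h₁).mul (hF.boundedOp_inv_mul h₂))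
    ((hF.smooth_div h₁).mul (hF.smooth_div h₂)) (hF.smooth_div h₃)).trace

end PosSymbol

end ComplexARMA

/-! ### Wirtinger derivatives in Banach spaces -/

namespace ComplexARMA

lemma differentiableAt_of_contDiffOn {n : ℕ} {E : Type*} [NormedAddCommGroup E] [NormedSpace ℝ E]
    {f : (Fin n → ℂ) → E} {Θ : Set (Fin n → ℂ)}
    (hΘ : IsOpen Θ) {m : ℕ} (hf : ContDiffOn ℝ m f Θ) (hm : 1 ≤ m) {θ : Fin n → ℂ}
    (hθ : θ ∈ Θ) : DifferentiableAt ℝ f θ :=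
  (hf.contDiffAt (hΘ.mem_nhds hθ)).differentiableAt (by
    have : m ≠ 0 := by omega
    exact_mod_cast this)

section Wirtinger

variable {n : ℕ} {E F : Type*} [NormedAddCommGroup E] [NormedSpace ℝ E] [NormedSpace ℂ E]
  [NormedAddCommGroup F] [NormedSpace ℝ F] [NormedSpace ℂ F]

/-- The complex coordinate that an index of `{1, …, n, 1̄, …, n̄}` refers to. -/
def Idx.coord (α : Idx n) : Fin n := α.elim id id

/-- The coefficient of `∂/∂y` in `2 ∂_α`: `-√-1` for `i` and `√-1` for `ī`. -/
noncomputable def Idx.sign (α : Idx n) : ℂ := α.elim (fun _ => -Complex.I) (fun _ => Complex.I)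

/-- The Wirtinger derivative of a function with values in a complex Banach space, defined through
the real Fréchet derivative. -/
noncomputable def wd (α : Idx n) (f : (Fin n → ℂ) → E) (θ : Fin n → ℂ) : E :=
  (1 / 2 : ℂ) • (fderiv ℝ f θ (Pi.single α.coord 1)
    + α.sign • fderiv ℝ f θ (Pi.single α.coord Complex.I))

lemma wirtinger_eq_wd (α : Idx n) {f : (Fin n → ℂ) → ℂ} {θ : Fin n → ℂ}
    (hf : DifferentiableAt ℝ f θ) : wirtinger α f θ = wd α f θ := by
  rcases α with i | i <;>
    simp [wirtinger, wd, hf.lineDeriv_eq_fderiv, Idx.coord, Idx.sign, sub_eq_add_neg]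

lemma wirtinger_congr (α : Idx n) {f g : (Fin n → ℂ) → ℂ} {θ : Fin n → ℂ}
    (h : f =ᶠ[nhds θ] g) : wirtinger α f θ = wirtinger α g θ := by
  rcases α with i | i <;> simp [wirtinger, h.lineDeriv_eq]

lemma wd_congr (α : Idx n) {f g : (Fin n → ℂ) → E} {θ : Fin n → ℂ}
    (h : f =ᶠ[nhds θ] g) : wd α f θ = wd α g θ := by
  simp [wd, h.fderiv_eq]

lemma wd_congr_of_isOpen (α : Idx n) {f g : (Fin n → ℂ) → E} {Θ : Set (Fin n → ℂ)}
    (hΘ : IsOpen Θ) (h : ∀ θ ∈ Θ, f θ = g θ) {θ : Fin n → ℂ} (hθ : θ ∈ Θ) :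
    wd α f θ = wd α g θ :=
  wd_congr α (Filter.eventually_of_mem (hΘ.mem_nhds hθ) h)

lemma wd_const (α : Idx n) (c : E) (θ : Fin n → ℂ) : wd α (fun _ => c) θ = 0 := by
  simp [wd]

lemma wd_add (α : Idx n) {f g : (Fin n → ℂ) → E} {θ : Fin n → ℂ}
    (hf : DifferentiableAt ℝ f θ) (hg : DifferentiableAt ℝ g θ) :
    wd α (fun θ => f θ + g θ) θ = wd α f θ + wd α g θ := by
  simp only [wd, fderiv_fun_add hf hg, add_apply]
  module

lemma wd_sub (α : Idx n) {f g : (Fin n → ℂ) → E} {θ : Fin n → ℂ}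
    (hf : DifferentiableAt ℝ f θ) (hg : DifferentiableAt ℝ g θ) :
    wd α (fun θ => f θ - g θ) θ = wd α f θ - wd α g θ := by
  simp only [wd, fderiv_fun_sub hf hg, sub_apply]
  module

lemma wd_clm (α : Idx n) (L : E →L[ℂ] F) {f : (Fin n → ℂ) → E} {θ : Fin n → ℂ}
    (hf : DifferentiableAt ℝ f θ) : wd α (fun θ => L (f θ)) θ = L (wd α f θ) := by
  have h : fderiv ℝ (fun θ => L (f θ)) θ = (L.restrictScalars ℝ).comp (fderiv ℝ f θ) :=
    (((L.restrictScalars ℝ).hasFDerivAt).comp θ hf.hasFDerivAt).fderiv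
  simp [wd, h]

lemma wd_sum (α : Idx n) {ι : Type*} (s : Finset ι) {f : ι → (Fin n → ℂ) → E} {θ : Fin n → ℂ}
    (hf : ∀ i ∈ s, DifferentiableAt ℝ (f i) θ) :
    wd α (fun θ => ∑ i ∈ s, f i θ) θ = ∑ i ∈ s, wd α (f i) θ := by
  simp only [wd, fderiv_fun_sum hf, sum_apply, Finset.smul_sum,
    ← Finset.sum_add_distrib]

lemma contDiffOn_wd (α : Idx n) {f : (Fin n → ℂ) → E} {Θ : Set (Fin n → ℂ)} (hΘ : IsOpen Θ)
    {k m : ℕ} (hf : ContDiffOn ℝ m f Θ) (hk : k + 1 ≤ m) : ContDiffOn ℝ k (wd α f) Θ := by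
  have h := hf.fderiv_of_isOpen hΘ (m := k) (by exact_mod_cast hk)
  unfold wd
  exact ((h.clm_apply contDiffOn_const).add
    ((h.clm_apply contDiffOn_const).const_smul _)).const_smul _

/-- Wirtinger derivatives commute, by the symmetry of the second Fréchet derivative. -/
lemma wd_comm (α β : Idx n) {f : (Fin n → ℂ) → E} {Θ : Set (Fin n → ℂ)} (hΘ : IsOpen Θ)
    {m : ℕ} (hf : ContDiffOn ℝ m f Θ) (hm : 2 ≤ m) {θ : Fin n → ℂ} (hθ : θ ∈ Θ) :
    wd α (wd β f) θ = wd β (wd α f) θ := by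
  have hs : IsSymmSndFDerivAt ℝ f θ :=
    (hf.contDiffAt (hΘ.mem_nhds hθ)).isSymmSndFDerivAt (by simpa using (by exact_mod_cast hm))
  have hd : DifferentiableAt ℝ (fderiv ℝ f) θ :=
    ((hf.fderiv_of_isOpen hΘ (m := 1) (by exact_mod_cast hm)).contDiffAt
      (hΘ.mem_nhds hθ)).differentiableAt (by simp)
  have key : ∀ (γ : Idx n) (v : Fin n → ℂ), fderiv ℝ (wd γ f) θ v
      = (1 / 2 : ℂ) • (fderiv ℝ (fderiv ℝ f) θ v (Pi.single γ.coord 1)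
        + γ.sign • fderiv ℝ (fderiv ℝ f) θ v (Pi.single γ.coord Complex.I)) := by
    intro γ v
    have h1 : ∀ w : Fin n → ℂ, HasFDerivAt (fun θ' => fderiv ℝ f θ' w)
        ((ContinuousLinearMap.apply ℝ E w).comp (fderiv ℝ (fderiv ℝ f) θ)) θ := fun w =>
      ((ContinuousLinearMap.apply ℝ E w).hasFDerivAt).comp θ hd.hasFDerivAt
    have h2 := (((h1 (Pi.single γ.coord 1)).fun_add
      ((h1 (Pi.single γ.coord Complex.I)).fun_const_smul γ.sign)).fun_const_smul (1 / 2 : ℂ)).fderiv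
    have h3 : wd γ f = fun θ' => (1 / 2 : ℂ) • (fderiv ℝ f θ' (Pi.single γ.coord 1)
      + γ.sign • fderiv ℝ f θ' (Pi.single γ.coord Complex.I)) := rfl
    rw [h3, h2]
    rfl
  have e : ∀ v w, fderiv ℝ (fderiv ℝ f) θ v w = fderiv ℝ (fderiv ℝ f) θ w v := fun v w => hs v w
  rw [wd, wd, key, key, key, key, e (Pi.single α.coord 1), e (Pi.single α.coord 1),
    e (Pi.single α.coord Complex.I), e (Pi.single α.coord Complex.I)]
  module

end Wirtinger

section Algebra

variable {n : ℕ} {A : Type*} [NormedRing A] [NormedAlgebra ℂ A] [NormedSpace ℝ A]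

lemma wd_mul (α : Idx n) {f g : (Fin n → ℂ) → A} {θ : Fin n → ℂ}
    (hf : DifferentiableAt ℝ f θ) (hg : DifferentiableAt ℝ g θ) :
    wd α (fun θ => f θ * g θ) θ = wd α f θ * g θ + f θ * wd α g θ := by
  have h : HasFDerivAt (fun θ => f θ * g θ) _ θ :=
    ((ContinuousLinearMap.mul ℂ A).bilinearRestrictScalars ℝ).hasFDerivAt_of_bilinear
      hf.hasFDerivAt hg.hasFDerivAt
  simp only [wd, h.fderiv]
  simp [mul_add, add_mul]
  abel

lemma contDiffOn_ringInverse_comp [HasSummableGeomSeries A] {f : (Fin n → ℂ) → A}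
    {Θ : Set (Fin n → ℂ)} {m : ℕ} (hf : ContDiffOn ℝ m f Θ) (hu : ∀ θ ∈ Θ, IsUnit (f θ)) :
    ContDiffOn ℝ m (fun θ => Ring.inverse (f θ)) Θ := by
  intro θ hθ
  obtain ⟨u, hu⟩ := hu θ hθ
  have h0 : ContDiffAt ℝ m Ring.inverse (f θ) := by
    rw [← hu]
    exact (contDiffAt_ringInverse ℂ u).restrict_scalars ℝ
  exact ContDiffAt.comp_contDiffWithinAt θ h0 (hf θ hθ)

end Algebra

end ComplexARMA

/-! ### Smooth families of symbols -/

namespace ComplexARMA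

variable {n : ℕ}

/-- A three times continuously differentiable family of symbols whose members, and whose first and
second Wirtinger derivatives in the parameter, are smooth functions of the frequency. -/
structure SmoothFamily (Θ : Set (Fin n → ℂ)) (X : (Fin n → ℂ) → FreqSymbol) : Prop where
  contDiffOn : ContDiffOn ℝ 3 X Θ
  smooth : ∀ θ ∈ Θ, IsSmooth (X θ)
  smooth₁ : ∀ θ ∈ Θ, ∀ α, IsSmooth (wd α X θ)
  smooth₂ : ∀ θ ∈ Θ, ∀ α β, IsSmooth (wd α (wd β X) θ)

lemma wd_sum_smul (α : Idx n) {ι : Type*} [Fintype ι] {c : ι → (Fin n → ℂ) → ℂ}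
    (φ : ι → FreqSymbol) {θ : Fin n → ℂ} (hc : ∀ i, DifferentiableAt ℝ (c i) θ) :
    wd α (fun θ => ∑ i, c i θ • φ i) θ = ∑ i, wd α (c i) θ • φ i := by
  have h1 : ∀ i, DifferentiableAt ℝ (fun θ => c i θ • φ i) θ := fun i =>
    (((ContinuousLinearMap.toSpanSingleton ℂ (φ i)).restrictScalars ℝ).differentiableAt).comp θ
      (hc i)
  rw [wd_sum α Finset.univ fun i _ => h1 i]
  refine Finset.sum_congr rfl fun i _ => ?_
  exact wd_clm α (ContinuousLinearMap.toSpanSingleton ℂ (φ i)) (hc i)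

lemma smoothFamily_sum_smul {Θ : Set (Fin n → ℂ)} (hΘ : IsOpen Θ) {ι : Type*} [Fintype ι]
    {c : ι → (Fin n → ℂ) → ℂ} {φ : ι → FreqSymbol} (hc : ∀ i, ContDiffOn ℝ 3 (c i) Θ)
    (hφ : ∀ i, IsSmooth (φ i)) : SmoothFamily Θ fun θ => ∑ i, c i θ • φ i := by
  have hd : ∀ θ ∈ Θ, ∀ i, DifferentiableAt ℝ (c i) θ := fun θ hθ i =>
    differentiableAt_of_contDiffOn (m := 3) hΘ (hc i) (by norm_num) hθ
  have hd1 : ∀ θ ∈ Θ, ∀ α i, DifferentiableAt ℝ (wd α (c i)) θ := fun θ hθ α i =>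
    differentiableAt_of_contDiffOn (m := 2) hΘ
      (contDiffOn_wd α hΘ (k := 2) (m := 3) (hc i) (by norm_num)) (by norm_num) hθ
  refine ⟨?_, fun θ _ => IsSmooth.sum _ fun i _ => (hφ i).smul _, fun θ hθ α => ?_,
    fun θ hθ α β => ?_⟩
  · exact ContDiffOn.sum fun i _ => ContDiff.comp_contDiffOn
      ((ContinuousLinearMap.toSpanSingleton ℂ (φ i)).restrictScalars ℝ).contDiff (hc i)
  · rw [wd_sum_smul α φ (hd θ hθ)]
    exact IsSmooth.sum _ fun i _ => (hφ i).smul _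
  · rw [wd_congr_of_isOpen α hΘ (fun θ' hθ' => wd_sum_smul β φ (hd θ' hθ')) hθ,
      wd_sum_smul α φ (hd1 θ hθ β)]
    exact IsSmooth.sum _ fun i _ => (hφ i).smul _

/-- Smooth families are closed under division: the derivatives of `X = H / G` are determined by
differentiating `X G = H`. -/
lemma SmoothFamily.of_mul_eq {Θ : Set (Fin n → ℂ)} (hΘ : IsOpen Θ)
    {X G H : (Fin n → ℂ) → FreqSymbol} (hG : SmoothFamily Θ G) (hH : SmoothFamily Θ H)
    (hu : ∀ θ ∈ Θ, IsUnit (G θ)) (h : ∀ θ ∈ Θ, X θ * G θ = H θ) : SmoothFamily Θ X := by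
  have div : ∀ θ ∈ Θ, ∀ Y K : FreqSymbol, IsSmooth K → Y * G θ = K → IsSmooth Y := by
    intro θ hθ Y K hK hY
    have : Y = K * Ring.inverse (G θ) := by
      rw [← hY, mul_assoc, Ring.mul_inverse_cancel _ (hu θ hθ), mul_one]
    rw [this]
    exact hK.mul ((hG.smooth θ hθ).inverse (hu θ hθ))
  have hX : ContDiffOn ℝ 3 X Θ := by
    have h1 : ContDiffOn ℝ 3 (fun θ => H θ * Ring.inverse (G θ)) Θ :=
      hH.contDiffOn.mul (contDiffOn_ringInverse_comp (m := 3) hG.contDiffOn hu)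
    refine h1.congr fun θ hθ => ?_
    rw [← h θ hθ, mul_assoc, Ring.mul_inverse_cancel _ (hu θ hθ), mul_one]
  have hd : ∀ {Y : (Fin n → ℂ) → FreqSymbol}, ContDiffOn ℝ 3 Y Θ → ∀ θ ∈ Θ,
      DifferentiableAt ℝ Y θ := fun hY θ hθ =>
    differentiableAt_of_contDiffOn (m := 3) hΘ hY (by norm_num) hθ
  have hd1 : ∀ {Y : (Fin n → ℂ) → FreqSymbol}, ContDiffOn ℝ 3 Y Θ → ∀ α, ∀ θ ∈ Θ,
      DifferentiableAt ℝ (wd α Y) θ := fun hY α θ hθ =>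
    differentiableAt_of_contDiffOn (m := 2) hΘ
      (contDiffOn_wd α hΘ (k := 2) (m := 3) hY (by norm_num)) (by norm_num) hθ
  have e1 : ∀ α, ∀ θ ∈ Θ, wd α X θ * G θ + X θ * wd α G θ = wd α H θ := by
    intro α θ hθ
    rw [← wd_mul α (hd hX θ hθ) (hd hG.contDiffOn θ hθ)]
    exact wd_congr_of_isOpen α hΘ h hθ
  have e2 : ∀ α β, ∀ θ ∈ Θ, wd α (wd β X) θ * G θ + wd β X θ * wd α G θ
      + (wd α X θ * wd β G θ + X θ * wd α (wd β G) θ) = wd α (wd β H) θ := by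
    intro α β θ hθ
    rw [← wd_congr_of_isOpen α hΘ (e1 β) hθ, wd_add α, wd_mul α, wd_mul α]
    · exact hd hX θ hθ
    · exact hd1 hG.contDiffOn β θ hθ
    · exact hd1 hX β θ hθ
    · exact hd hG.contDiffOn θ hθ
    · exact (hd1 hX β θ hθ).mul (hd hG.contDiffOn θ hθ)
    · exact (hd hX θ hθ).mul (hd1 hG.contDiffOn β θ hθ)
  have s0 : ∀ θ ∈ Θ, IsSmooth (X θ) := fun θ hθ =>
    div θ hθ _ _ (hH.smooth θ hθ) (h θ hθ)
  have s1 : ∀ θ ∈ Θ, ∀ α, IsSmooth (wd α X θ) := fun θ hθ α =>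
    div θ hθ _ (wd α H θ - X θ * wd α G θ)
      ((hH.smooth₁ θ hθ α).sub ((s0 θ hθ).mul (hG.smooth₁ θ hθ α))) (by rw [← e1 α θ hθ]; ring)
  refine ⟨hX, s0, s1, fun θ hθ α β => ?_⟩
  exact div θ hθ _ (wd α (wd β H) θ - wd β X θ * wd α G θ - wd α X θ * wd β G θ
      - X θ * wd α (wd β G) θ)
    ((((hH.smooth₂ θ hθ α β).sub ((s1 θ hθ β).mul (hG.smooth₁ θ hθ α))).sub
      ((s1 θ hθ α).mul (hG.smooth₁ θ hθ β))).sub ((s0 θ hθ).mul (hG.smooth₂ θ hθ α β)))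
    (by rw [← e2 α β θ hθ]; ring)

lemma smul_transfer_mul_transferConj {r : ℕ} (c : Fin r → ℂ) (k : ℂ) :
    k • (transfer c * transferConj c)
      = ∑ p : Fin (r + 1) × Fin (r + 1), (k * ((Fin.cons 1 c : Fin (r + 1) → ℂ) p.1
          * star ((Fin.cons 1 c : Fin (r + 1) → ℂ) p.2)))
        • fourier (-(p.1.val : ℤ) + (p.2.val : ℤ)) := by
  rw [transfer, transferConj, Finset.sum_mul_sum, Fintype.sum_prod_type, Finset.smul_sum]
  refine Finset.sum_congr rfl fun i _ => ?_
  rw [Finset.smul_sum]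
  refine Finset.sum_congr rfl fun j _ => ?_
  rw [smul_mul_smul_comm, fourier_mul_fourier, smul_smul]

lemma smoothFamily_transfer {Θ : Set (Fin n → ℂ)} (hΘ : IsOpen Θ) {r : ℕ}
    {c : (Fin n → ℂ) → Fin r → ℂ} (hc : ContDiffOn ℝ 3 c Θ) {k : (Fin n → ℂ) → ℂ}
    (hk : ContDiffOn ℝ 3 k Θ) :
    SmoothFamily Θ fun θ => k θ • (transfer (c θ) * transferConj (c θ)) := by
  simp only [smul_transfer_mul_transferConj]
  have hcons : ∀ i : Fin (r + 1),
      ContDiffOn ℝ 3 (fun θ => (Fin.cons 1 (c θ) : Fin (r + 1) → ℂ) i) Θ := by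
    intro i
    refine Fin.cases ?_ (fun i => ?_) i
    · simpa using contDiffOn_const
    · simpa using (contDiffOn_pi.1 hc) i
  have hstar : ∀ i : Fin (r + 1),
      ContDiffOn ℝ 3 (fun θ => star ((Fin.cons 1 (c θ) : Fin (r + 1) → ℂ) i)) Θ := fun i =>
    Complex.conjCLE.contDiff.comp_contDiffOn (hcons i)
  exact smoothFamily_sum_smul hΘ
    (fun p => hk.mul ((hcons p.1).mul (hstar p.2))) fun p => isSmooth_fourier _

theorem smoothFamily_armaSymbol {Θ : Set (Fin n → ℂ)} (hΘ : IsOpen Θ) {r s : ℕ}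
    {a : (Fin n → ℂ) → Fin r → ℂ} {b : (Fin n → ℂ) → Fin s → ℂ} {σ2 : (Fin n → ℂ) → ℝ}
    (ha : ContDiffOn ℝ 3 a Θ) (hb : ContDiffOn ℝ 3 b Θ) (hσ2 : ContDiffOn ℝ 3 σ2 Θ)
    (hroots : ∀ θ ∈ Θ, RootsInUnitDisk (a θ)) :
    SmoothFamily Θ fun θ => armaSymbol (a θ) (b θ) (σ2 θ) := by
  refine SmoothFamily.of_mul_eq hΘ (smoothFamily_transfer hΘ ha (contDiffOn_const (c := 1)))
    (smoothFamily_transfer hΘ hb (k := fun θ => (σ2 θ : ℂ))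
      (Complex.ofRealCLM.contDiff.comp_contDiffOn hσ2)) (fun θ hθ => ?_) fun θ hθ => ?_
  · simp only [one_smul]
    exact isUnit_transfer_mul_transferConj (hroots θ hθ)
  · simp only [one_smul, armaSymbol]
    rw [smul_mul_assoc, mul_assoc, Ring.inverse_mul_cancel _
      (isUnit_transfer_mul_transferConj (hroots θ hθ)), mul_one]

end ComplexARMA

/-! ### Derivatives of inverses and determinants -/

namespace ComplexARMA

section HasWd

variable {n : ℕ} {E F : Type*} [NormedAddCommGroup E] [NormedSpace ℝ E] [NormedSpace ℂ E]
  [NormedAddCommGroup F] [NormedSpace ℝ F] [NormedSpace ℂ F]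

/-- `f` is real differentiable at `θ` and its Wirtinger derivative `∂_α f` there is `f'`. -/
structure HasWd (α : Idx n) (f : (Fin n → ℂ) → E) (f' : E) (θ : Fin n → ℂ) : Prop where
  differentiableAt : DifferentiableAt ℝ f θ
  wd_eq : wd α f θ = f'

lemma hasWd_of_differentiableAt (α : Idx n) {f : (Fin n → ℂ) → E} {θ : Fin n → ℂ}
    (hf : DifferentiableAt ℝ f θ) : HasWd α f (wd α f θ) θ :=
  ⟨hf, rfl⟩

namespace HasWd

variable {α : Idx n} {f g : (Fin n → ℂ) → E} {f' g' : E} {θ : Fin n → ℂ}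

lemma sub (hf : HasWd α f f' θ) (hg : HasWd α g g' θ) :
    HasWd α (fun θ => f θ - g θ) (f' - g') θ :=
  ⟨hf.1.fun_sub hg.1, by rw [wd_sub α hf.1 hg.1, hf.2, hg.2]⟩

lemma clm (hf : HasWd α f f' θ) (L : E →L[ℂ] F) : HasWd α (fun θ => L (f θ)) (L f') θ :=
  ⟨((L.restrictScalars ℝ).differentiableAt).comp θ hf.1, by rw [wd_clm α L hf.1, hf.2]⟩

lemma comp {f : (Fin n → ℂ) → E} (hf : HasWd α f f' θ) {φ : E → F} {φ' : E →L[ℂ] F}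
    (hφ : HasFDerivAt φ (φ'.restrictScalars ℝ) (f θ)) :
    HasWd α (fun θ => φ (f θ)) (φ' f') θ := by
  have h : HasFDerivAt (fun θ => φ (f θ)) _ θ := hφ.comp θ hf.1.hasFDerivAt
  refine ⟨h.differentiableAt, ?_⟩
  rw [← hf.2]
  simp [wd, h.fderiv]

/-- The bridge to `wirtinger`: it suffices to differentiate a function that agrees with the given
one on the open parameter set. -/
lemma wirtinger_eq {f g : (Fin n → ℂ) → ℂ} {g' : ℂ} {Θ : Set (Fin n → ℂ)} (hΘ : IsOpen Θ)
    (hg : HasWd α g g' θ) (h : ∀ θ ∈ Θ, f θ = g θ) (hθ : θ ∈ Θ) : wirtinger α f θ = g' := by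
  rw [wirtinger_congr α (Filter.eventually_of_mem (hΘ.mem_nhds hθ) h),
    wirtinger_eq_wd α hg.1, hg.2]

end HasWd

end HasWd

section Algebra

variable {n : ℕ} {A : Type*} [NormedRing A] [NormedAlgebra ℂ A] [NormedSpace ℝ A]
  {α : Idx n} {f g : (Fin n → ℂ) → A} {f' g' : A} {θ : Fin n → ℂ}

lemma HasWd.mul (hf : HasWd α f f' θ) (hg : HasWd α g g' θ) :
    HasWd α (fun θ => f θ * g θ) (f' * g θ + f θ * g') θ :=
  ⟨(((ContinuousLinearMap.mul ℂ A).bilinearRestrictScalars ℝ).hasFDerivAt_of_bilinear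
    hf.1.hasFDerivAt hg.1.hasFDerivAt).differentiableAt,
    by rw [wd_mul α hf.1 hg.1, hf.2, hg.2]⟩

lemma HasWd.ringInverse [HasSummableGeomSeries A] (hf : HasWd α f f' θ) (hu : IsUnit (f θ)) :
    HasWd α (fun θ => Ring.inverse (f θ)) (-(Ring.inverse (f θ) * f' * Ring.inverse (f θ))) θ := by
  obtain ⟨u, hu⟩ := hu
  have h0 : HasFDerivAt Ring.inverse
      ((-ContinuousLinearMap.mulLeftRight ℂ A ↑u⁻¹ ↑u⁻¹).restrictScalars ℝ) (f θ) := by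
    rw [← hu]
    exact (hasFDerivAt_ringInverse (𝕜 := ℂ) u).restrictScalars ℝ
  rw [← hu, Ring.inverse_unit]
  exact hf.comp h0

end Algebra

section InverseFamily

variable {n : ℕ} {A : Type*} [NormedRing A] [NormedAlgebra ℂ A] [NormedSpace ℝ A]
  [HasSummableGeomSeries A]

/-- The normalized derivative `X⁻¹ ∂_α X` of a family `X` in a Banach algebra. -/
noncomputable def logD (X : (Fin n → ℂ) → A) (α : Idx n) (θ : Fin n → ℂ) : A :=
  Ring.inverse (X θ) * wd α X θ

/-- The normalized second derivative `X⁻¹ ∂_α ∂_β X` of a family `X` in a Banach algebra. -/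
noncomputable def logD₂ (X : (Fin n → ℂ) → A) (α β : Idx n) (θ : Fin n → ℂ) : A :=
  Ring.inverse (X θ) * wd α (wd β X) θ

/-- The normalized third derivative `X⁻¹ ∂_α ∂_β ∂_γ X` of a family `X` in a Banach algebra. -/
noncomputable def logD₃ (X : (Fin n → ℂ) → A) (α β γ : Idx n) (θ : Fin n → ℂ) : A :=
  Ring.inverse (X θ) * wd α (wd β (wd γ X)) θ

variable {Θ : Set (Fin n → ℂ)} {X : (Fin n → ℂ) → A} {θ : Fin n → ℂ}

lemma hasWd_inverse (hΘ : IsOpen Θ) (hX : ContDiffOn ℝ 3 X Θ) (hu : ∀ θ ∈ Θ, IsUnit (X θ))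
    (α : Idx n) (hθ : θ ∈ Θ) :
    HasWd α (fun θ => Ring.inverse (X θ)) (-(logD X α θ * Ring.inverse (X θ))) θ :=
  (hasWd_of_differentiableAt α (differentiableAt_of_contDiffOn (m := 3) hΘ hX (by norm_num) hθ)
    ).ringInverse (hu θ hθ)

lemma hasWd_logD (hΘ : IsOpen Θ) (hX : ContDiffOn ℝ 3 X Θ) (hu : ∀ θ ∈ Θ, IsUnit (X θ))
    (α β : Idx n) (hθ : θ ∈ Θ) :
    HasWd α (logD X β) (logD₂ X α β θ - logD X α θ * logD X β θ) θ := by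
  have h := (hasWd_inverse hΘ hX hu α hθ).mul (hasWd_of_differentiableAt α
    (differentiableAt_of_contDiffOn (m := 2) hΘ
      (contDiffOn_wd β hΘ (k := 2) (m := 3) hX (by norm_num)) (by norm_num) hθ))
  refine ⟨h.1, h.2.trans ?_⟩
  simp only [logD, logD₂]
  noncomm_ring

lemma hasWd_logD₂ (hΘ : IsOpen Θ) (hX : ContDiffOn ℝ 3 X Θ) (hu : ∀ θ ∈ Θ, IsUnit (X θ))
    (α β γ : Idx n) (hθ : θ ∈ Θ) :
    HasWd α (logD₂ X β γ) (logD₃ X α β γ θ - logD X α θ * logD₂ X β γ θ) θ := by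
  have h := (hasWd_inverse hΘ hX hu α hθ).mul (hasWd_of_differentiableAt α
    (differentiableAt_of_contDiffOn (m := 1) hΘ
      (contDiffOn_wd β hΘ (k := 1) (m := 2)
        (contDiffOn_wd γ hΘ (k := 2) (m := 3) hX (by norm_num)) (by norm_num)) (by norm_num) hθ))
  refine ⟨h.1, h.2.trans ?_⟩
  simp only [logD, logD₂, logD₃]
  noncomm_ring

end InverseFamily

section Matrices

open Matrix
open scoped Matrix.Norms.L2Operator

variable {N : ℕ}

/-- The trace as a continuous linear form. -/
noncomputable def traceCLM (N : ℕ) : Matrix (Fin N) (Fin N) ℂ →L[ℂ] ℂ :=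
  LinearMap.toContinuousLinearMap (Matrix.traceLinearMap (Fin N) ℂ ℂ)

/-- The quadratic form `z* A z` as a continuous linear form in `A`. -/
noncomputable def quadFormCLM (z : Fin N → ℂ) : Matrix (Fin N) (Fin N) ℂ →L[ℂ] ℂ :=
  LinearMap.toContinuousLinearMap
    { toFun := fun A => quadForm A z
      map_add' := fun A B => by simp [quadForm, Matrix.add_mulVec]
      map_smul' := fun c A => by simp [quadForm, Matrix.smul_mulVec] }

lemma quadFormCLM_apply (z : Fin N → ℂ) (A : Matrix (Fin N) (Fin N) ℂ) :
    quadFormCLM z A = quadForm A z := rfl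

lemma contDiff_det : ContDiff ℂ ⊤ fun A : Matrix (Fin N) (Fin N) ℂ => A.det := by
  have h : ∀ i j, ContDiff ℂ ⊤ fun A : Matrix (Fin N) (Fin N) ℂ => A i j := fun i j =>
    (LinearMap.toContinuousLinearMap (Matrix.entryLinearMap ℂ ℂ i j)).contDiff
  simp only [Matrix.det_apply]
  exact ContDiff.sum fun σ _ => (contDiff_prod fun i _ => h _ _).const_smul _

/-- Jacobi's formula for the derivative of the determinant at an invertible matrix. -/
theorem hasFDerivAt_det {A : Matrix (Fin N) (Fin N) ℂ} (hA : IsUnit A.det) :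
    HasFDerivAt (fun A : Matrix (Fin N) (Fin N) ℂ => A.det)
      (A.det • (traceCLM N).comp (ContinuousLinearMap.mul ℂ _ A⁻¹)) A := by
  have hd : DifferentiableAt ℂ (fun A : Matrix (Fin N) (Fin N) ℂ => A.det) A :=
    (contDiff_det.differentiable (by simp)) A
  suffices h : ∀ H, A.det • (A⁻¹ * H).trace
      = fderiv ℂ (fun A : Matrix (Fin N) (Fin N) ℂ => A.det) A H by
    have e : A.det • (traceCLM N).comp (ContinuousLinearMap.mul ℂ _ A⁻¹)
        = fderiv ℂ (fun A : Matrix (Fin N) (Fin N) ℂ => A.det) A := by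
      ext1 H
      exact h H
    rw [e]
    exact hd.hasFDerivAt
  intro H
  rw [← hd.lineDeriv_eq_fderiv]
  -- `det (A + t H) = det A * det (1 + t A⁻¹ H)`
  obtain ⟨p, e⟩ : ∃ p : Polynomial ℂ, ∀ t : ℂ,
      (A + t • H).det = A.det * (1 + (A⁻¹ * H).trace * t + p.eval t * t ^ 2) := by
    refine ⟨(Matrix.det (1 + (Polynomial.X : Polynomial ℂ)
      • (A⁻¹ * H).map Polynomial.C)).divX.divX, fun t => ?_⟩
    rw [← Matrix.det_one_add_smul, ← Matrix.det_mul]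
    congr 1
    rw [Matrix.mul_add, Matrix.mul_one, Matrix.mul_smul, ← Matrix.mul_assoc,
      Matrix.mul_nonsing_inv _ hA, Matrix.one_mul]
  symm
  simp only [lineDeriv, e]
  have h1 := ((((hasDerivAt_id (0 : ℂ)).const_mul (A⁻¹ * H).trace).const_add 1).fun_add
    ((p.hasDerivAt 0).fun_mul ((hasDerivAt_id (0 : ℂ)).fun_pow 2))).const_mul A.det
  exact (h1.congr_deriv (by simp)).deriv

end Matrices

end ComplexARMA

/-! ### The normal log-likelihood: cumulants and derivatives -/

namespace ComplexARMA

open Matrix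
open scoped Matrix.Norms.L2Operator

variable {N : ℕ}

section Moments

variable {V : Matrix (Fin N) (Fin N) ℂ}

lemma integrable_quadForm_sub (hV : V.PosDef) (A : Matrix (Fin N) (Fin N) ℂ) (c : ℂ) :
    Integrable (fun z => quadForm A z - c) (complexNormal 0 V) :=
  integrable_of_hasTemperateGrowth hV (by fun_prop)

lemma integrable_quadForm_sub_mul (hV : V.PosDef) (A B : Matrix (Fin N) (Fin N) ℂ) (c d : ℂ) :
    Integrable (fun z => (quadForm A z - c) * (quadForm B z - d)) (complexNormal 0 V) :=
  integrable_of_hasTemperateGrowth hV (by fun_prop)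

lemma integrable_quadForm_sub_mul_mul (hV : V.PosDef) (A B C : Matrix (Fin N) (Fin N) ℂ)
    (c d e : ℂ) :
    Integrable (fun z => (quadForm A z - c) * (quadForm B z - d) * (quadForm C z - e))
      (complexNormal 0 V) :=
  integrable_of_hasTemperateGrowth hV (by fun_prop)

variable [IsProbabilityMeasure (complexNormal 0 V)]

lemma integral_quadForm_sub (hV : V.PosDef) (K : Matrix (Fin N) (Fin N) ℂ) (c : ℂ) :
    ∫ z, (quadForm (K * V⁻¹) z - c) ∂complexNormal 0 V = K.trace - c := by
  have hi : Integrable (quadForm (K * V⁻¹)) (complexNormal 0 V) :=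
    integrable_of_hasTemperateGrowth hV (by fun_prop)
  rw [integral_sub hi (integrable_const c), integral_quadForm hV, integral_const,
    Matrix.mul_assoc, Matrix.nonsing_inv_mul _ hV.det_pos.ne'.isUnit]
  simp

/-- The covariance of two quadratic forms in a centred complex normal vector; one of them need not
be centred. The normalization `K V⁻¹` makes the mean `tr K`. -/
lemma integral_quadForm_sub_mul (hV : V.PosDef) (K L : Matrix (Fin N) (Fin N) ℂ) (c : ℂ) :
    ∫ z, (quadForm (K * V⁻¹) z - c) * (quadForm (L * V⁻¹) z - L.trace) ∂complexNormal 0 V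
      = (K * L).trace := by
  have hu := hV.det_pos.ne'.isUnit
  have e : ∀ z, (quadForm (K * V⁻¹) z - c) * (quadForm (L * V⁻¹) z - L.trace)
      = quadForm (K * V⁻¹) z * quadForm (L * V⁻¹) z - L.trace * quadForm (K * V⁻¹) z
        - c * (quadForm (L * V⁻¹) z - L.trace) := fun z => by ring
  have i1 : Integrable (fun z => quadForm (K * V⁻¹) z * quadForm (L * V⁻¹) z)
    (complexNormal 0 V) := integrable_of_hasTemperateGrowth hV (by fun_prop)
  have i2 : Integrable (fun z => L.trace * quadForm (K * V⁻¹) z)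
    (complexNormal 0 V) := integrable_of_hasTemperateGrowth hV (by fun_prop)
  have i3 : Integrable (fun z => c * (quadForm (L * V⁻¹) z - L.trace))
    (complexNormal 0 V) := integrable_of_hasTemperateGrowth hV (by fun_prop)
  simp only [e]
  rw [integral_sub (i1.sub' i2) i3, integral_sub i1 i2, integral_const_mul, integral_const_mul,
    integral_quadForm_sub hV, integral_quadForm_mul_quadForm hV, integral_quadForm hV]
  simp only [Matrix.mul_assoc, Matrix.nonsing_inv_mul _ hu, Matrix.mul_one]
  rw [Matrix.trace_mul_comm L K]
  ring

/-- The third joint cumulant of quadratic forms in a centred complex normal vector. -/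
lemma integral_quadForm_sub_mul_mul (hV : V.PosDef) (K L M : Matrix (Fin N) (Fin N) ℂ) :
    ∫ z, (quadForm (K * V⁻¹) z - K.trace) * (quadForm (L * V⁻¹) z - L.trace)
        * (quadForm (M * V⁻¹) z - M.trace) ∂complexNormal 0 V
      = (K * L * M).trace + (K * M * L).trace := by
  have hu := hV.det_pos.ne'.isUnit
  have e : ∀ z, (quadForm (K * V⁻¹) z - K.trace) * (quadForm (L * V⁻¹) z - L.trace)
        * (quadForm (M * V⁻¹) z - M.trace)
      = quadForm (K * V⁻¹) z * (quadForm (L * V⁻¹) z * quadForm (M * V⁻¹) z)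
        - M.trace * (quadForm (K * V⁻¹) z * quadForm (L * V⁻¹) z)
        - L.trace * (quadForm (K * V⁻¹) z * (quadForm (M * V⁻¹) z - M.trace))
        - K.trace * ((quadForm (L * V⁻¹) z - L.trace) * (quadForm (M * V⁻¹) z - M.trace)) :=
    fun z => by ring
  have i1 : Integrable (fun z => quadForm (K * V⁻¹) z
    * (quadForm (L * V⁻¹) z * quadForm (M * V⁻¹) z)) (complexNormal 0 V) :=
    integrable_of_hasTemperateGrowth hV (by fun_prop)
  have i2 : Integrable (fun z => M.trace * (quadForm (K * V⁻¹) z * quadForm (L * V⁻¹) z))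
    (complexNormal 0 V) := integrable_of_hasTemperateGrowth hV (by fun_prop)
  have i3 : Integrable (fun z => L.trace * (quadForm (K * V⁻¹) z
    * (quadForm (M * V⁻¹) z - M.trace))) (complexNormal 0 V) :=
    integrable_of_hasTemperateGrowth hV (by fun_prop)
  have i4 : Integrable (fun z => K.trace * ((quadForm (L * V⁻¹) z - L.trace)
    * (quadForm (M * V⁻¹) z - M.trace))) (complexNormal 0 V) :=
    integrable_of_hasTemperateGrowth hV (by fun_prop)
  have h2 := integral_quadForm_sub_mul hV K M 0
  simp only [sub_zero] at h2
  simp only [e]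
  rw [integral_sub ((i1.sub' i2).sub' i3) i4, integral_sub (i1.sub' i2) i3, integral_sub i1 i2,
    integral_const_mul, integral_const_mul, integral_const_mul, h2,
    integral_quadForm_sub_mul hV, integral_quadForm_mul_quadForm hV,
    integral_quadForm_mul_quadForm_mul_quadForm hV]
  simp only [Matrix.mul_assoc, Matrix.nonsing_inv_mul _ hu, Matrix.mul_one]
  have c1 : (M * (L * K)).trace = (K * (M * L)).trace := by
    rw [← Matrix.mul_assoc, Matrix.trace_mul_comm]
  have c2 : (M * (K * L)).trace = (K * (L * M)).trace := by
    rw [Matrix.trace_mul_comm, Matrix.mul_assoc]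
  rw [c1, c2, Matrix.trace_mul_comm L K, Matrix.trace_mul_comm M K, Matrix.trace_mul_comm M L]
  ring

end Moments

section LogLikelihood

variable {n : ℕ} {Θ : Set (Fin n → ℂ)} {Sg : (Fin n → ℂ) → Matrix (Fin N) (Fin N) ℂ}
  {θ : Fin n → ℂ}

/-- The log-density at `z` of the centred complex normal distribution with covariance matrix
`V`, as an analytic expression in `V`. -/
noncomputable def normalLogLik (z : Fin N → ℂ) (V : Matrix (Fin N) (Fin N) ℂ) : ℂ :=
  -(N : ℂ) * (Real.log Real.pi : ℂ) - Complex.log V.det - quadFormCLM z (Ring.inverse V)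

/-- The determinant and the quadratic form are real, so that the real parts in `logLikelihood` can
be dropped. -/
lemma logLikelihood_eq_normalLogLik {γ : ℤ → ℂ} (hV : (covMatrix γ N).PosDef) (z : Fin N → ℂ) :
    (logLikelihood γ N z : ℂ) = normalLogLik z (covMatrix γ N) := by
  set V := covMatrix γ N with hVdef
  obtain ⟨h1, h2⟩ := Complex.pos_iff.1 hV.det_pos
  have hdet : V.det = (V.det.re : ℂ) := Complex.ext rfl (by simp [← h2])
  have hq : (quadForm V⁻¹ z) = ((quadForm V⁻¹ z).re : ℂ) := by
    have := Complex.nonneg_iff.1 (hV.inv.posSemidef.dotProduct_mulVec_nonneg z)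
    exact Complex.ext rfl (by simpa [quadForm] using this.2.symm)
  have hlog : ((Real.log V.det.re : ℝ) : ℂ) = Complex.log V.det := by
    rw [Complex.ofReal_log h1.le, ← hdet]
  have hq' : (((star z ⬝ᵥ (V⁻¹.mulVec z)).re : ℝ) : ℂ) = quadForm V⁻¹ z := hq.symm
  rw [logLikelihood, normalLogLik, ← hVdef, quadFormCLM_apply, ← Matrix.nonsing_inv_eq_ringInverse,
    ← hlog, ← hq']
  push_cast
  ring

lemma contDiffOn_normalLogLik (z : Fin N → ℂ) (hS : ContDiffOn ℝ 3 Sg Θ)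
    (hpos : ∀ θ ∈ Θ, (Sg θ).PosDef) : ContDiffOn ℝ 3 (fun θ => normalLogLik z (Sg θ)) Θ := by
  have h1 : ContDiffOn ℝ 3 (fun θ => Complex.log (Sg θ).det) Θ := by
    intro θ hθ
    have hs : (Sg θ).det ∈ Complex.slitPlane :=
      Or.inl (Complex.pos_iff.1 (hpos θ hθ).det_pos).1
    have h2 : ContDiffAt ℝ 3 (fun A : Matrix (Fin N) (Fin N) ℂ => Complex.log A.det) (Sg θ) :=
      ((Complex.contDiffAt_log hs).comp (Sg θ)
        (contDiff_det.of_le le_top).contDiffAt).restrict_scalars ℝ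
    exact h2.comp_contDiffWithinAt θ (hS θ hθ)
  have h3 : ContDiffOn ℝ 3 (fun θ => quadFormCLM z (Ring.inverse (Sg θ))) Θ :=
    ((quadFormCLM z).restrictScalars ℝ).contDiff.comp_contDiffOn
      (contDiffOn_ringInverse_comp (m := 3) hS fun θ hθ => (hpos θ hθ).isUnit)
  exact (contDiffOn_const.sub h1).sub h3

/-- The score, by Jacobi's formula. -/
lemma hasWd_normalLogLik (hΘ : IsOpen Θ) (hS : ContDiffOn ℝ 3 Sg Θ)
    (hpos : ∀ θ ∈ Θ, (Sg θ).PosDef) (z : Fin N → ℂ) (α : Idx n) (hθ : θ ∈ Θ) :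
    HasWd α (fun θ => normalLogLik z (Sg θ))
      (quadFormCLM z (logD Sg α θ * Ring.inverse (Sg θ)) - traceCLM N (logD Sg α θ)) θ := by
  have hX := hasWd_of_differentiableAt α
    (differentiableAt_of_contDiffOn (m := 3) hΘ hS (by norm_num) hθ)
  have hu : IsUnit (Sg θ).det := (hpos θ hθ).det_pos.ne'.isUnit
  have hs : (Sg θ).det ∈ Complex.slitPlane := Or.inl (Complex.pos_iff.1 (hpos θ hθ).det_pos).1
  have h1 := (hX.comp ((hasFDerivAt_det hu).restrictScalars ℝ)).comp
    (((Complex.hasStrictDerivAt_log hs).hasDerivAt.hasFDerivAt).restrictScalars ℝ)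
  have h2 := ((hasWd_inverse hΘ hS (fun θ hθ => (hpos θ hθ).isUnit) α hθ).clm (quadFormCLM z))
  have h3 := ((hasWd_of_differentiableAt α (differentiableAt_const
    (-(N : ℂ) * (Real.log Real.pi : ℂ)))).sub h1).sub h2
  refine ⟨h3.1, h3.2.trans ?_⟩
  simp [wd_const, logD, Matrix.nonsing_inv_eq_ringInverse]
  rw [mul_right_comm, mul_inv_cancel₀ hu.ne_zero, one_mul]
  ring

/-- The second derivative of the log-likelihood, as the derivative of the score. -/
lemma hasWd_score (hΘ : IsOpen Θ) (hS : ContDiffOn ℝ 3 Sg Θ)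
    (hpos : ∀ θ ∈ Θ, (Sg θ).PosDef) (z : Fin N → ℂ) (α β : Idx n) (hθ : θ ∈ Θ) :
    HasWd α (fun θ => quadFormCLM z (logD Sg β θ * Ring.inverse (Sg θ)) - traceCLM N (logD Sg β θ))
      (quadFormCLM z ((logD₂ Sg α β θ - logD Sg α θ * logD Sg β θ - logD Sg β θ * logD Sg α θ)
          * Ring.inverse (Sg θ))
        - traceCLM N (logD₂ Sg α β θ - logD Sg α θ * logD Sg β θ)) θ := by
  have hu : ∀ θ ∈ Θ, IsUnit (Sg θ) := fun θ hθ => (hpos θ hθ).isUnit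
  have h1 := hasWd_logD hΘ hS hu α β hθ
  have h := ((h1.mul (hasWd_inverse hΘ hS hu α hθ)).clm (quadFormCLM z)).sub (h1.clm (traceCLM N))
  refine ⟨h.1, h.2.trans ?_⟩
  congr 2
  noncomm_ring

/-- The third derivative of the log-likelihood is again of the form `z* (K V⁻¹) z - tr k`, with `V` the
covariance matrix. Its expectation depends only on `K - k`, in which the third
derivatives of `V` cancel. -/
lemma exists_hasWd_hessian (hΘ : IsOpen Θ) (hS : ContDiffOn ℝ 3 Sg Θ)
    (hpos : ∀ θ ∈ Θ, (Sg θ).PosDef) (α β γ : Idx n) (hθ : θ ∈ Θ) :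
    ∃ K k : Matrix (Fin N) (Fin N) ℂ,
      K - k = logD Sg γ θ * logD Sg α θ * logD Sg β θ + logD Sg α θ * logD Sg γ θ * logD Sg β θ
        + logD Sg β θ * logD Sg γ θ * logD Sg α θ + logD Sg γ θ * logD Sg β θ * logD Sg α θ
        - logD₂ Sg α γ θ * logD Sg β θ - logD Sg γ θ * logD₂ Sg α β θ
        - logD₂ Sg β γ θ * logD Sg α θ ∧
    ∀ z, HasWd α (fun θ =>
      quadFormCLM z ((logD₂ Sg β γ θ - logD Sg β θ * logD Sg γ θ - logD Sg γ θ * logD Sg β θ)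
          * Ring.inverse (Sg θ))
        - traceCLM N (logD₂ Sg β γ θ - logD Sg β θ * logD Sg γ θ))
      (quadFormCLM z (K * Ring.inverse (Sg θ)) - traceCLM N k) θ := by
  have hu : ∀ θ ∈ Θ, IsUnit (Sg θ) := fun θ hθ => (hpos θ hθ).isUnit
  have h1 := (hasWd_logD₂ hΘ hS hu α β γ hθ).sub
    ((hasWd_logD hΘ hS hu α β hθ).mul (hasWd_logD hΘ hS hu α γ hθ))
  have h2 := (h1.sub
    ((hasWd_logD hΘ hS hu α γ hθ).mul (hasWd_logD hΘ hS hu α β hθ)))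
  have h := h2.mul (hasWd_inverse hΘ hS hu α hθ)
  simp only [mul_neg, ← mul_assoc, ← neg_mul, ← add_mul] at h
  refine ⟨_, _, ?_, fun z => (h.clm (quadFormCLM z)).sub (h1.clm (traceCLM N))⟩
  noncomm_ring

end LogLikelihood

end ComplexARMA

/-! ### Derivatives of the likelihood and the spectral density of a Gaussian model -/

namespace ComplexARMA

open Matrix
open scoped Matrix.Norms.L2Operator

/-- `Σ⁻¹ ∂_α Σ` for the Toeplitz matrices `Σ` of size `N` of a family of symbols. -/
noncomputable abbrev toepD {n : ℕ} (F : (Fin n → ℂ) → FreqSymbol) (N : ℕ) (α : Idx n)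
    (θ : Fin n → ℂ) : Matrix (Fin N) (Fin N) ℂ :=
  logD (fun θ => toep N (F θ)) α θ

/-- `Σ⁻¹ ∂_α ∂_β Σ` for the Toeplitz matrices `Σ` of size `N` of a family of symbols. -/
noncomputable abbrev toepD₂ {n : ℕ} (F : (Fin n → ℂ) → FreqSymbol) (N : ℕ) (α β : Idx n)
    (θ : Fin n → ℂ) : Matrix (Fin N) (Fin N) ℂ :=
  logD₂ (fun θ => toep N (F θ)) α β θ

/-- A parametrized family of centred Gaussian processes whose autocovariances are the Fourier
coefficients of a smooth family of positive symbols. -/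
structure GaussianModel {Ω : Type*} [MeasurableSpace Ω] {n : ℕ} (Θ : Set (Fin n → ℂ))
    (P : (Fin n → ℂ) → Measure Ω) (Z : (Fin n → ℂ) → ℤ → Ω → ℂ)
    (F : (Fin n → ℂ) → FreqSymbol) : Prop where
  isOpen : IsOpen Θ
  family : SmoothFamily Θ F
  posSymbol : ∀ θ ∈ Θ, PosSymbol (F θ)
  covMatrix_eq : ∀ θ ∈ Θ, ∀ N, covMatrix (autocov (P θ) (Z θ)) N = toep N (F θ)
  posDef : ∀ θ ∈ Θ, ∀ N, (toep N (F θ)).PosDef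
  obsLaw_eq : ∀ θ ∈ Θ, ∀ N, obsLaw (P θ) (Z θ) N = complexNormal 0 (toep N (F θ))
  isProbabilityMeasure : ∀ θ ∈ Θ, ∀ N, IsProbabilityMeasure (complexNormal 0 (toep N (F θ)))
  specFamily_eq : ∀ θ ∈ Θ, ∀ ω : ℝ,
    specFamily P Z θ ω = (1 / (2 * Real.pi) : ℂ) * F θ (ω : AddCircle (2 * Real.pi))

/-- The autocovariances of a complex Gaussian ARMA family are the Fourier coefficients of its
symbols `σ² |b|² / |a|²`. -/
theorem gaussianModel_of_isARMA {Ω : Type*} [MeasurableSpace Ω] {n r s : ℕ}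
    {Θ : Set (Fin n → ℂ)} (hΘ : IsOpen Θ)
    {P : (Fin n → ℂ) → Measure Ω} {Z : (Fin n → ℂ) → ℤ → Ω → ℂ}
    {a : (Fin n → ℂ) → Fin r → ℂ} {b : (Fin n → ℂ) → Fin s → ℂ} {σ2 : (Fin n → ℂ) → ℝ}
    (ha : ContDiffOn ℝ 3 a Θ) (hb : ContDiffOn ℝ 3 b Θ) (hσ2 : ContDiffOn ℝ 3 σ2 Θ)
    (hARMA : ∀ θ ∈ Θ, IsARMA (P θ) (Z θ) (a θ) (b θ) (σ2 θ)) :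
    GaussianModel Θ P Z fun θ => armaSymbol (a θ) (b θ) (σ2 θ) := by
  have hcov : ∀ θ ∈ Θ, ∀ N, covMatrix (autocov (P θ) (Z θ)) N
      = toep N (armaSymbol (a θ) (b θ) (σ2 θ)) := by
    intro θ hθ N
    ext i j
    simp only [covMatrix, Matrix.of_apply, toep_apply, (hARMA θ hθ).autocov_eq]
  have hobs : ∀ θ ∈ Θ, ∀ N, (toep N (armaSymbol (a θ) (b θ) (σ2 θ))).PosDef ∧
      obsLaw (P θ) (Z θ) N = complexNormal 0 (toep N (armaSymbol (a θ) (b θ) (σ2 θ))) := by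
    intro θ hθ N
    have hA := hARMA θ hθ
    have := hA.isProbabilityMeasure
    rw [← hcov θ hθ N]
    exact obsLaw_eq_complexNormal hA.gaussian hA.stationary hA.mean_zero N
  refine ⟨hΘ, smoothFamily_armaSymbol hΘ ha hb hσ2 fun θ hθ => (hARMA θ hθ).causal,
    fun θ hθ => ⟨(hARMA θ hθ).isSmooth, fun t => ?_,
      fun N => (hobs θ hθ N).1.det_pos.ne'.isUnit⟩, hcov,
    fun θ hθ N => (hobs θ hθ N).1, fun θ hθ N => (hobs θ hθ N).2, fun θ hθ N => ?_,
    fun θ hθ ω => (hARMA θ hθ).spectralDensity_eq ω⟩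
  · obtain ⟨x, hx, h⟩ := exists_armaSymbol_eq_pos (hARMA θ hθ).causal (hARMA θ hθ).invertible
      (hARMA θ hθ).variance_pos t
    rw [h]
    exact hx
  · have := (hARMA θ hθ).isProbabilityMeasure
    rw [← (hobs θ hθ N).2]
    exact Measure.isProbabilityMeasure_map
      (aemeasurable_pi_lambda _ fun j => (hARMA θ hθ).gaussian.aemeasurable _)

namespace GaussianModel

variable {Ω : Type*} [MeasurableSpace Ω] {n : ℕ} {Θ : Set (Fin n → ℂ)}
  {P : (Fin n → ℂ) → Measure Ω} {Z : (Fin n → ℂ) → ℤ → Ω → ℂ} {F : (Fin n → ℂ) → FreqSymbol}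
  {θ : Fin n → ℂ}

section Spectral

lemma wirtinger_specFamily (hM : GaussianModel Θ P Z F) (hθ : θ ∈ Θ) (α : Idx n) (ω : ℝ) :
    wirtinger α (fun θ => specFamily P Z θ ω) θ
      = ((1 / (2 * Real.pi) : ℂ) • ContinuousMap.evalCLM ℂ (ω : AddCircle (2 * Real.pi)))
        (wd α F θ) :=
  ((hasWd_of_differentiableAt α (differentiableAt_of_contDiffOn (m := 3) hM.isOpen
    hM.family.contDiffOn (by norm_num) hθ)).clm _).wirtinger_eq hM.isOpen
      (fun θ hθ => hM.specFamily_eq θ hθ ω) hθ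

lemma S₁_eq (hM : GaussianModel Θ P Z F) (hθ : θ ∈ Θ) (α : Idx n) (ω : ℝ) :
    S₁ (specFamily P Z) α θ ω = logD F α θ (ω : AddCircle (2 * Real.pi)) := by
  rw [S₁, hM.wirtinger_specFamily hθ, hM.specFamily_eq θ hθ, logD, ContinuousMap.mul_apply,
    inverse_apply (hM.posSymbol θ hθ).isUnit]
  simp
  field_simp

lemma S₂_eq (hM : GaussianModel Θ P Z F) (hθ : θ ∈ Θ) (α β : Idx n) (ω : ℝ) :
    S₂ (specFamily P Z) α β θ ω = logD₂ F α β θ (ω : AddCircle (2 * Real.pi)) := by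
  have h := ((hasWd_of_differentiableAt α (differentiableAt_of_contDiffOn (m := 2) hM.isOpen
    (contDiffOn_wd β hM.isOpen (k := 2) (m := 3) hM.family.contDiffOn (by norm_num))
    (by norm_num) hθ)).clm ((1 / (2 * Real.pi) : ℂ) •
      ContinuousMap.evalCLM ℂ (ω : AddCircle (2 * Real.pi)))).wirtinger_eq hM.isOpen
      (fun θ hθ => hM.wirtinger_specFamily hθ β ω) hθ
  rw [S₂, h, hM.specFamily_eq θ hθ, logD₂, ContinuousMap.mul_apply,
    inverse_apply (hM.posSymbol θ hθ).isUnit]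
  simp
  field_simp

lemma contDiffOn_specFamily (hM : GaussianModel Θ P Z F) (ω : ℝ) :
    ContDiffOn ℝ 3 (fun θ => specFamily P Z θ ω) Θ := by
  have h := ((((1 / (2 * Real.pi) : ℂ) • ContinuousMap.evalCLM ℂ
    (ω : AddCircle (2 * Real.pi))).restrictScalars ℝ).contDiff (n := 3)).comp_contDiffOn
      hM.family.contDiffOn
  exact h.congr fun θ hθ => hM.specFamily_eq θ hθ ω

lemma fisherMetric_eq (hM : GaussianModel Θ P Z F) (hθ : θ ∈ Θ) (α β : Idx n) :
    fisherMetric (specFamily P Z) α β θ = coef 0 (logD F α θ * logD F β θ) := by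
  simp only [fisherMetric, hM.S₁_eq hθ, coef_zero_eq_intervalIntegral, ContinuousMap.mul_apply]

lemma skewness_eq (hM : GaussianModel Θ P Z F) (hθ : θ ∈ Θ) (α β γ : Idx n) :
    skewness (specFamily P Z) α β γ θ
      = 2 * coef 0 (logD F α θ * logD F β θ * logD F γ θ) := by
  simp only [skewness, hM.S₁_eq hθ, coef_zero_eq_intervalIntegral, ContinuousMap.mul_apply]

lemma mConnection_eq (hM : GaussianModel Θ P Z F) (hθ : θ ∈ Θ) (α β γ : Idx n) :
    mConnection (specFamily P Z) α β γ θ = coef 0 (logD₂ F α β θ * logD F γ θ) := by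
  simp only [mConnection, hM.S₁_eq hθ, hM.S₂_eq hθ, coef_zero_eq_intervalIntegral,
    ContinuousMap.mul_apply]

end Spectral

section Likelihood

variable {N : ℕ}

lemma contDiffOn_toep (hM : GaussianModel Θ P Z F) :
    ContDiffOn ℝ 3 (fun θ => toep N (F θ)) Θ :=
  ((toep N).restrictScalars ℝ).contDiff.comp_contDiffOn hM.family.contDiffOn

lemma toepD_eq (hM : GaussianModel Θ P Z F) (hθ : θ ∈ Θ) (α : Idx n) :
    toepD F N α θ = (toep N (F θ))⁻¹ * toep N (wd α F θ) := by
  rw [toepD, logD, wd_clm α (toep N) (differentiableAt_of_contDiffOn (m := 3) hM.isOpen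
    hM.family.contDiffOn (by norm_num) hθ), Matrix.nonsing_inv_eq_ringInverse]

lemma toepD₂_eq (hM : GaussianModel Θ P Z F) (hθ : θ ∈ Θ) (α β : Idx n) :
    toepD₂ F N α β θ = (toep N (F θ))⁻¹ * toep N (wd α (wd β F) θ) := by
  rw [toepD₂, logD₂, wd_congr_of_isOpen α hM.isOpen (fun θ hθ => wd_clm β (toep N)
      (differentiableAt_of_contDiffOn (m := 3) hM.isOpen hM.family.contDiffOn (by norm_num) hθ)) hθ,
    wd_clm α (toep N) (differentiableAt_of_contDiffOn (m := 2) hM.isOpen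
      (contDiffOn_wd β hM.isOpen (k := 2) (m := 3) hM.family.contDiffOn (by norm_num))
      (by norm_num) hθ), Matrix.nonsing_inv_eq_ringInverse]

lemma logLik_eq (hM : GaussianModel Θ P Z F) (z : Fin N → ℂ) (hθ : θ ∈ Θ) :
    logLik P Z N z θ = normalLogLik z (toep N (F θ)) := by
  have h := hM.covMatrix_eq θ hθ N
  rw [logLik, logLikelihood_eq_normalLogLik (h ▸ hM.posDef θ hθ N), h]

lemma contDiffOn_logLik (hM : GaussianModel Θ P Z F) (z : Fin N → ℂ) :
    ContDiffOn ℝ 3 (logLik P Z N z) Θ :=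
  (contDiffOn_normalLogLik z hM.contDiffOn_toep fun θ hθ => hM.posDef θ hθ N).congr
    fun _ hθ => hM.logLik_eq z hθ

lemma wirtinger_logLik (hM : GaussianModel Θ P Z F) (z : Fin N → ℂ) (hθ : θ ∈ Θ) (α : Idx n) :
    wirtinger α (logLik P Z N z) θ
      = quadForm (toepD F N α θ * (toep N (F θ))⁻¹) z
        - (toepD F N α θ).trace := by
  rw [Matrix.nonsing_inv_eq_ringInverse]
  exact (hasWd_normalLogLik hM.isOpen hM.contDiffOn_toep (fun θ hθ => hM.posDef θ hθ N) z α
    hθ).wirtinger_eq hM.isOpen (fun θ hθ => hM.logLik_eq z hθ) hθ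

lemma wirtinger_wirtinger_logLik (hM : GaussianModel Θ P Z F) (z : Fin N → ℂ) (hθ : θ ∈ Θ)
    (α β : Idx n) :
    wirtinger α (wirtinger β (logLik P Z N z)) θ
      = quadForm ((toepD₂ F N α β θ
            - toepD F N α θ * toepD F N β θ
            - toepD F N β θ * toepD F N α θ)
          * (toep N (F θ))⁻¹) z
        - (toepD₂ F N α β θ
          - toepD F N α θ * toepD F N β θ).trace := by
  have h := fun θ (hθ : θ ∈ Θ) => hM.wirtinger_logLik z hθ β
  simp only [Matrix.nonsing_inv_eq_ringInverse] at h ⊢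
  exact (hasWd_score hM.isOpen hM.contDiffOn_toep (fun θ hθ => hM.posDef θ hθ N) z α β
    hθ).wirtinger_eq hM.isOpen h hθ

lemma exists_wirtinger_wirtinger_wirtinger_logLik (hM : GaussianModel Θ P Z F) (hθ : θ ∈ Θ)
    (α β γ : Idx n) :
    ∃ K k : Matrix (Fin N) (Fin N) ℂ,
      (K - k = toepD F N γ θ * toepD F N α θ
          * toepD F N β θ
        + toepD F N α θ * toepD F N γ θ
          * toepD F N β θ
        + toepD F N β θ * toepD F N γ θ
          * toepD F N α θ
        + toepD F N γ θ * toepD F N β θ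
          * toepD F N α θ
        - toepD₂ F N α γ θ * toepD F N β θ
        - toepD F N γ θ * toepD₂ F N α β θ
        - toepD₂ F N β γ θ * toepD F N α θ) ∧
      ∀ z, wirtinger α (wirtinger β (wirtinger γ (logLik P Z N z))) θ
        = quadForm (K * (toep N (F θ))⁻¹) z - k.trace := by
  obtain ⟨K, k, hK, h⟩ := exists_hasWd_hessian hM.isOpen hM.contDiffOn_toep
    (fun θ hθ => hM.posDef θ hθ N) α β γ hθ
  refine ⟨K, k, hK, fun z => ?_⟩
  have h2 := fun θ (hθ : θ ∈ Θ) => hM.wirtinger_wirtinger_logLik z hθ β γ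
  simp only [Matrix.nonsing_inv_eq_ringInverse] at h2 ⊢
  exact (h z).wirtinger_eq hM.isOpen h2 hθ

end Likelihood

end GaussianModel

end ComplexARMA

/-! ### Asymptotics of the expectations -/

namespace ComplexARMA

/-- `x N = N c + O(1)`. -/
def LinearGrowth (x : ℕ → ℂ) (c : ℂ) : Prop :=
  ∃ C : ℝ, ∀ N : ℕ, ‖x N - N * c‖ ≤ C

namespace LinearGrowth

variable {x y : ℕ → ℂ} {c d : ℂ}

lemma add (hx : LinearGrowth x c) (hy : LinearGrowth y d) :
    LinearGrowth (fun N => x N + y N) (c + d) := by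
  obtain ⟨C, hC⟩ := hx
  obtain ⟨D, hD⟩ := hy
  refine ⟨C + D, fun N => ?_⟩
  have e : x N + y N - N * (c + d) = (x N - N * c) + (y N - N * d) := by ring
  rw [e]
  exact (norm_add_le _ _).trans (add_le_add (hC N) (hD N))

lemma neg (hx : LinearGrowth x c) : LinearGrowth (fun N => -x N) (-c) := by
  obtain ⟨C, hC⟩ := hx
  refine ⟨C, fun N => ?_⟩
  have e : -x N - N * (-c) = -(x N - N * c) := by ring
  rw [e, norm_neg]
  exact hC N

lemma sub (hx : LinearGrowth x c) (hy : LinearGrowth y d) :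
    LinearGrowth (fun N => x N - y N) (c - d) := by
  simpa only [sub_eq_add_neg] using hx.add hy.neg

/-- The value at `N = 0`, where `1 / N` is a junk value, does not matter at infinity. -/
lemma isBigO (hx : LinearGrowth x c) {E : ℕ → ℂ} {L : ℂ} (hE : ∀ N, E N = x N) (hL : L = c) :
    (fun N : ℕ => (1 / (N : ℂ)) * E N - L) =O[atTop] (fun N : ℕ => 1 / (N : ℝ)) := by
  obtain ⟨C, hC⟩ := hx
  refine IsBigO.of_bound C ?_
  filter_upwards [eventually_gt_atTop 0] with N hN
  have hN' : (N : ℂ) ≠ 0 := by exact_mod_cast hN.ne'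
  have e : (1 / (N : ℂ)) * E N - L = (1 / (N : ℂ)) * (x N - N * c) := by
    rw [hE, hL]
    field_simp
  rw [e, norm_mul, mul_comm]
  have h1 : ‖(1 / (N : ℂ))‖ = 1 / (N : ℝ) := by simp
  have h2 : ‖1 / (N : ℝ)‖ = 1 / (N : ℝ) := by simp
  rw [h1, h2]
  exact mul_le_mul_of_nonneg_right (hC N) (by positivity)

end LinearGrowth

namespace GaussianModel

open Matrix

variable {Ω : Type*} [MeasurableSpace Ω] {n : ℕ} {Θ : Set (Fin n → ℂ)}
  {P : (Fin n → ℂ) → Measure Ω} {Z : (Fin n → ℂ) → ℤ → Ω → ℂ} {F : (Fin n → ℂ) → FreqSymbol}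
  {θ : Fin n → ℂ}

section Trace

lemma linearGrowth_trace₁₁ (hM : GaussianModel Θ P Z F) (hθ : θ ∈ Θ) (α β : Idx n) :
    LinearGrowth (fun N => (toepD F N α θ * toepD F N β θ).trace)
      (coef 0 (logD F α θ * logD F β θ)) := by
  simp only [hM.toepD_eq hθ]
  exact (hM.posSymbol θ hθ).trace_two (hM.family.smooth₁ θ hθ α) (hM.family.smooth₁ θ hθ β)

lemma linearGrowth_trace₂₁ (hM : GaussianModel Θ P Z F) (hθ : θ ∈ Θ) (α β γ : Idx n) :
    LinearGrowth (fun N => (toepD₂ F N α β θ * toepD F N γ θ).trace)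
      (coef 0 (logD₂ F α β θ * logD F γ θ)) := by
  simp only [hM.toepD_eq hθ, hM.toepD₂_eq hθ]
  exact (hM.posSymbol θ hθ).trace_two (hM.family.smooth₂ θ hθ α β) (hM.family.smooth₁ θ hθ γ)

lemma linearGrowth_trace₁₁₁ (hM : GaussianModel Θ P Z F) (hθ : θ ∈ Θ) (α β γ : Idx n) :
    LinearGrowth (fun N => (toepD F N α θ * toepD F N β θ * toepD F N γ θ).trace)
      (coef 0 (logD F α θ * logD F β θ * logD F γ θ)) := by
  simp only [hM.toepD_eq hθ]
  exact (hM.posSymbol θ hθ).trace_three (hM.family.smooth₁ θ hθ α) (hM.family.smooth₁ θ hθ β)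
    (hM.family.smooth₁ θ hθ γ)

lemma logD₂_comm (hM : GaussianModel Θ P Z F) (hθ : θ ∈ Θ) (α β : Idx n) :
    logD₂ F α β θ = logD₂ F β α θ := by
  rw [logD₂, logD₂, wd_comm (m := 3) α β hM.isOpen hM.family.contDiffOn (by norm_num) hθ]

end Trace

section Expectation

variable {N : ℕ}

lemma expect_wirtinger (hM : GaussianModel Θ P Z F) (hθ : θ ∈ Θ) (α : Idx n) :
    expect P Z θ N (fun z => wirtinger α (logLik P Z N z) θ) = 0 := by
  have := hM.isProbabilityMeasure θ hθ N
  simp only [expect, hM.obsLaw_eq θ hθ, hM.wirtinger_logLik _ hθ]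
  rw [integral_quadForm_sub (hM.posDef θ hθ N), sub_self]

lemma expect_wirtinger_wirtinger (hM : GaussianModel Θ P Z F) (hθ : θ ∈ Θ) (α β : Idx n) :
    expect P Z θ N (fun z => wirtinger α (wirtinger β (logLik P Z N z)) θ)
      = -(toepD F N α θ * toepD F N β θ).trace := by
  have := hM.isProbabilityMeasure θ hθ N
  simp only [expect, hM.obsLaw_eq θ hθ, hM.wirtinger_wirtinger_logLik _ hθ]
  rw [integral_quadForm_sub (hM.posDef θ hθ N)]
  simp only [Matrix.trace_sub]
  rw [Matrix.trace_mul_comm (toepD F N β θ)]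
  ring

/-- Both cyclic orders of the three first derivatives occur twice; they have the same limit, because
symbols commute. -/
lemma expect_wirtinger_wirtinger_wirtinger (hM : GaussianModel Θ P Z F) (hθ : θ ∈ Θ)
    (α β γ : Idx n) :
    expect P Z θ N (fun z => wirtinger α (wirtinger β (wirtinger γ (logLik P Z N z))) θ)
      = -(toepD₂ F N α β θ * toepD F N γ θ).trace - (toepD₂ F N β γ θ * toepD F N α θ).trace
        - (toepD₂ F N α γ θ * toepD F N β θ).trace
        + ((toepD F N α θ * toepD F N β θ * toepD F N γ θ).trace
            + (toepD F N α θ * toepD F N β θ * toepD F N γ θ).trace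
          + ((toepD F N α θ * toepD F N γ θ * toepD F N β θ).trace
            + (toepD F N α θ * toepD F N γ θ * toepD F N β θ).trace)) := by
  have := hM.isProbabilityMeasure θ hθ N
  obtain ⟨K, k, hK, h⟩ := hM.exists_wirtinger_wirtinger_wirtinger_logLik (N := N) hθ α β γ
  simp only [expect, hM.obsLaw_eq θ hθ, h]
  rw [integral_quadForm_sub (hM.posDef θ hθ N), ← Matrix.trace_sub, hK]
  simp only [Matrix.trace_sub, Matrix.trace_add]
  have c1 : (toepD F N γ θ * toepD F N α θ * toepD F N β θ).trace
      = (toepD F N α θ * toepD F N β θ * toepD F N γ θ).trace := by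
    rw [Matrix.mul_assoc, Matrix.trace_mul_comm]
  have c2 : (toepD F N β θ * toepD F N γ θ * toepD F N α θ).trace
      = (toepD F N α θ * toepD F N β θ * toepD F N γ θ).trace := by
    rw [Matrix.trace_mul_comm, Matrix.mul_assoc]
  have c3 : (toepD F N γ θ * toepD F N β θ * toepD F N α θ).trace
      = (toepD F N α θ * toepD F N γ θ * toepD F N β θ).trace := by
    rw [Matrix.trace_mul_comm, Matrix.mul_assoc]
  rw [c1, c2, c3, Matrix.trace_mul_comm (toepD F N γ θ) (toepD₂ F N α β θ)]
  ring

lemma expect_wirtinger_mul_wirtinger (hM : GaussianModel Θ P Z F) (hθ : θ ∈ Θ) (α β : Idx n) :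
    expect P Z θ N (fun z => wirtinger α (logLik P Z N z) θ * wirtinger β (logLik P Z N z) θ)
      = (toepD F N α θ * toepD F N β θ).trace := by
  have := hM.isProbabilityMeasure θ hθ N
  simp only [expect, hM.obsLaw_eq θ hθ, hM.wirtinger_logLik _ hθ]
  exact integral_quadForm_sub_mul (hM.posDef θ hθ N) _ _ _

lemma expect_wirtinger_wirtinger_mul_wirtinger (hM : GaussianModel Θ P Z F) (hθ : θ ∈ Θ)
    (α β γ : Idx n) :
    expect P Z θ N (fun z => wirtinger α (wirtinger β (logLik P Z N z)) θ
        * wirtinger γ (logLik P Z N z) θ)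
      = (toepD₂ F N α β θ * toepD F N γ θ).trace
        - (toepD F N α θ * toepD F N β θ * toepD F N γ θ).trace
        - (toepD F N β θ * toepD F N α θ * toepD F N γ θ).trace := by
  have := hM.isProbabilityMeasure θ hθ N
  simp only [expect, hM.obsLaw_eq θ hθ, hM.wirtinger_logLik _ hθ,
    hM.wirtinger_wirtinger_logLik _ hθ]
  rw [integral_quadForm_sub_mul (hM.posDef θ hθ N)]
  simp only [Matrix.sub_mul, Matrix.trace_sub]

lemma expect_wirtinger_mul_wirtinger_mul_wirtinger (hM : GaussianModel Θ P Z F) (hθ : θ ∈ Θ)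
    (α β γ : Idx n) :
    expect P Z θ N (fun z => wirtinger α (logLik P Z N z) θ * wirtinger β (logLik P Z N z) θ
        * wirtinger γ (logLik P Z N z) θ)
      = (toepD F N α θ * toepD F N β θ * toepD F N γ θ).trace
        + (toepD F N α θ * toepD F N γ θ * toepD F N β θ).trace := by
  have := hM.isProbabilityMeasure θ hθ N
  simp only [expect, hM.obsLaw_eq θ hθ, hM.wirtinger_logLik _ hθ]
  exact integral_quadForm_sub_mul_mul (hM.posDef θ hθ N) _ _ _

end Expectation

end GaussianModel

end ComplexARMA


theorem mainTheorem7 {Ω : Type*} [MeasurableSpace Ω] {n r s : ℕ}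
    (Θ : Set (Fin n → ℂ)) (hΘ : IsOpen Θ)
    (P : (Fin n → ℂ) → Measure Ω) (Z : (Fin n → ℂ) → ℤ → Ω → ℂ)
    (a : (Fin n → ℂ) → Fin r → ℂ) (b : (Fin n → ℂ) → Fin s → ℂ) (σ2 : (Fin n → ℂ) → ℝ)
    (ha : ContDiffOn ℝ 3 a Θ) (hb : ContDiffOn ℝ 3 b Θ) (hσ2 : ContDiffOn ℝ 3 σ2 Θ)
    (hARMA : ∀ θ ∈ Θ, IsARMA (P θ) (Z θ) (a θ) (b θ) (σ2 θ)) :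
    -- the derivatives in the parameter exist in the usual sense
    (∀ (N : ℕ) (z : Fin N → ℂ), ContDiffOn ℝ 3 (logLik P Z N z) Θ) ∧
    (∀ ω : ℝ, ContDiffOn ℝ 3 (fun θ => specFamily P Z θ ω) Θ) ∧
    (∀ θ ∈ Θ,
      -- the power spectral density is well defined
      Summable (autocov (P θ) (Z θ)) ∧
      ∀ α β γ : Idx n,
        -- the integrals that define the spectral quantities exist
        IntervalIntegrable
          (fun ω => S₁ (specFamily P Z) α θ ω * S₁ (specFamily P Z) β θ ω)
          volume (-Real.pi) Real.pi ∧
        IntervalIntegrable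
          (fun ω => S₁ (specFamily P Z) α θ ω * S₁ (specFamily P Z) β θ ω
            * S₁ (specFamily P Z) γ θ ω)
          volume (-Real.pi) Real.pi ∧
        IntervalIntegrable
          (fun ω => S₂ (specFamily P Z) α β θ ω * S₁ (specFamily P Z) γ θ ω)
          volume (-Real.pi) Real.pi ∧
        -- the expectations exist
        (∀ N : ℕ,
          Integrable (fun z => wirtinger α (logLik P Z N z) θ) (obsLaw (P θ) (Z θ) N) ∧
          Integrable (fun z => wirtinger α (wirtinger β (logLik P Z N z)) θ)
            (obsLaw (P θ) (Z θ) N) ∧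
          Integrable (fun z => wirtinger α (wirtinger β (wirtinger γ (logLik P Z N z))) θ)
            (obsLaw (P θ) (Z θ) N) ∧
          Integrable (fun z => wirtinger α (logLik P Z N z) θ * wirtinger β (logLik P Z N z) θ)
            (obsLaw (P θ) (Z θ) N) ∧
          Integrable (fun z => wirtinger α (wirtinger β (logLik P Z N z)) θ
            * wirtinger γ (logLik P Z N z) θ) (obsLaw (P θ) (Z θ) N) ∧
          Integrable (fun z => wirtinger α (logLik P Z N z) θ * wirtinger β (logLik P Z N z) θ
            * wirtinger γ (logLik P Z N z) θ) (obsLaw (P θ) (Z θ) N)) ∧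
        -- the six expansions
        (∀ N : ℕ,
          (1 / (N : ℂ)) * expect P Z θ N (fun z => wirtinger α (logLik P Z N z) θ) = 0) ∧
        (fun N : ℕ =>
          (1 / (N : ℂ)) * expect P Z θ N
              (fun z => wirtinger α (wirtinger β (logLik P Z N z)) θ)
            - (-fisherMetric (specFamily P Z) α β θ))
          =O[atTop] (fun N : ℕ => 1 / (N : ℝ)) ∧
        (fun N : ℕ =>
          (1 / (N : ℂ)) * expect P Z θ N
              (fun z => wirtinger α (wirtinger β (wirtinger γ (logLik P Z N z))) θ)
            - (-mConnection (specFamily P Z) α β γ θ - mConnection (specFamily P Z) β γ α θ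
                - mConnection (specFamily P Z) γ α β θ
                + 2 * skewness (specFamily P Z) α β γ θ))
          =O[atTop] (fun N : ℕ => 1 / (N : ℝ)) ∧
        (fun N : ℕ =>
          (1 / (N : ℂ)) * expect P Z θ N
              (fun z => wirtinger α (logLik P Z N z) θ * wirtinger β (logLik P Z N z) θ)
            - fisherMetric (specFamily P Z) α β θ)
          =O[atTop] (fun N : ℕ => 1 / (N : ℝ)) ∧
        (fun N : ℕ =>
          (1 / (N : ℂ)) * expect P Z θ N
              (fun z => wirtinger α (wirtinger β (logLik P Z N z)) θ
                * wirtinger γ (logLik P Z N z) θ)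
            - (mConnection (specFamily P Z) α β γ θ - skewness (specFamily P Z) α β γ θ))
          =O[atTop] (fun N : ℕ => 1 / (N : ℝ)) ∧
        (fun N : ℕ =>
          (1 / (N : ℂ)) * expect P Z θ N
              (fun z => wirtinger α (logLik P Z N z) θ * wirtinger β (logLik P Z N z) θ
                * wirtinger γ (logLik P Z N z) θ)
            - skewness (specFamily P Z) α β γ θ)
          =O[atTop] (fun N : ℕ => 1 / (N : ℝ))) := by
  have hM := gaussianModel_of_isARMA hΘ ha hb hσ2 hARMA
  refine ⟨fun N z => hM.contDiffOn_logLik z, hM.contDiffOn_specFamily, fun θ hθ =>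
    ⟨(hARMA θ hθ).summable_autocov, fun α β γ => ⟨?_, ?_, ?_, fun N => ?_, fun N => ?_,
      ?_, ?_, ?_, ?_, ?_⟩⟩⟩
  · simp only [hM.S₁_eq hθ]
    exact Continuous.intervalIntegrable (by fun_prop) _ _
  · simp only [hM.S₁_eq hθ]
    exact Continuous.intervalIntegrable (by fun_prop) _ _
  · simp only [hM.S₁_eq hθ, hM.S₂_eq hθ]
    exact Continuous.intervalIntegrable (by fun_prop) _ _
  · have hV := hM.posDef θ hθ N
    obtain ⟨K, k, -, h⟩ := hM.exists_wirtinger_wirtinger_wirtinger_logLik (N := N) hθ α β γ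
    simp only [hM.obsLaw_eq θ hθ, h, hM.wirtinger_wirtinger_logLik _ hθ, hM.wirtinger_logLik _ hθ]
    exact ⟨integrable_quadForm_sub hV _ _, integrable_quadForm_sub hV _ _,
      integrable_quadForm_sub hV _ _, integrable_quadForm_sub_mul hV _ _ _ _,
      integrable_quadForm_sub_mul hV _ _ _ _, integrable_quadForm_sub_mul_mul hV _ _ _ _ _ _⟩
  · rw [hM.expect_wirtinger hθ, mul_zero]
  · exact (hM.linearGrowth_trace₁₁ hθ α β).neg.isBigO
      (fun N => hM.expect_wirtinger_wirtinger hθ α β) (by rw [hM.fisherMetric_eq hθ])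
  · have h1 := hM.linearGrowth_trace₁₁₁ hθ α β γ
    have h2 := hM.linearGrowth_trace₁₁₁ hθ α γ β
    refine ((((hM.linearGrowth_trace₂₁ hθ α β γ).neg.sub (hM.linearGrowth_trace₂₁ hθ β γ α)).sub
      (hM.linearGrowth_trace₂₁ hθ α γ β)).add ((h1.add h1).add (h2.add h2))).isBigO
      (fun N => hM.expect_wirtinger_wirtinger_wirtinger hθ α β γ) ?_
    rw [hM.mConnection_eq hθ, hM.mConnection_eq hθ, hM.mConnection_eq hθ, hM.skewness_eq hθ,
      hM.logD₂_comm hθ γ α, mul_right_comm (logD _ α θ) (logD _ γ θ)]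
    ring
  · exact (hM.linearGrowth_trace₁₁ hθ α β).isBigO
      (fun N => hM.expect_wirtinger_mul_wirtinger hθ α β) (hM.fisherMetric_eq hθ α β)
  · refine (((hM.linearGrowth_trace₂₁ hθ α β γ).sub (hM.linearGrowth_trace₁₁₁ hθ α β γ)).sub
      (hM.linearGrowth_trace₁₁₁ hθ β α γ)).isBigO
      (fun N => hM.expect_wirtinger_wirtinger_mul_wirtinger hθ α β γ) ?_
    rw [hM.mConnection_eq hθ, hM.skewness_eq hθ, mul_comm (logD _ β θ) (logD _ α θ)]
    ring
  · refine ((hM.linearGrowth_trace₁₁₁ hθ α β γ).add (hM.linearGrowth_trace₁₁₁ hθ α γ β)).isBigO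
      (fun N => hM.expect_wirtinger_mul_wirtinger_mul_wirtinger hθ α β γ) ?_
    rw [hM.skewness_eq hθ, mul_right_comm (logD _ α θ) (logD _ γ θ)]
    ring
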